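/- Let $\mathbb{D}\subset\mathbb{C}$ be the open unit disk and let $\mathbb{G}=\{(w_1+w_2,w_1w_2): w_1,w_2\in\mathbb{D}\}\subset\mathbb{C}^2$ be the symmetrized bidisk, with Lebesgue measure $dv$. For a bounded domain $\Omega\subset\mathbb{C}^n$ let $B_\Omega(w,\eta)$ be its Bergman kernel, let the Bergman projection $\mathcal{B}_\Omega$ be the orthogonal projection of $L^2(\Omega)$ onto its subspace of square integrable holomorphic functions, and let the positive Bergman operator be $$\mathcal{B}^+_\Omega f(w)=\int_\Omega |B_\Omega(w,\eta)|\,f(\eta)\,dv(\eta).$$ Let $\delta(z_1,z_2)=-\log|z_1^2-4z_2|$ on $\mathbb{G}$. For $k\in\mathbb{N}$, $p\in(1,\infty)$ and $l\ge 0$, let $W^{k,p}(\mathbb{G},l\delta)$ be the space of functions on $\mathbb{G}$ whose weak derivatives of order at most $k$ exist as locally integrable functions and whose norm given by $$\|f\|^p_{W^{k,p}(\mathbb{G},l\delta)}=\sum_{|\alpha|\le k}\int_{\mathbb{G}}|D^\alpha_{z,\bar z}f|^p\,e^{-l\delta}\,dv=\sum_{|\alpha|\le k}\int_{\mathbb{G}}|D^\alpha_{z,\bar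 z}f|^p\,|z_1^2-4z_2|^{l}\,dv$$ is finite, where $D^\alpha_{z,\bar z}=\dfrac{\partial^{\alpha_1+\alpha_2+\alpha_3+\alpha_4}}{\partial z_1^{\alpha_1}\partial\bar z_1^{\alpha_2}\partial z_2^{\alpha_3}\partial\bar z_2^{\alpha_4}}$; write $W^{k,p}(\mathbb{G})=W^{k,p}(\mathbb{G},0)$. Theorem 1.1. Let $p\in(1,\infty)$. Suppose that there is a constant $C_0$ such that for every $w_2\in\mathbb{D}$ the operator $\mathcal{B}^+_{\mathbb{D}}$ is bounded from $L^p(\mathbb{D},|w_1-w_2|^2\,dA(w_1))$ to itself with norm at most $C_0$. Then for every positive integer $k$ the space $W^{k,p}(\mathbb{G})$ is contained in $L^2(\mathbb{G})$, and the Bergman projection $\mathcal{B}_{\mathbb{G}}$ is bounded from $W^{k,p}(\mathbb{G})$ to $W^{k,p}(\mathbb{G},\tfrac{3kp}{2}\delta)$: there is a constant $C$ such that for all $f\in W^{k,p}(\mathbb{G})$ $$\mathcal{B}_{\mathbb{G}}f\in W^{k,p}\big(\mathbb{G},\tfrac{3kp}{2}\delta\big),\qquad \|\mathcal{B}_{\mathbb{G}}f\|_{W^{k,p}(\mathbb{G},\frac{3kp}{2}\delta)}\le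 C\,\|f\|_{W^{k,p}(\mathbb{G})}.$$ -/

import Mathlib

open MeasureTheory Set
open scoped ENNReal NNReal ComplexConjugate

noncomputable section

namespace SymBidisk

/-! ## Bergman space, Bergman projection, Bergman kernel -/

section Bergman

variable {E : Type*} [NormedAddCommGroup E] [NormedSpace ℂ E] [MeasureSpace E]

/-- The Bergman space `A²(Ω)`, as the subspace of those classes in `L²(Ω)` that are represented by
a function holomorphic on `Ω`. -/
def bergmanSpace (Ω : Set E) : Submodule ℂ (Lp ℂ 2 (volume.restrict Ω)) where
  carrier := {f | ∃ F : E → ℂ, DifferentiableOn ℂ F Ω ∧ f =ᵐ[volume.restrict Ω] F}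
  add_mem' := by
    rintro f g ⟨F, hF, hf⟩ ⟨G, hG, hg⟩
    exact ⟨F + G, hF.add hG, (Lp.coeFn_add f g).trans (hf.add hg)⟩
  zero_mem' := ⟨0, differentiableOn_const 0, Lp.coeFn_zero ℂ 2 _⟩
  smul_mem' := by
    rintro c f ⟨F, hF, hf⟩
    exact ⟨c • F, hF.const_smul c, (Lp.coeFn_smul c f).trans (hf.const_smul c)⟩

/-- The Bergman projection of `Ω`: the orthogonal projection of `L²(Ω)` onto `A²(Ω)`, as an operator
from `L²(Ω)` to itself. For `Ω` open in `ℂⁿ` the subspace `A²(Ω)` is closed, so that taking its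
closure changes nothing; it only provides completeness. -/
def bergmanProjection (Ω : Set E) :
    Lp ℂ 2 (volume.restrict Ω) →L[ℂ] Lp ℂ 2 (volume.restrict Ω) :=
  (bergmanSpace Ω).topologicalClosure.starProjection

/-- `K` is a Bergman kernel of `Ω`: for `w ∈ Ω` the function `η ↦ conj (K w η)` is in `A²(Ω)`, and
`F w = ∫_Ω K(w, η) F(η) dv(η)` for all `F ∈ A²(Ω)`. These two properties determine `K` on
`Ω × Ω`. -/
structure IsBergmanKernel (Ω : Set E) (K : E → E → ℂ) : Prop where
  differentiableOn : ∀ w ∈ Ω, DifferentiableOn ℂ (fun η => conj (K w η)) Ω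
  memLp : ∀ w ∈ Ω, MemLp (fun η => conj (K w η)) 2 (volume.restrict Ω)
  reproducing : ∀ w ∈ Ω, ∀ F : E → ℂ, DifferentiableOn ℂ F Ω → MemLp F 2 (volume.restrict Ω) →
    F w = ∫ η in Ω, K w η * F η

open Classical in
/-- The Bergman kernel `B(w, η)` of `Ω` (it exists for every open `Ω` in `ℂⁿ`; only its values on
`Ω × Ω` are meaningful). -/
def bergmanKernel (Ω : Set E) : E → E → ℂ :=
  if h : ∃ K, IsBergmanKernel Ω K then h.choose else 0

/-- The positive Bergman operator `B⁺_Ω f (w) = ∫_Ω |B(w, η)| f(η) dv(η)`. -/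
def positiveBergman (Ω : Set E) (f : E → ℂ) (w : E) : ℂ :=
  ∫ η in Ω, ‖bergmanKernel Ω w η‖ • f η

/-- `B⁺_Ω` is a bounded operator from `L^p(Ω, σ)` to itself with norm at most `C`: for each
`f ∈ L^p(Ω, σ)` the integral defining `B⁺_Ω f (w)` converges absolutely for almost every `w`, and
`‖B⁺_Ω f‖ ≤ C ‖f‖` in `L^p(Ω, σ)`. -/
def PositiveBergmanBoundedBy (Ω : Set E) (σ : E → ℝ) (p : ℝ) (C : ℝ≥0) : Prop :=
  let μ : Measure E := (volume.restrict Ω).withDensity fun w => ENNReal.ofReal (σ w)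
  ∀ f : E → ℂ, MemLp f (ENNReal.ofReal p) μ →
    (∀ᵐ w ∂(volume.restrict Ω), IntegrableOn (fun η => ‖bergmanKernel Ω w η‖ • f η) Ω) ∧
    MemLp (positiveBergman Ω f) (ENNReal.ofReal p) μ ∧
    eLpNorm (positiveBergman Ω f) (ENNReal.ofReal p) μ ≤ C * eLpNorm f (ENNReal.ofReal p) μ

end Bergman

/-! ## The unit disk and the symmetrized bidisk -/

/-- The open unit disk `𝔻`. -/
def disk : Set ℂ := Metric.ball 0 1

/-- The symmetrization map `Φ(w₁, w₂) = (w₁ + w₂, w₁ w₂)`. -/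
def symMap (w : ℂ × ℂ) : ℂ × ℂ := (w.1 + w.2, w.1 * w.2)

/-- The symmetrized bidisk `𝔾 = Φ(𝔻 × 𝔻)`. -/
def symBidisk : Set (ℂ × ℂ) := symMap '' (disk ×ˢ disk)

/-- The weight exponent `δ(z₁, z₂) = -log |z₁² - 4 z₂|`. -/
def delta (z : ℂ × ℂ) : ℝ := -Real.log ‖z.1 ^ 2 - 4 * z.2‖

/-! ## Weighted Sobolev spaces on the symmetrized bidisk -/

/-- `∂φ/∂ζ` for the complex coordinate `ζ` in the direction `e`:
`(1/2) (∂/∂x - i ∂/∂y)`. -/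
def dHol (e : ℂ × ℂ) (φ : ℂ × ℂ → ℂ) (z : ℂ × ℂ) : ℂ :=
  (fderiv ℝ φ z e - Complex.I * fderiv ℝ φ z (Complex.I • e)) / 2

/-- `∂φ/∂ζ̄` for the complex coordinate `ζ` in the direction `e`:
`(1/2) (∂/∂x + i ∂/∂y)`. -/
def dBar (e : ℂ × ℂ) (φ : ℂ × ℂ → ℂ) (z : ℂ × ℂ) : ℂ :=
  (fderiv ℝ φ z e + Complex.I * fderiv ℝ φ z (Complex.I • e)) / 2

/-- The classical derivative `D^α = ∂^|α| / ∂z₁^α₁ ∂z̄₁^α₂ ∂z₂^α₃ ∂z̄₂^α₄` (indices in Lean from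
`0` to `3`), used on smooth functions only. -/
def wirtinger (α : Fin 4 → ℕ) (φ : ℂ × ℂ → ℂ) : ℂ × ℂ → ℂ :=
  (dHol (1, 0))^[α 0] ((dBar (1, 0))^[α 1] ((dHol (0, 1))^[α 2] ((dBar (0, 1))^[α 3] φ)))

/-- `v` is the weak derivative `D^α u` on the open set `Ω`. -/
structure HasWeakDeriv (Ω : Set (ℂ × ℂ)) (α : Fin 4 → ℕ) (u v : ℂ × ℂ → ℂ) : Prop where
  locallyIntegrableOn_fun : LocallyIntegrableOn u Ω
  locallyIntegrableOn_deriv : LocallyIntegrableOn v Ω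
  integral_eq : ∀ φ : ℂ × ℂ → ℂ, ContDiff ℝ (⊤ : ℕ∞) φ → HasCompactSupport φ → tsupport φ ⊆ Ω →
    ∫ z in Ω, u z * wirtinger α φ z = (-1) ^ (∑ i, α i) * ∫ z in Ω, v z * φ z

open Classical in
/-- The weak derivative `D^α u` on `Ω` (unique almost everywhere on `Ω` if it exists). -/
def weakDeriv (Ω : Set (ℂ × ℂ)) (α : Fin 4 → ℕ) (u : ℂ × ℂ → ℂ) : ℂ × ℂ → ℂ :=
  if h : ∃ v, HasWeakDeriv Ω α u v then h.choose else 0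

/-- The multi-indices `α = (α₁, α₂, α₃, α₄)` with `|α| ≤ k`. -/
def multiIndices (k : ℕ) : Finset (Fin 4 → ℕ) :=
  (Fintype.piFinset fun _ => Finset.range (k + 1)).filter fun α => ∑ i, α i ≤ k

/-- `∫_𝔾 |g|^p e^{-lδ} dv`. -/
def weightedIntegral (p l : ℝ) (g : ℂ × ℂ → ℂ) : ℝ≥0∞ :=
  ∫⁻ z in symBidisk, ‖g z‖ₑ ^ p * ENNReal.ofReal (Real.exp (-l * delta z))

/-- `f ∈ W^{k,p}(𝔾, lδ)`: the weak derivatives of `f` of order at most `k` exist on `𝔾` and lie in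
the weighted space `L^p(𝔾, lδ)`. For `l = 0` this is `W^{k,p}(𝔾)`. -/
def MemSobolev (k : ℕ) (p l : ℝ) (f : ℂ × ℂ → ℂ) : Prop :=
  ∀ α ∈ multiIndices k, (∃ v, HasWeakDeriv symBidisk α f v) ∧
    weightedIntegral p l (weakDeriv symBidisk α f) < ∞

/-- The norm of `W^{k,p}(𝔾, lδ)`. -/
def sobolevNorm (k : ℕ) (p l : ℝ) (f : ℂ × ℂ → ℂ) : ℝ≥0∞ :=
  (∑ α ∈ multiIndices k, weightedIntegral p l (weakDeriv symBidisk α f)) ^ (1 / p)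

end SymBidisk

end

noncomputable section

namespace SymBidisk

/-! ## The Bergman kernel of the disk -/

/-! The map `symMap` is a two-to-one branched cover of the symmetrized bidisk by the bidisk, with
Jacobian J = w₁ - w₂ and z₁² - 4z₂ = J². It pushes |J|² dv to twice Lebesgue measure, so L^p of the
symmetrized bidisk becomes the symmetric part of L^p(|J|²) on the bidisk. Multiplication by J
intertwines the two Bergman integrals (`jac_mul_integral_symKernel`), because `symKernel` is the
antisymmetrized bidisk kernel divided by the Jacobians. The problem thus moves to the bidisk, whose
kernel is a product.

The hypothesis, applied in w₁ and then in w₂, bounds the positive Bergman operator of the bidisk on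
L^p(|J|²). Two by-products matter. The kernel is bounded below, so boundedness embeds L^p(|J|²) into
L¹ (`exists_weighted_estimates`), and pullbacks are integrable without any Jacobian factor. Testing
on small disks about the zero of the weight forces p ≥ 2 (`two_le_of_positiveBergmanBoundedBy`),
whence W^{k,p} ⊂ L^p ⊂ L².

For derivatives, ∂_w of the disk kernel equals the transpose of ∂_η - η̄² ∂̄_η applied to the kernel
in η (`fderiv_bidiskKernelAux_eq_tangAdj`). This field is tangential to the circle, so integration
by parts leaves no boundary term: a holomorphic derivative of the Bergman integral of G is the
Bergman integral of a tangential derivative of G. If G is a smooth multiple of a pullback, the chain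
rule gives smooth multiples of pullbacks of derivatives of at most one order more. As f is only
Sobolev and `symMap` branches, the chain rule is proved by mollifying downstairs
(`HasWeakGrad.integral_comp_symMap_of_compact`); test functions that do not vanish at the boundary
are reached through radial cutoffs with bounded tangential derivatives
(`exists_bound_tang_bidiskCutoff`).

Derivatives on the symmetrized bidisk are recovered from those on the bidisk by solving a 2 × 2
system of determinant J. Each one costs J²: a derivative of order m is controlled after
multiplication by J^(2m+1) (`HasOrder.wder`). The target weight is |J|^(3kp), and 2m + 1 ≤ 3k when m
≤ k and k ≥ 1. All of this is done for families indexed by the whole Sobolev space, so the constants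
produced by induction do not depend on f. -/

/-- The explicit Bergman kernel of the disk. -/
def diskKernel (w η : ℂ) : ℂ := (Real.pi : ℂ)⁻¹ * ((1 - w * conj η) ^ 2)⁻¹

lemma mem_disk {w : ℂ} : w ∈ disk ↔ ‖w‖ < 1 := by simp [disk]

lemma isOpen_disk : IsOpen disk := Metric.isOpen_ball

lemma measurableSet_disk : MeasurableSet disk := isOpen_disk.measurableSet

lemma one_sub_mul_conj_ne_zero {w η : ℂ} (hw : ‖w‖ < 1) (hη : ‖η‖ ≤ 1) : 1 - w * conj η ≠ 0 := by
  intro h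
  have h1 : ‖w * conj η‖ < 1 := by
    rw [norm_mul, Complex.norm_conj]
    nlinarith [norm_nonneg w, norm_nonneg η]
  rw [← sub_eq_zero.mp h] at h1
  simp at h1

lemma conj_diskKernel (w η : ℂ) : conj (diskKernel w η) = diskKernel η w := by
  simp [diskKernel, mul_comm]

/-- On |η| = r one has r² = η η̄, hence η - w r² = η (1 - w η̄), and the integral is Cauchy's
formula for the derivative of z V(z) at w r². Only circles inside the disk occur, so V needs no
boundary regularity. -/
lemma diskKernel_integral_circle {V : ℂ → ℂ} (hV : DifferentiableOn ℂ V disk) {w : ℂ}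
    (hw : w ∈ disk) {r : ℝ} (hr0 : 0 < r) (hr1 : r < 1) :
    ∫ θ in (-Real.pi)..Real.pi, diskKernel w (circleMap 0 r θ) * V (circleMap 0 r θ) =
      2 * (V (w * r ^ 2) + w * r ^ 2 * deriv V (w * r ^ 2)) := by
  have hper : Function.Periodic
      (fun θ : ℝ => diskKernel w (circleMap 0 r θ) * V (circleMap 0 r θ)) (2 * Real.pi) := by
    intro θ; simp only [periodic_circleMap 0 r θ]
  have hshift := hper.intervalIntegral_add_eq (-Real.pi) 0
  rw [show -Real.pi + 2 * Real.pi = Real.pi by ring, zero_add] at hshift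
  rw [hshift]
  have hw' := mem_disk.1 hw
  have hw0 : ‖w * (r : ℂ) ^ 2‖ < r := by
    rw [norm_mul, norm_pow, Complex.norm_real, Real.norm_of_nonneg hr0.le]
    nlinarith [norm_nonneg w, mul_pos hr0 hr0]
  have hwd : w * (r : ℂ) ^ 2 ∈ disk := mem_disk.2 (hw0.trans hr1)
  have hc := Complex.two_pi_I_inv_smul_circleIntegral_sub_sq_inv_smul_of_differentiable
    (U := disk) isOpen_disk (c := 0) (R := r) (w₀ := w * (r : ℂ) ^ 2) (f := fun z => z * V z)
    (Metric.closedBall_subset_ball hr1) (differentiableOn_id.mul hV) (by simpa using hw0)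
  have hder : deriv (fun z => z * V z) (w * (r : ℂ) ^ 2) =
      V (w * r ^ 2) + w * r ^ 2 * deriv V (w * r ^ 2) := by
    have := (hasDerivAt_id (w * (r : ℂ) ^ 2)).mul
      (hV.differentiableAt (isOpen_disk.mem_nhds hwd)).hasDerivAt
    simpa [Function.comp_def] using (this.congr_of_eventuallyEq (f₁ := fun z => z * V z)
      (Filter.Eventually.of_forall fun _ => rfl)).deriv
  rw [hder] at hc
  rw [← hc]
  simp only [circleIntegral, deriv_circleMap, smul_eq_mul]
  have hfun : ∀ θ : ℝ, circleMap 0 r θ * Complex.I *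
      (((circleMap 0 r θ - w * (r : ℂ) ^ 2) ^ 2)⁻¹ * (circleMap 0 r θ * V (circleMap 0 r θ))) =
      Complex.I * Real.pi * (diskKernel w (circleMap 0 r θ) * V (circleMap 0 r θ)) := by
    intro θ
    have hη : ‖circleMap 0 r θ‖ = r := by simp [hr0.le]
    set η := circleMap 0 r θ
    have hη0 : η ≠ 0 := by rw [← norm_pos_iff, hη]; exact hr0
    have hr2 : (r : ℂ) ^ 2 = η * conj η := by
      rw [Complex.mul_conj, Complex.normSq_eq_norm_sq, hη]; push_cast; rfl
    have hne := one_sub_mul_conj_ne_zero hw' (hη ▸ hr1.le : ‖η‖ ≤ 1)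
    have : η - w * (r : ℂ) ^ 2 = η * (1 - w * conj η) := by rw [hr2]; ring
    rw [this, diskKernel]
    have hpi : (Real.pi : ℂ) ≠ 0 := by exact_mod_cast Real.pi_ne_zero
    field_simp
  simp_rw [hfun]
  rw [intervalIntegral.integral_const_mul]
  have hpi : (Real.pi : ℂ) ≠ 0 := by exact_mod_cast Real.pi_ne_zero
  have hI := Complex.I_ne_zero
  field_simp

lemma polarCoord_symm_eq_circleMap (p : ℝ × ℝ) :
    Complex.polarCoord.symm p = circleMap 0 p.1 p.2 := by
  rw [Complex.polarCoord_symm_apply, circleMap, Complex.exp_mul_I]; simp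

/-- Polar coordinates on the disk. -/
lemma integral_disk_polar {u : ℂ → ℂ} (hc : ContinuousOn u disk) (hu : IntegrableOn u disk) :
    ∫ η in disk, u η = ∫ r in Ioo (0 : ℝ) 1, ∫ θ in (-Real.pi)..Real.pi,
      (r : ℂ) * u (circleMap 0 r θ) := by
  set S : Set (ℝ × ℝ) := Ioo (0 : ℝ) 1 ×ˢ Ioo (-Real.pi) Real.pi
  have hS : MeasurableSet S := measurableSet_Ioo.prod measurableSet_Ioo
  have hmem : ∀ p ∈ polarCoord.target, (Complex.polarCoord.symm p ∈ disk ↔ p ∈ S) := by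
    rintro ⟨r, θ⟩ hp
    simp only [polarCoord_target, mem_prod, mem_Ioi, mem_Ioo] at hp
    rw [polarCoord_symm_eq_circleMap, mem_disk]
    simp [S, hp.1, hp.2.1, hp.2.2, abs_of_pos hp.1]
  have hsub : S ⊆ polarCoord.target := by
    rintro ⟨r, θ⟩ hp
    simp only [S, mem_prod, mem_Ioo] at hp
    simp [polarCoord_target, hp.1.1, hp.2]
  have hind : ∀ p ∈ polarCoord.target, p.1 • disk.indicator u (Complex.polarCoord.symm p) =
      S.indicator (fun p => (p.1 : ℂ) * u (circleMap 0 p.1 p.2)) p := by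
    intro p hp
    by_cases h : p ∈ S
    · rw [indicator_of_mem h, indicator_of_mem ((hmem p hp).2 h), polarCoord_symm_eq_circleMap]
      simp
    · rw [indicator_of_notMem h, indicator_of_notMem (fun h' => h ((hmem p hp).1 h'))]; simp
  have htarget : MeasurableSet polarCoord.target := polarCoord.open_target.measurableSet
  have hint : IntegrableOn (fun p : ℝ × ℝ => (p.1 : ℂ) * u (circleMap 0 p.1 p.2)) S := by
    have hmaps : MapsTo (fun p : ℝ × ℝ => circleMap 0 p.1 p.2) S disk := by
      rintro ⟨r, θ⟩ hp
      have := (hmem _ (hsub hp)).2 hp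
      rwa [polarCoord_symm_eq_circleMap] at this
    have hcm : Continuous (fun p : ℝ × ℝ => circleMap 0 p.1 p.2) := by
      unfold circleMap; fun_prop
    refine ⟨ContinuousOn.aestronglyMeasurable ?_ hS, ?_⟩
    · exact (by fun_prop : Continuous fun p : ℝ × ℝ => (p.1 : ℂ)).continuousOn.mul
        (hc.comp hcm.continuousOn hmaps)
    · rw [hasFiniteIntegral_iff_enorm]
      have h1 := Complex.lintegral_comp_polarCoord_symm (fun η => ‖disk.indicator u η‖ₑ)
      have h2 : ∫⁻ η, ‖disk.indicator u η‖ₑ < ∞ :=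
        (hu.integrable_indicator measurableSet_disk).2
      rw [← h1] at h2
      refine lt_of_le_of_lt ?_ h2
      refine (le_of_eq ?_).trans (lintegral_mono_set hsub)
      refine setLIntegral_congr_fun hS fun p hp => ?_
      rw [indicator_of_mem ((hmem _ (hsub hp)).2 hp), polarCoord_symm_eq_circleMap, enorm_mul,
        smul_eq_mul, ← ofReal_norm, Complex.norm_real, Real.norm_of_nonneg hp.1.1.le]
  rw [← integral_indicator measurableSet_disk, ← Complex.integral_comp_polarCoord_symm,
    setIntegral_congr_fun htarget hind, setIntegral_indicator hS, inter_eq_right.2 hsub,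
    Measure.volume_eq_prod, setIntegral_prod _ hint]
  refine setIntegral_congr_fun measurableSet_Ioo fun r _ => ?_
  simp only
  rw [intervalIntegral.integral_of_le (by linarith [Real.pi_pos]), integral_Ioc_eq_integral_Ioo]

/-- The reproducing property of the Bergman kernel of the disk. -/
theorem diskKernel_reproducing {V : ℂ → ℂ} (hV : DifferentiableOn ℂ V disk) {w : ℂ}
    (hw : w ∈ disk) (hi : IntegrableOn (fun η => diskKernel w η * V η) disk) :
    ∫ η in disk, diskKernel w η * V η = V w := by
  have hw' := mem_disk.1 hw
  have hc : ContinuousOn (fun η => diskKernel w η * V η) disk := by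
    refine ContinuousOn.mul ?_ hV.continuousOn
    unfold diskKernel
    refine continuousOn_const.mul (ContinuousOn.inv₀ (by fun_prop) fun η hη => ?_)
    exact pow_ne_zero _ (one_sub_mul_conj_ne_zero hw' (mem_disk.1 hη).le)
  rw [integral_disk_polar hc hi]
  have hmem : ∀ r ∈ uIcc (0 : ℝ) 1, w * (r : ℂ) ^ 2 ∈ disk := by
    intro r hr
    rw [uIcc_of_le zero_le_one] at hr
    rw [mem_disk, norm_mul, norm_pow, Complex.norm_real, Real.norm_of_nonneg hr.1]
    nlinarith [norm_nonneg w, pow_le_one₀ (n := 2) hr.1 hr.2]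
  have hV' : ContinuousOn (deriv V) disk := (hV.deriv isOpen_disk).continuousOn
  -- `φ` is the derivative of r² V(w r²), so the radial integral is the value of that function at r
  -- = 1, namely V(w).
  set φ : ℝ → ℂ := fun r => 2 * r * (V (w * r ^ 2) + w * r ^ 2 * deriv V (w * r ^ 2))
  have hinner : ∀ r ∈ Ioo (0 : ℝ) 1, ∫ θ in (-Real.pi)..Real.pi,
      (r : ℂ) * (diskKernel w (circleMap 0 r θ) * V (circleMap 0 r θ)) = φ r := by
    intro r hr
    rw [intervalIntegral.integral_const_mul, diskKernel_integral_circle hV hw hr.1 hr.2]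
    simp only [φ]; ring
  rw [setIntegral_congr_fun measurableSet_Ioo hinner, ← integral_Ioc_eq_integral_Ioo,
    ← intervalIntegral.integral_of_le zero_le_one]
  have hmap : Continuous fun r : ℝ => w * (r : ℂ) ^ 2 := by fun_prop
  have hφc : ContinuousOn φ (uIcc 0 1) := by
    refine ContinuousOn.mul (by fun_prop) (ContinuousOn.add ?_ (ContinuousOn.mul (by fun_prop) ?_))
    · exact hV.continuousOn.comp hmap.continuousOn hmem
    · exact hV'.comp hmap.continuousOn hmem
  have hder : ∀ r ∈ uIcc (0 : ℝ) 1, HasDerivAt (fun r : ℝ => (r : ℂ) ^ 2 * V (w * r ^ 2)) (φ r) r := by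
    intro r hr
    have hVr := (hV.differentiableAt (isOpen_disk.mem_nhds (hmem r hr))).hasDerivAt
    have h1 : HasDerivAt (fun z : ℂ => z ^ 2 * V (w * z ^ 2))
        (2 * r * V (w * r ^ 2) + r ^ 2 * (deriv V (w * r ^ 2) * (w * (2 * r)))) (r : ℂ) := by
      have hp : HasDerivAt (fun z : ℂ => z ^ 2) (2 * r) (r : ℂ) := by
        simpa using hasDerivAt_pow 2 (r : ℂ)
      exact hp.mul (HasDerivAt.comp (r : ℂ) (h₂ := V) hVr (hp.const_mul w))
    convert h1.comp_ofReal using 1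
    simp only [φ]; ring
  rw [intervalIntegral.integral_eq_sub_of_hasDerivAt hder hφc.intervalIntegrable]
  simp

lemma continuousOn_diskKernel {w : ℂ} (hw : w ∈ disk) :
    ContinuousOn (fun η => diskKernel w η) (Metric.closedBall 0 1) := by
  unfold diskKernel
  refine continuousOn_const.mul (ContinuousOn.inv₀ (by fun_prop) fun η hη => ?_)
  exact pow_ne_zero _ (one_sub_mul_conj_ne_zero (mem_disk.1 hw) (by simpa using hη))

lemma differentiableOn_conj_diskKernel {w : ℂ} (hw : w ∈ disk) :
    DifferentiableOn ℂ (fun η => conj (diskKernel w η)) disk := by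
  simp only [conj_diskKernel]
  unfold diskKernel
  refine DifferentiableOn.const_mul (DifferentiableOn.inv (by fun_prop) fun η hη => ?_) _
  exact pow_ne_zero _ (one_sub_mul_conj_ne_zero (mem_disk.1 hη) (mem_disk.1 hw).le)

instance : IsFiniteMeasure (volume.restrict disk) :=
  ⟨by
    rw [Measure.restrict_apply_univ]
    exact Metric.isBounded_ball.measure_lt_top⟩

lemma memLp_conj_diskKernel {w : ℂ} (hw : w ∈ disk) (q : ℝ≥0∞) :
    MemLp (fun η => conj (diskKernel w η)) q (volume.restrict disk) := by
  have hc := continuousOn_diskKernel hw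
  obtain ⟨M, hM⟩ := (isCompact_closedBall (0 : ℂ) 1).exists_bound_of_continuousOn hc
  refine MemLp.of_bound (C := M) ?_ ?_
  · exact (Complex.continuous_conj.comp_continuousOn
      (hc.mono Metric.ball_subset_closedBall)).aestronglyMeasurable measurableSet_disk
  · filter_upwards [ae_restrict_mem measurableSet_disk] with η hη
    simpa using hM η (Metric.ball_subset_closedBall hη)

theorem isBergmanKernel_diskKernel : IsBergmanKernel disk diskKernel where
  differentiableOn _ hw := differentiableOn_conj_diskKernel hw
  memLp _ hw := memLp_conj_diskKernel hw 2
  reproducing w hw F hF hF2 := by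
    refine (diskKernel_reproducing hF hw ?_).symm
    have := (memLp_conj_diskKernel hw 2).star.integrable_mul hF2
    simpa [Pi.mul_def, IntegrableOn] using this

/-- `bergmanKernel` is obtained by choice, so it must be identified: two reproducing kernels applied
to each other's conjugates give the same integral up to conjugation. -/
theorem bergmanKernel_disk {w η : ℂ} (hw : w ∈ disk) (hη : η ∈ disk) :
    bergmanKernel disk w η = diskKernel w η := by
  have hex : ∃ K, IsBergmanKernel disk K := ⟨_, isBergmanKernel_diskKernel⟩
  have hK : IsBergmanKernel disk (bergmanKernel disk) := by
    rw [bergmanKernel, dif_pos hex]; exact hex.choose_spec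
  have h1 := isBergmanKernel_diskKernel.reproducing η hη _ (hK.differentiableOn w hw) (hK.memLp w hw)
  have h2 := hK.reproducing w hw _ (isBergmanKernel_diskKernel.differentiableOn η hη)
    (isBergmanKernel_diskKernel.memLp η hη)
  have h3 : bergmanKernel disk w η =
      conj (∫ ζ in disk, diskKernel η ζ * conj (bergmanKernel disk w ζ)) := by
    rw [← h1, Complex.conj_conj]
  rw [h3, ← integral_conj, ← conj_diskKernel, h2]
  refine integral_congr_ae (Filter.Eventually.of_forall fun ζ => ?_)
  simp [mul_comm]

/-! ## Weighted estimates on the bidisk -/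

lemma lintegral_rpow_enorm_weight {p : ℝ} (hp : 1 < p) (w₂ : ℂ) {f : ℂ → ℂ}
    (hf : AEMeasurable f (volume.restrict disk)) :
    eLpNorm f (ENNReal.ofReal p)
      ((volume.restrict disk).withDensity fun w => ENNReal.ofReal (‖w - w₂‖ ^ 2)) ^ p =
      ∫⁻ w in disk, ‖f w‖ₑ ^ p * ‖w - w₂‖ₑ ^ 2 := by
  have hp0 : 0 < p := by linarith
  rw [eLpNorm_eq_lintegral_rpow_enorm_toReal (by simpa using hp0) (by simp),
    ENNReal.toReal_ofReal hp0.le, ← ENNReal.rpow_mul, one_div_mul_cancel hp0.ne', ENNReal.rpow_one,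
    lintegral_withDensity_eq_lintegral_mul₀ (by fun_prop) (by fun_prop)]
  refine lintegral_congr fun w => ?_
  rw [Pi.mul_apply, mul_comm, ENNReal.ofReal_pow (norm_nonneg _), ofReal_norm]

lemma ae_ne_restrict (w₂ : ℂ) (s : Set ℂ) : ∀ᵐ w ∂(volume.restrict s), w ≠ w₂ :=
  ae_restrict_of_ae (by simp [ae_iff])

/-- The boundedness of the positive Bergman operator, as an inequality of Lebesgue integrals. -/
lemma lintegral_diskKernel_le {p : ℝ} (hp : 1 < p) {C : ℝ≥0} {w₂ : ℂ}
    (hB : PositiveBergmanBoundedBy disk (fun w₁ => ‖w₁ - w₂‖ ^ 2) p C) {u : ℂ → ℝ≥0∞}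
    (hu : Measurable u) :
    ∫⁻ w in disk, (∫⁻ η in disk, ‖diskKernel w η‖ₑ * u η) ^ p * ‖w - w₂‖ₑ ^ 2 ≤
      ((C : ℝ≥0∞) + 1) ^ p * ∫⁻ w in disk, u w ^ p * ‖w - w₂‖ₑ ^ 2 := by
  have hp0 : 0 < p := by linarith
  -- With the constant `C + 1`, which is never zero, the right side really is `∞` in this case.
  by_cases htop : ∫⁻ w in disk, u w ^ p * ‖w - w₂‖ₑ ^ 2 = ∞
  · rw [htop, ENNReal.mul_top]
    · exact le_top
    · exact (ENNReal.rpow_pos_of_nonneg (by simp) hp0.le).ne'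
  have hfin : ∀ᵐ w ∂(volume.restrict disk), u w ≠ ∞ := by
    have h1 := ae_lt_top (by fun_prop) htop
    filter_upwards [h1, ae_ne_restrict w₂ disk] with w hw hne hw'
    rw [hw', ENNReal.top_rpow_of_pos hp0, ENNReal.top_mul] at hw
    · exact hw.ne rfl
    · simpa [sub_eq_zero] using hne
  set f : ℂ → ℂ := fun w => ((u w).toReal : ℂ)
  have hfm : Measurable f := by fun_prop
  have hfu : ∀ᵐ w ∂(volume.restrict disk), ‖f w‖ₑ = u w := by
    filter_upwards [hfin] with w hw
    simp only [f]
    rw [← ofReal_norm, Complex.norm_real, Real.norm_of_nonneg ENNReal.toReal_nonneg,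
      ENNReal.ofReal_toReal hw]
  set μ : Measure ℂ := (volume.restrict disk).withDensity fun w => ENNReal.ofReal (‖w - w₂‖ ^ 2)
  have hnorm : eLpNorm f (ENNReal.ofReal p) μ ^ p = ∫⁻ w in disk, u w ^ p * ‖w - w₂‖ₑ ^ 2 := by
    rw [lintegral_rpow_enorm_weight hp w₂ hfm.aemeasurable]
    refine lintegral_congr_ae ?_
    filter_upwards [hfu] with w hw
    rw [hw]
  have hmem : MemLp f (ENNReal.ofReal p) μ := by
    refine ⟨hfm.aestronglyMeasurable, ?_⟩
    by_contra h
    rw [not_lt, top_le_iff] at h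
    rw [h, ENNReal.top_rpow_of_pos hp0] at hnorm
    exact htop hnorm.symm
  obtain ⟨hint, hm, hle⟩ := hB f hmem
  -- The weight vanishes only at `w₂`, so measurability for the weighted measure gives measurability
  -- for Lebesgue measure.
  have hac : volume.restrict disk ≪ μ := by
    refine withDensity_absolutelyContinuous' (by fun_prop) ?_
    filter_upwards [ae_ne_restrict w₂ disk] with w hw
    simp [sub_eq_zero, hw]
  have hpb : ∀ᵐ w ∂(volume.restrict disk),
      ‖positiveBergman disk f w‖ₑ = ∫⁻ η in disk, ‖diskKernel w η‖ₑ * u η := by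
    filter_upwards [hint, ae_restrict_mem measurableSet_disk] with w hw hwd
    have h1 : positiveBergman disk f w =
        ((∫ η in disk, ‖bergmanKernel disk w η‖ * (u η).toReal : ℝ) : ℂ) := by
      rw [positiveBergman, ← integral_complex_ofReal]
      refine integral_congr_ae (Filter.Eventually.of_forall fun η => ?_)
      simp [f]
    have h2 : Integrable (fun η => ‖bergmanKernel disk w η‖ * (u η).toReal)
        (volume.restrict disk) := by
      refine hw.norm.congr (Filter.Eventually.of_forall fun η => ?_)
      simp [f]
    have h0 : 0 ≤ ∫ η in disk, ‖bergmanKernel disk w η‖ * (u η).toReal :=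
      integral_nonneg fun η => mul_nonneg (norm_nonneg _) ENNReal.toReal_nonneg
    rw [h1, ← ofReal_norm, Complex.norm_real, Real.norm_of_nonneg h0,
      ofReal_integral_eq_lintegral_ofReal h2
        (Filter.Eventually.of_forall fun η => mul_nonneg (norm_nonneg _) ENNReal.toReal_nonneg)]
    refine lintegral_congr_ae ?_
    filter_upwards [hfin, ae_restrict_mem measurableSet_disk] with η hη hηd
    rw [ENNReal.ofReal_mul (norm_nonneg _), ENNReal.ofReal_toReal hη, ofReal_norm,
      bergmanKernel_disk hwd hηd]
  have hle' := ENNReal.rpow_le_rpow hle hp0.le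
  have hpm : AEMeasurable (positiveBergman disk f) (volume.restrict disk) :=
    (hm.1.aemeasurable).mono_ac hac
  rw [ENNReal.mul_rpow_of_nonneg _ _ hp0.le, hnorm, lintegral_rpow_enorm_weight hp w₂ hpm] at hle'
  calc _ = ∫⁻ w in disk, ‖positiveBergman disk f w‖ₑ ^ p * ‖w - w₂‖ₑ ^ 2 := by
        refine lintegral_congr_ae ?_
        filter_upwards [hpb] with w hw
        rw [hw]
    _ ≤ _ := hle'
    _ ≤ _ := by gcongr; exact le_self_add

/-! ### The bidisk and the iterated one-variable estimate -/

/-- The unit bidisk. -/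
def bidisk : Set (ℂ × ℂ) := Metric.ball 0 1

lemma bidisk_eq : bidisk = disk ×ˢ disk := by
  rw [bidisk, disk, ball_prod_same]; rfl

lemma mem_bidisk {w : ℂ × ℂ} : w ∈ bidisk ↔ ‖w.1‖ < 1 ∧ ‖w.2‖ < 1 := by
  rw [bidisk_eq, mem_prod, mem_disk, mem_disk]

lemma isOpen_bidisk : IsOpen bidisk := Metric.isOpen_ball

lemma measurableSet_bidisk : MeasurableSet bidisk := isOpen_bidisk.measurableSet

lemma volume_restrict_bidisk :
    volume.restrict bidisk = (volume.restrict disk).prod (volume.restrict disk) := by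
  rw [bidisk_eq, Measure.volume_eq_prod, Measure.prod_restrict]

instance : IsFiniteMeasure (volume.restrict bidisk) :=
  ⟨by
    rw [Measure.restrict_apply_univ]
    exact Metric.isBounded_ball.measure_lt_top⟩

/-- The Bergman kernel of the bidisk. -/
def bidiskKernel (w η : ℂ × ℂ) : ℂ := diskKernel w.1 η.1 * diskKernel w.2 η.2

/-- The Jacobian determinant of the symmetrization map. -/
def jac (w : ℂ × ℂ) : ℂ := w.1 - w.2

@[fun_prop]
lemma Measurable.diskKernel {X : Type*} [MeasurableSpace X] {f g : X → ℂ} (hf : Measurable f)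
    (hg : Measurable g) : Measurable fun x => diskKernel (f x) (g x) := by
  unfold SymBidisk.diskKernel
  exact (((hf.mul (Complex.continuous_conj.measurable.comp hg)).const_sub 1).pow_const 2).inv.const_mul _

@[fun_prop]
lemma Measurable.bidiskKernel {X : Type*} [MeasurableSpace X] {f g : X → ℂ × ℂ}
    (hf : Measurable f) (hg : Measurable g) : Measurable fun x => bidiskKernel (f x) (g x) := by
  unfold SymBidisk.bidiskKernel
  exact (Measurable.diskKernel hf.fst hg.fst).mul (Measurable.diskKernel hf.snd hg.snd)

@[fun_prop]
lemma measurable_jac : Measurable jac := by unfold jac; fun_prop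

/-- The product kernel is a composition of two one-variable operators. The hypothesis is used in w₁
with w₂ frozen and, after exchanging the integrals, in w₂ with w₁ frozen; this works because |w₁ -
w₂|² is symmetric and `C` is uniform in the frozen variable. -/
lemma lintegral_bidiskKernel_le {p : ℝ} (hp : 1 < p) {C : ℝ≥0}
    (hB : ∀ w₂ ∈ disk, PositiveBergmanBoundedBy disk (fun w₁ => ‖w₁ - w₂‖ ^ 2) p C)
    {u : ℂ × ℂ → ℝ≥0∞} (hu : Measurable u) :
    ∫⁻ w in bidisk, (∫⁻ η in bidisk, ‖bidiskKernel w η‖ₑ * u η) ^ p * ‖jac w‖ₑ ^ 2 ≤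
      ((C : ℝ≥0∞) + 1) ^ p * (((C : ℝ≥0∞) + 1) ^ p *
        ∫⁻ w in bidisk, u w ^ p * ‖jac w‖ₑ ^ 2) := by
  have hp0 : 0 < p := by linarith
  obtain ⟨v, hv⟩ : ∃ v : ℂ → ℂ → ℝ≥0∞,
      v = fun η₁ w₂ => ∫⁻ η₂ in disk, ‖diskKernel w₂ η₂‖ₑ * u (η₁, η₂) := ⟨_, rfl⟩
  have hvm : Measurable (fun q : ℂ × ℂ => v q.1 q.2) := by
    rw [hv]
    refine Measurable.lintegral_prod_right' (f := fun (q : (ℂ × ℂ) × ℂ) =>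
      ‖diskKernel q.1.2 q.2‖ₑ * u (q.1.1, q.2)) ?_
    fun_prop
  have hinner : ∀ w : ℂ × ℂ, ∫⁻ η in bidisk, ‖bidiskKernel w η‖ₑ * u η =
      ∫⁻ η₁ in disk, ‖diskKernel w.1 η₁‖ₑ * v η₁ w.2 := by
    intro w
    rw [volume_restrict_bidisk, lintegral_prod _ (by fun_prop)]
    refine lintegral_congr fun η₁ => ?_
    rw [hv, ← lintegral_const_mul]
    · simp only [bidiskKernel, enorm_mul, mul_assoc]
    · fun_prop
  simp only [hinner]
  have hvm' : Measurable fun q : ℂ × ℂ => v q.2 q.1 := hvm.comp measurable_swap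
  have hm1 : Measurable fun w : ℂ × ℂ => ∫⁻ η₁ in disk, ‖diskKernel w.1 η₁‖ₑ * v η₁ w.2 := by
    refine Measurable.lintegral_prod_right' (f := fun (q : (ℂ × ℂ) × ℂ) =>
      ‖diskKernel q.1.1 q.2‖ₑ * v q.2 q.1.2) ?_
    exact (by fun_prop : Measurable fun q : (ℂ × ℂ) × ℂ => ‖diskKernel q.1.1 q.2‖ₑ).mul
      (hvm.comp (by fun_prop : Measurable fun q : (ℂ × ℂ) × ℂ => (q.2, q.1.2)))
  have hA : ((C : ℝ≥0∞) + 1) ^ p ≠ ∞ := by simp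
  generalize hAe : ((C : ℝ≥0∞) + 1) ^ p = A at hA ⊢
  have hvj : Measurable fun q : ℂ × ℂ => v q.1 q.2 ^ p * ‖jac q‖ₑ ^ 2 := by fun_prop
  calc ∫⁻ w in bidisk, (∫⁻ η₁ in disk, ‖diskKernel w.1 η₁‖ₑ * v η₁ w.2) ^ p * ‖jac w‖ₑ ^ 2
      = ∫⁻ w₂ in disk, ∫⁻ w₁ in disk,
          (∫⁻ η₁ in disk, ‖diskKernel w₁ η₁‖ₑ * v η₁ w₂) ^ p * ‖w₁ - w₂‖ₑ ^ 2 := by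
        rw [volume_restrict_bidisk, lintegral_prod_symm _ (by fun_prop)]
        simp only [jac]
    _ ≤ ∫⁻ w₂ in disk, A *
          ∫⁻ w₁ in disk, v w₁ w₂ ^ p * ‖w₁ - w₂‖ₑ ^ 2 :=
        setLIntegral_mono' measurableSet_disk fun w₂ hw₂ =>
          hAe ▸ lintegral_diskKernel_le hp (hB w₂ hw₂)
            (hvm.comp (by fun_prop : Measurable fun w₁ => (w₁, w₂)))
    _ = A *
          ∫⁻ w₁ in disk, ∫⁻ w₂ in disk, v w₁ w₂ ^ p * ‖w₂ - w₁‖ₑ ^ 2 := by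
        rw [lintegral_const_mul' _ _ hA, lintegral_lintegral_swap]
        · simp_rw [enorm_sub_rev]
        · exact (hvm'.pow_const p |>.mul (by fun_prop)).aemeasurable
    _ ≤ A * ∫⁻ w₁ in disk, A *
          ∫⁻ w₂ in disk, u (w₁, w₂) ^ p * ‖w₂ - w₁‖ₑ ^ 2 := by
        gcongr A * ?_
        refine setLIntegral_mono' measurableSet_disk fun w₁ hw₁ => ?_
        rw [hv]
        exact hAe ▸ lintegral_diskKernel_le hp (hB w₁ hw₁)
          (hu.comp (by fun_prop : Measurable fun w₂ => (w₁, w₂)))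
    _ = _ := by
        rw [lintegral_const_mul' _ _ hA, volume_restrict_bidisk, lintegral_prod _ (by fun_prop)]
        simp_rw [jac, enorm_sub_rev]

/-! ### Lower bounds for the kernel, the L¹ embedding and p ≥ 2 -/

lemma le_norm_diskKernel {w η : ℂ} (hw : w ∈ disk) (hη : η ∈ disk) :
    (4 * Real.pi)⁻¹ ≤ ‖diskKernel w η‖ := by
  have hw' := mem_disk.1 hw
  have hη' := mem_disk.1 hη
  have hne : 0 < ‖1 - w * conj η‖ := norm_pos_iff.2 (one_sub_mul_conj_ne_zero hw' hη'.le)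
  have h2 : ‖1 - w * conj η‖ ≤ 2 := by
    refine (norm_sub_le _ _).trans ?_
    rw [norm_mul, Complex.norm_conj, norm_one]
    nlinarith [norm_nonneg w, norm_nonneg η]
  rw [diskKernel, norm_mul, norm_inv, norm_inv, norm_pow, Complex.norm_real,
    Real.norm_of_nonneg Real.pi_pos.le, ← mul_inv]
  refine inv_anti₀ (by positivity) ?_
  have h4 : ‖1 - w * conj η‖ ^ 2 ≤ 4 := by nlinarith
  nlinarith [Real.pi_pos]

/-- If |K| ≥ c, then the positive operator applied to u is at least c ∫ u at every point of s. An
upper bound for the operator therefore bounds the plain integral of u. -/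
lemma lintegral_rpow_le_of_kernel {X : Type*} [MeasurableSpace X] {μ : Measure X}
    {K : X → X → ℂ} {c : ℝ} {s : Set X} (hs : MeasurableSet s)
    (hK : ∀ w ∈ s, ∀ η ∈ s, c ≤ ‖K w η‖) {p : ℝ} (hp : 0 < p) (σ : X → ℝ≥0∞) (hσ : Measurable σ)
    (u : X → ℝ≥0∞) (hu : Measurable u) :
    (∫⁻ η in s, u η ∂μ) ^ p * (ENNReal.ofReal c ^ p * ∫⁻ w in s, σ w ∂μ) ≤
      ∫⁻ w in s, (∫⁻ η in s, ‖K w η‖ₑ * u η ∂μ) ^ p * σ w ∂μ := by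
  rw [← mul_assoc, ← lintegral_const_mul _ hσ]
  refine setLIntegral_mono' hs fun w hw => ?_
  gcongr
  rw [mul_comm, ← ENNReal.mul_rpow_of_nonneg _ _ hp.le, ← lintegral_const_mul _ hu]
  refine ENNReal.rpow_le_rpow (setLIntegral_mono' hs fun η hη => ?_) hp.le
  gcongr
  rw [← ofReal_norm]
  exact ENNReal.ofReal_le_ofReal (hK w hw η hη)

lemma le_norm_bidiskKernel {w η : ℂ × ℂ} (hw : w ∈ bidisk) (hη : η ∈ bidisk) :
    (4 * Real.pi)⁻¹ * (4 * Real.pi)⁻¹ ≤ ‖bidiskKernel w η‖ := by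
  rw [bidisk_eq] at hw hη
  rw [bidiskKernel, norm_mul]
  exact mul_le_mul (le_norm_diskKernel hw.1 hη.1) (le_norm_diskKernel hw.2 hη.2)
    (by have := Real.pi_pos; positivity) (norm_nonneg _)

lemma volume_jac_eq_zero : ∀ᵐ w : ℂ × ℂ, jac w ≠ 0 := by
  rw [Measure.volume_eq_prod, Measure.ae_prod_iff_ae_ae]
  · refine Filter.Eventually.of_forall fun x => ?_
    have : ∀ᵐ y : ℂ, y ≠ x := by simp [ae_iff]
    filter_upwards [this] with y hy
    simpa [jac, sub_eq_zero] using hy.symm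
  · exact measurable_jac (MeasurableSet.compl (measurableSet_singleton 0))

lemma lintegral_jac_ne_zero : ∫⁻ w in bidisk, ‖jac w‖ₑ ^ 2 ≠ 0 := by
  intro h
  rw [lintegral_eq_zero_iff (by fun_prop)] at h
  have h2 := h.and (ae_restrict_of_ae (s := bidisk) volume_jac_eq_zero)
  have h3 : ∀ᵐ w ∂(volume.restrict bidisk), False := by
    filter_upwards [h2] with w hw
    exact hw.2 (by simpa using hw.1)
  rw [Filter.eventually_false_iff_eq_bot, ae_eq_bot, Measure.restrict_eq_zero] at h3
  exact (isOpen_bidisk.measure_pos _ ⟨0, by simp [bidisk]⟩).ne' h3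

/-- The constants of the weighted estimates on the bidisk: boundedness of the positive Bergman
operator on `L^p(bidisk, |J|²)`, and the resulting embedding into `L¹`. -/
theorem exists_weighted_estimates {p : ℝ} (hp : 1 < p) {C : ℝ≥0}
    (hB : ∀ w₂ ∈ disk, PositiveBergmanBoundedBy disk (fun w₁ => ‖w₁ - w₂‖ ^ 2) p C) :
    ∃ A : ℝ≥0, (∀ u : ℂ × ℂ → ℝ≥0∞, Measurable u →
      ∫⁻ w in bidisk, (∫⁻ η in bidisk, ‖bidiskKernel w η‖ₑ * u η) ^ p * ‖jac w‖ₑ ^ 2 ≤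
        A * ∫⁻ w in bidisk, u w ^ p * ‖jac w‖ₑ ^ 2) ∧
      (∀ u : ℂ × ℂ → ℝ≥0∞, Measurable u → (∫⁻ η in bidisk, u η) ^ p ≤
        A * ∫⁻ w in bidisk, u w ^ p * ‖jac w‖ₑ ^ 2) := by
  have hp0 : 0 < p := by linarith
  have hpi := Real.pi_pos
  have hA : ((C : ℝ≥0∞) + 1) ^ p ≠ ∞ := by simp
  have h1 := fun u (hu : Measurable u) => lintegral_bidiskKernel_le hp hB hu
  generalize ((C : ℝ≥0∞) + 1) ^ p = B at hA h1
  lift B to ℝ≥0 using hA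
  -- `D` is the factor of (∫ u)^p supplied by `lintegral_rpow_le_of_kernel`; dividing by it requires
  -- 0 < D < ∞.
  obtain ⟨D, hD⟩ : ∃ D, D = ENNReal.ofReal ((4 * Real.pi)⁻¹ * (4 * Real.pi)⁻¹) ^ p *
    ∫⁻ w in bidisk, ‖jac w‖ₑ ^ 2 := ⟨_, rfl⟩
  have hD0 : D ≠ 0 := by
    rw [hD]
    refine mul_ne_zero ?_ lintegral_jac_ne_zero
    exact (ENNReal.rpow_pos (ENNReal.ofReal_pos.2 (by positivity)) (by simp)).ne'
  have h2 : ∀ u : ℂ × ℂ → ℝ≥0∞, Measurable u → (∫⁻ η in bidisk, u η) ^ p ≤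
      D⁻¹ * (B * B) * ∫⁻ w in bidisk, u w ^ p * ‖jac w‖ₑ ^ 2 := by
    intro u hu
    have h3 := (lintegral_rpow_le_of_kernel measurableSet_bidisk
      (fun w hw η hη => le_norm_bidiskKernel hw hη) hp0 (fun w => ‖jac w‖ₑ ^ 2) (by fun_prop)
      u hu).trans (h1 u hu)
    rw [← hD, ← mul_assoc] at h3
    have hDtop : D ≠ ∞ := by
      rw [hD]
      refine ENNReal.mul_ne_top (by simp [hp0.le]) ?_
      have hle : ∫⁻ w in bidisk, ‖jac w‖ₑ ^ 2 ≤ ∫⁻ w in bidisk, 4 := by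
        refine setLIntegral_mono' measurableSet_bidisk fun w hw => ?_
        have h := mem_bidisk.1 hw
        have : ‖jac w‖ₑ ≤ 2 := by
          rw [← ofReal_norm, jac]
          refine ENNReal.ofReal_le_of_le_toReal ?_
          simpa using (norm_sub_le _ _).trans (by linarith)
        calc ‖jac w‖ₑ ^ 2 ≤ 2 ^ 2 := by gcongr
          _ = 4 := by norm_num
      refine (hle.trans_lt ?_).ne
      rw [lintegral_const]
      exact ENNReal.mul_lt_top (by simp) (measure_lt_top _ _)
    rw [mul_assoc, mul_comm D⁻¹, ← div_eq_mul_inv,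
      ENNReal.le_div_iff_mul_le (Or.inl hD0) (Or.inl hDtop)]
    exact h3
  have hE : D⁻¹ * (B * B : ℝ≥0∞) ≠ ∞ := ENNReal.mul_ne_top (by simpa using hD0) (by finiteness)
  generalize D⁻¹ * (B * B : ℝ≥0∞) = E at h2 hE
  lift E to ℝ≥0 using hE
  refine ⟨B * B + E, fun u hu => ?_, fun u hu => ?_⟩
  · refine (h1 u hu).trans ?_
    rw [← mul_assoc]
    gcongr
    push_cast
    exact le_self_add
  · refine (h2 u hu).trans ?_
    gcongr
    exact le_add_self

/-- The hypothesis on the positive Bergman operator forces `p ≥ 2`. -/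
theorem two_le_of_positiveBergmanBoundedBy {p : ℝ} (hp : 1 < p) {C : ℝ≥0}
    (hB : PositiveBergmanBoundedBy disk (fun w₁ => ‖w₁ - 0‖ ^ 2) p C) : 2 ≤ p := by
  have hp0 : 0 < p := by linarith
  have hpi := Real.pi_pos
  by_contra! hlt
  have hA : ((C : ℝ≥0∞) + 1) ^ p ≠ ∞ := by simp
  obtain ⟨D, hD⟩ : ∃ D, D = ENNReal.ofReal ((4 * Real.pi)⁻¹) ^ p *
    ∫⁻ w in disk, ‖w - 0‖ₑ ^ 2 := ⟨_, rfl⟩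
  have hD0 : D ≠ 0 := by
    rw [hD]
    refine mul_ne_zero (ENNReal.rpow_pos (ENNReal.ofReal_pos.2 (by positivity)) (by simp)).ne' ?_
    intro h
    rw [lintegral_eq_zero_iff (by fun_prop)] at h
    have h3 : ∀ᵐ w ∂(volume.restrict disk), False := by
      filter_upwards [h, ae_ne_restrict 0 disk] with w hw hw'
      exact hw' (by simpa using hw)
    rw [Filter.eventually_false_iff_eq_bot, ae_eq_bot, Measure.restrict_eq_zero] at h3
    exact (isOpen_disk.measure_pos _ ⟨0, by simp [disk]⟩).ne' h3
  -- The test function is the indicator of the disk of radius ε about the zero of the weight. The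
  -- left side scales like ε^(2p) and the right side like ε⁴, which is impossible as ε → 0 if p < 2.
  have key : ∀ ε : ℝ, 0 < ε → ε < 1 → ENNReal.ofReal (Real.pi * ε ^ 2) ^ p * D ≤
      ((C : ℝ≥0∞) + 1) ^ p * ENNReal.ofReal (Real.pi * ε ^ 4) := by
    intro ε hε hε1
    have hsub : Metric.ball (0 : ℂ) ε ⊆ disk := Metric.ball_subset_ball hε1.le
    have hu : Measurable ((Metric.ball (0 : ℂ) ε).indicator fun _ => (1 : ℝ≥0∞)) :=
      measurable_const.indicator measurableSet_ball
    have h1 := (lintegral_rpow_le_of_kernel (μ := volume) measurableSet_disk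
      (fun w hw η hη => le_norm_diskKernel hw hη) hp0 (fun w => ‖w - 0‖ₑ ^ 2) (by fun_prop)
      _ hu).trans (lintegral_diskKernel_le hp hB hu)
    rw [← hD, lintegral_indicator measurableSet_ball, Measure.restrict_restrict measurableSet_ball,
      inter_eq_left.2 hsub, setLIntegral_one, Complex.volume_ball] at h1
    have hvol : ENNReal.ofReal ε ^ 2 * (NNReal.pi : ℝ≥0∞) = ENNReal.ofReal (Real.pi * ε ^ 2) := by
      rw [mul_comm, ENNReal.ofReal_mul hpi.le, ENNReal.ofReal_pow hε.le]
      congr 1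
      rw [← NNReal.coe_real_pi, ENNReal.ofReal_coe_nnreal]
    rw [hvol] at h1
    refine h1.trans ?_
    gcongr
    calc ∫⁻ w in disk, (Metric.ball (0 : ℂ) ε).indicator (fun _ => 1) w ^ p * ‖w - 0‖ₑ ^ 2
        ≤ ∫⁻ w in disk, (Metric.ball (0 : ℂ) ε).indicator (fun _ => ENNReal.ofReal ε ^ 2) w := by
          refine lintegral_mono fun w => ?_
          by_cases hw : w ∈ Metric.ball (0 : ℂ) ε
          · rw [indicator_of_mem hw, indicator_of_mem hw, ENNReal.one_rpow, one_mul, sub_zero,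
              ← ofReal_norm]
            gcongr
            simpa using (mem_ball_zero_iff.1 hw).le
          · rw [indicator_of_notMem hw, indicator_of_notMem hw, ENNReal.zero_rpow_of_pos hp0,
              zero_mul]
      _ = ENNReal.ofReal (Real.pi * ε ^ 4) := by
          rw [lintegral_indicator measurableSet_ball, Measure.restrict_restrict measurableSet_ball,
            inter_eq_left.2 hsub, setLIntegral_const, Complex.volume_ball, hvol,
            ← ENNReal.ofReal_pow hε.le, ← ENNReal.ofReal_mul (by positivity)]
          congr 1; ring
  have hDtop : D ≠ ∞ := by
    intro h
    have h1 := key (1 / 2) (by norm_num) (by norm_num)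
    rw [h, ENNReal.mul_top] at h1
    · exact (ENNReal.mul_lt_top hA.lt_top ENNReal.ofReal_lt_top).not_ge h1
    · exact (ENNReal.rpow_pos (ENNReal.ofReal_pos.2 (by positivity)) (by simp)).ne'
  have hDpos : 0 < D.toReal := ENNReal.toReal_pos hD0 hDtop
  set A := (((C : ℝ≥0∞) + 1) ^ p).toReal
  have key2 : ∀ ε : ℝ, 0 < ε → ε < 1 → Real.pi ^ p * D.toReal ≤ A * Real.pi * ε ^ (4 - 2 * p) := by
    intro ε hε hε1
    have h := ENNReal.toReal_mono (ENNReal.mul_ne_top hA ENNReal.ofReal_ne_top) (key ε hε hε1)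
    rw [ENNReal.toReal_mul, ENNReal.toReal_mul, ← ENNReal.toReal_rpow,
      ENNReal.toReal_ofReal (by positivity), ENNReal.toReal_ofReal (by positivity),
      Real.mul_rpow hpi.le (by positivity), ← Real.rpow_natCast ε 2, ← Real.rpow_natCast ε 4,
      ← Real.rpow_mul hε.le] at h
    have he : ε ^ (4 - 2 * p) = ε ^ ((4 : ℕ) : ℝ) / ε ^ (((2 : ℕ) : ℝ) * p) := by
      rw [← Real.rpow_sub hε]; norm_num
    rw [he, ← mul_div_assoc, le_div_iff₀ (by positivity)]
    calc _ = Real.pi ^ p * ε ^ (((2 : ℕ) : ℝ) * p) * D.toReal := by ring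
      _ ≤ _ := h
      _ = _ := by ring
  have hlim : Filter.Tendsto (fun ε : ℝ => A * Real.pi * ε ^ (4 - 2 * p)) (nhdsWithin 0 (Ioi 0))
      (nhds (A * Real.pi * 0 ^ (4 - 2 * p))) := by
    refine Filter.Tendsto.const_mul _ (Filter.Tendsto.mono_left ?_ nhdsWithin_le_nhds)
    exact (Real.continuousAt_rpow_const 0 _ (Or.inr (by linarith))).tendsto
  rw [Real.zero_rpow (by linarith), mul_zero] at hlim
  have := ge_of_tendsto hlim (b := Real.pi ^ p * D.toReal) (by
    filter_upwards [Ioo_mem_nhdsGT (zero_lt_one' ℝ)] with ε hε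
    exact key2 ε hε.1 hε.2)
  have h0 : 0 < Real.pi ^ p * D.toReal := by positivity
  linarith

/-! ## The symmetrization map -/

lemma symBidisk_eq_image : symBidisk = symMap '' bidisk := by rw [symBidisk, bidisk_eq]

lemma symMap_mem {w : ℂ × ℂ} (hw : w ∈ bidisk) : symMap w ∈ symBidisk := by
  rw [symBidisk_eq_image]; exact mem_image_of_mem _ hw

@[fun_prop]
lemma continuous_symMap : Continuous symMap := by unfold symMap; fun_prop

@[fun_prop]
lemma measurable_symMap : Measurable symMap := continuous_symMap.measurable

lemma symMap_swap (w : ℂ × ℂ) : symMap w.swap = symMap w := by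
  simp [symMap, add_comm, mul_comm]

lemma jac_swap (w : ℂ × ℂ) : jac w.swap = -jac w := by simp [jac]

lemma jac_sq (w : ℂ × ℂ) : (symMap w).1 ^ 2 - 4 * (symMap w).2 = jac w ^ 2 := by
  simp only [symMap, jac]; ring

lemma symMap_eq_iff {w w' : ℂ × ℂ} : symMap w = symMap w' ↔ w = w' ∨ w = w'.swap := by
  constructor
  · intro h
    simp only [symMap, Prod.mk.injEq] at h
    obtain ⟨h1, h2⟩ := h
    have : (w.1 - w'.1) * (w.1 - w'.2) = 0 := by linear_combination w.1 * h1 - h2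
    rcases mul_eq_zero.1 this with h | h
    · left
      refine Prod.ext (sub_eq_zero.1 h) ?_
      linear_combination h1 - h
    · right
      refine Prod.ext (sub_eq_zero.1 h) ?_
      simp only [Prod.snd_swap]
      linear_combination h1 - h
  · rintro (rfl | rfl)
    · rfl
    · exact symMap_swap _

lemma swap_mem_bidisk {w : ℂ × ℂ} : w.swap ∈ bidisk ↔ w ∈ bidisk := by
  simp [mem_bidisk, and_comm]

lemma symMap_mem_iff {w : ℂ × ℂ} : symMap w ∈ symBidisk ↔ w ∈ bidisk := by
  refine ⟨fun h => ?_, symMap_mem⟩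
  rw [symBidisk_eq_image] at h
  obtain ⟨w', hw', h⟩ := h
  rcases symMap_eq_iff.1 h with rfl | rfl
  · exact hw'
  · exact swap_mem_bidisk.1 hw'

lemma symMap_surjective : Function.Surjective symMap := by
  intro z
  obtain ⟨s, hs⟩ := IsAlgClosed.exists_pow_nat_eq (z.1 ^ 2 - 4 * z.2) two_pos
  refine ⟨((z.1 + s) / 2, (z.1 - s) / 2), Prod.ext ?_ ?_⟩
  · simp only [symMap]; ring
  · simp only [symMap]; linear_combination -hs / 4

/-- At z = `symMap w` the polynomial factors as (1 - w₁ s)(1 - w₂ s), whose zeros are the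
reciprocals of the nonzero wᵢ. This form exhibits the complement as the projection of a closed set
along a compact factor, hence openness. -/
lemma mem_symBidisk_iff {z : ℂ × ℂ} :
    z ∈ symBidisk ↔ ∀ s ∈ Metric.closedBall (0 : ℂ) 1, 1 - z.1 * s + z.2 * s ^ 2 ≠ 0 := by
  obtain ⟨w, rfl⟩ := symMap_surjective z
  have hfac : ∀ s, 1 - (symMap w).1 * s + (symMap w).2 * s ^ 2 = (1 - w.1 * s) * (1 - w.2 * s) := by
    intro s; simp only [symMap]; ring
  rw [symMap_mem_iff, mem_bidisk]
  simp only [hfac]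
  have key : ∀ a : ℂ, ‖a‖ < 1 ↔ ∀ s ∈ Metric.closedBall (0 : ℂ) 1, 1 - a * s ≠ 0 := by
    intro a
    constructor
    · intro ha s hs
      have := one_sub_mul_conj_ne_zero (η := conj s) ha (by simpa using hs)
      simpa using this
    · intro h
      by_contra! ha
      have ha0 : a ≠ 0 := by rintro rfl; simp at ha; linarith
      exact h a⁻¹ (by simpa using inv_le_one_of_one_le₀ ha) (by simp [ha0])
  rw [key, key, ← forall₂_and]
  simp

lemma isOpen_symBidisk : IsOpen symBidisk := by
  have hc : IsClosed {q : (ℂ × ℂ) × Metric.closedBall (0 : ℂ) 1 |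
      1 - q.1.1 * (q.2 : ℂ) + q.1.2 * (q.2 : ℂ) ^ 2 = 0} :=
    isClosed_eq (by fun_prop) continuous_const
  have : CompactSpace (Metric.closedBall (0 : ℂ) 1) :=
    isCompact_iff_compactSpace.1 (isCompact_closedBall _ _)
  have h := isClosedMap_fst_of_compactSpace _ hc
  rw [← isOpen_compl_iff] at h
  convert h using 1
  ext z
  rw [mem_symBidisk_iff]
  simp

lemma measurableSet_symBidisk : MeasurableSet symBidisk := isOpen_symBidisk.measurableSet

lemma symBidisk_subset_image : symBidisk ⊆ symMap '' Metric.closedBall 0 1 := by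
  rw [symBidisk_eq_image]; exact image_mono Metric.ball_subset_closedBall

lemma isCompact_image_symMap : IsCompact (symMap '' Metric.closedBall 0 1) :=
  (isCompact_closedBall _ _).image continuous_symMap

instance : IsFiniteMeasure (volume.restrict symBidisk) :=
  ⟨by
    rw [Measure.restrict_apply_univ]
    exact (isCompact_image_symMap.measure_lt_top).trans_le' (measure_mono symBidisk_subset_image)⟩

instance : (volume : Measure (ℂ × ℂ)).IsAddHaarMeasure :=
  inferInstanceAs ((volume : Measure ℂ).prod volume).IsAddHaarMeasure

/-! ### Jacobian and change of variables -/

/-- The complex derivative of the symmetrization map. -/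
def symMapDeriv (w : ℂ × ℂ) : (ℂ × ℂ) →L[ℂ] ℂ × ℂ :=
  (ContinuousLinearMap.fst ℂ ℂ ℂ + ContinuousLinearMap.snd ℂ ℂ ℂ).prod
    (w.1 • ContinuousLinearMap.snd ℂ ℂ ℂ + w.2 • ContinuousLinearMap.fst ℂ ℂ ℂ)

lemma hasFDerivAt_symMap (w : ℂ × ℂ) : HasFDerivAt symMap (symMapDeriv w) w :=
  (hasFDerivAt_fst.add hasFDerivAt_snd).prodMk (hasFDerivAt_fst.mul hasFDerivAt_snd)

/-- The real determinant of a complex linear map is the squared modulus of its complex determinant,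
which here is w₁ - w₂. -/
lemma abs_det_symMapDeriv (w : ℂ × ℂ) :
    |((symMapDeriv w).restrictScalars ℝ).det| = ‖jac w‖ ^ 2 := by
  have h1 : ((symMapDeriv w).restrictScalars ℝ).det =
      LinearMap.det (((symMapDeriv w : (ℂ × ℂ) →ₗ[ℂ] ℂ × ℂ)).restrictScalars ℝ) := rfl
  have h2 : LinearMap.det (symMapDeriv w : (ℂ × ℂ) →ₗ[ℂ] ℂ × ℂ) = jac w := by
    rw [← LinearMap.det_toMatrix (Module.Basis.finTwoProd ℂ), Matrix.det_fin_two]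
    simp [LinearMap.toMatrix_apply, symMapDeriv, jac]
  rw [h1, LinearMap.det_restrictScalars, h2, Algebra.norm_complex_apply, Complex.normSq_eq_norm_sq,
    abs_of_nonneg (by positivity)]

lemma ae_symMap_discriminant_ne_zero : ∀ᵐ z : ℂ × ℂ, z.1 ^ 2 - 4 * z.2 ≠ 0 := by
  rw [Measure.volume_eq_prod, Measure.ae_prod_iff_ae_ae]
  · refine Filter.Eventually.of_forall fun x => ?_
    have : ∀ᵐ y : ℂ, y ≠ x ^ 2 / 4 := by simp [ae_iff]
    filter_upwards [this] with y hy h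
    exact hy (by linear_combination -h / 4)
  · exact (by fun_prop : Measurable fun z : ℂ × ℂ => z.1 ^ 2 - 4 * z.2)
      (MeasurableSet.compl (measurableSet_singleton 0))

/-- Change of variables for the two-to-one symmetrization map. -/
theorem lintegral_symMap (u : ℂ × ℂ → ℝ≥0∞) :
    ∫⁻ w in bidisk, ‖jac w‖ₑ ^ 2 * u (symMap w) = 2 * ∫⁻ z in symBidisk, u z := by
  -- Lexicographic order on ℂ selects exactly one point from each pair {w, swap w} off the diagonal,
  -- so `symMap` is injective on `P`.
  set P : Set (ℂ × ℂ) := {w | w.1.re < w.2.re ∨ (w.1.re = w.2.re ∧ w.1.im < w.2.im)} with hP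
  have hPm : MeasurableSet P := by
    have h1 : MeasurableSet {w : ℂ × ℂ | w.1.re < w.2.re} :=
      measurableSet_lt (by fun_prop) (by fun_prop)
    have h2 : MeasurableSet {w : ℂ × ℂ | w.1.re = w.2.re} :=
      measurableSet_eq_fun (by fun_prop) (by fun_prop)
    have h3 : MeasurableSet {w : ℂ × ℂ | w.1.im < w.2.im} :=
      measurableSet_lt (by fun_prop) (by fun_prop)
    exact h1.union (h2.inter h3)
  have hPor : ∀ w, jac w ≠ 0 → (w ∈ P ∨ w.swap ∈ P) := by
    intro w hw
    simp only [hP, mem_ofPred_eq, Prod.fst_swap, Prod.snd_swap]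
    rcases lt_trichotomy w.1.re w.2.re with h | h | h
    · exact Or.inl (Or.inl h)
    · rcases lt_trichotomy w.1.im w.2.im with h' | h' | h'
      · exact Or.inl (Or.inr ⟨h, h'⟩)
      · exact absurd (sub_eq_zero.2 (Complex.ext h h')) hw
      · exact Or.inr (Or.inr ⟨h.symm, h'⟩)
    · exact Or.inr (Or.inl h)
  have hPnot : ∀ w ∈ P, w.swap ∉ P := by
    intro w hw hw'
    simp only [hP, mem_ofPred_eq, Prod.fst_swap, Prod.snd_swap] at hw hw'
    rcases hw with h | ⟨h, h'⟩ <;> rcases hw' with g | ⟨g, g'⟩ <;> linarith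
  set H : Set (ℂ × ℂ) := bidisk ∩ P with hH
  have hHm : MeasurableSet H := measurableSet_bidisk.inter hPm
  have hinj : InjOn symMap H := by
    intro w hw w' hw' h
    rcases symMap_eq_iff.1 h with h | rfl
    · exact h
    · exact absurd hw.2 (hPnot _ hw'.2)
  have himg : symMap '' H =ᵐ[volume] symBidisk := by
    refine Filter.EventuallyEq.symm ?_
    filter_upwards [ae_symMap_discriminant_ne_zero] with z hz
    refine propext ⟨fun h => ?_, fun h => ?_⟩
    · obtain ⟨w, hw, rfl⟩ := symBidisk_eq_image ▸ h
      rw [jac_sq] at hz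
      rcases hPor w (by simpa using hz) with h' | h'
      · exact ⟨w, ⟨hw, h'⟩, rfl⟩
      · exact ⟨w.swap, ⟨swap_mem_bidisk.2 hw, h'⟩, symMap_swap w⟩
    · obtain ⟨w, hw, rfl⟩ := h
      exact symMap_mem hw.1
  have hhalf : ∫⁻ z in symBidisk, u z = ∫⁻ w in H, ‖jac w‖ₑ ^ 2 * u (symMap w) := by
    rw [← setLIntegral_congr himg, lintegral_image_eq_lintegral_abs_det_fderiv_mul volume hHm
      (fun w _ => ((hasFDerivAt_symMap w).restrictScalars ℝ).hasFDerivWithinAt) hinj]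
    refine lintegral_congr fun w => ?_
    rw [abs_det_symMapDeriv, ENNReal.ofReal_pow (norm_nonneg _), ofReal_norm]
  have hswap : MeasurePreserving (Prod.swap : ℂ × ℂ → ℂ × ℂ) volume volume :=
    Measure.measurePreserving_swap
  have hhalf' : ∫⁻ w in Prod.swap ⁻¹' H, ‖jac w‖ₑ ^ 2 * u (symMap w) =
      ∫⁻ w in H, ‖jac w‖ₑ ^ 2 * u (symMap w) := by
    rw [← hswap.setLIntegral_comp_preimage_emb MeasurableEquiv.prodComm.measurableEmbedding _
      (Prod.swap ⁻¹' H)]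
    simp only [← preimage_comp, Prod.swap_swap_eq, preimage_id, jac_swap, symMap_swap, enorm_neg]
  have hunion : (H ∪ Prod.swap ⁻¹' H : Set (ℂ × ℂ)) =ᵐ[volume] bidisk := by
    filter_upwards [volume_jac_eq_zero] with w hw
    refine propext ⟨fun h => ?_, fun h => ?_⟩
    · rcases h with h | h
      · exact h.1
      · exact swap_mem_bidisk.1 h.1
    · rcases hPor w hw with h' | h'
      · exact Or.inl ⟨h, h'⟩
      · exact Or.inr ⟨swap_mem_bidisk.2 h, h'⟩
  have hdisj : Disjoint H (Prod.swap ⁻¹' H) :=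
    disjoint_left.2 fun w hw hw' => hPnot w hw.2 hw'.2
  rw [← setLIntegral_congr hunion, lintegral_union (measurable_swap hHm) hdisj, hhalf', ← hhalf,
    two_mul]

/-- The change of variables as a pushforward of measures, which transfers it from Lebesgue to
Bochner integrals. -/
lemma map_symMap : Measure.map symMap ((volume.restrict bidisk).withDensity fun w => ‖jac w‖ₑ ^ 2) =
    (2 : ℝ≥0∞) • volume.restrict symBidisk := by
  ext s hs
  rw [Measure.map_apply measurable_symMap hs, withDensity_apply _ (measurable_symMap hs),
    ← lintegral_indicator (measurable_symMap hs)]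
  have := lintegral_symMap (s.indicator fun _ => 1)
  rw [lintegral_indicator hs, setLIntegral_one] at this
  rw [Measure.smul_apply, smul_eq_mul, ← this]
  refine lintegral_congr fun w => ?_
  by_cases h : symMap w ∈ s
  · rw [indicator_of_mem (by exact h), indicator_of_mem h, mul_one]
  · rw [indicator_of_notMem (by exact h), indicator_of_notMem h, mul_zero]

lemma integral_symMap {u : ℂ × ℂ → ℂ} (hu : AEStronglyMeasurable u (volume.restrict symBidisk)) :
    ∫ w in bidisk, (‖jac w‖ ^ 2 : ℝ) * u (symMap w) = 2 * ∫ z in symBidisk, u z := by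
  have h1 : ∫ z, u z ∂((2 : ℝ≥0∞) • volume.restrict symBidisk) = 2 * ∫ z in symBidisk, u z := by
    rw [integral_smul_measure]; simp
  rw [← h1, ← map_symMap, integral_map measurable_symMap.aemeasurable (by
    rw [map_symMap]; exact hu.smul_measure _)]
  have h2 : (fun w => ‖jac w‖ₑ ^ 2) = fun w => ((‖jac w‖₊ ^ 2 : ℝ≥0) : ℝ≥0∞) := by
    ext w; simp [enorm]
  rw [h2, integral_withDensity_eq_integral_smul (by fun_prop)]
  refine integral_congr_ae (Filter.Eventually.of_forall fun w => ?_)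
  simp [NNReal.smul_def]

/-! ## Reproducing kernels and the Bergman projection -/

/-- If `K` has the properties of a Bergman kernel at almost every point, the Bergman projection is
the integral operator with kernel `K`. -/
theorem bergmanProjection_eq_integral {E : Type*} [NormedAddCommGroup E] [NormedSpace ℂ E]
    [MeasureSpace E] {Ω : Set E} {K : E → E → ℂ}
    (hK : ∀ᵐ w ∂(volume.restrict Ω), DifferentiableOn ℂ (fun η => conj (K w η)) Ω ∧
      MemLp (fun η => conj (K w η)) 2 (volume.restrict Ω) ∧
      ∀ F : E → ℂ, DifferentiableOn ℂ F Ω → MemLp F 2 (volume.restrict Ω) →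
        F w = ∫ η in Ω, K w η * F η)
    (f : Lp ℂ 2 (volume.restrict Ω)) :
    bergmanProjection Ω f =ᵐ[volume.restrict Ω] fun w => ∫ η in Ω, K w η * f η := by
  set M := bergmanSpace Ω
  set v := bergmanProjection Ω f with hv
  have hvM : v ∈ M.topologicalClosure := by
    rw [hv, bergmanProjection]
    exact Submodule.starProjection_apply_mem _ _
  have hinner : ∀ (w : E) (hk : MemLp (fun η => conj (K w η)) 2 (volume.restrict Ω))
      (g : Lp ℂ 2 (volume.restrict Ω)),
      inner ℂ (hk.toLp _) g = ∫ η in Ω, K w η * g η := by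
    intro w hk g
    rw [L2.inner_def]
    refine integral_congr_ae ?_
    filter_upwards [hk.coeFn_toLp] with η hη
    rw [hη]
    simp [mul_comm]
  -- The projection is only known to lie in the closure of the Bergman space. It is approximated in
  -- L² by members, each given pointwise by pairing with the kernel; a subsequence converges almost
  -- everywhere and the pairing is continuous.
  obtain ⟨vs, hvs, hlim⟩ := mem_closure_iff_seq_limit.1
    (show v ∈ closure (M : Set (Lp ℂ 2 (volume.restrict Ω))) from hvM)
  choose F hFd hF using hvs
  obtain ⟨ns, hns, hae⟩ := (tendstoInMeasure_of_tendsto_Lp hlim).exists_seq_tendsto_ae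
  have hall : ∀ᵐ w ∂(volume.restrict Ω), ∀ n, vs n w = F n w := ae_all_iff.2 hF
  filter_upwards [hK, hae, hall] with w ⟨hd, hm, hr⟩ hw hFw
  have h1 : ∀ n, vs n w = inner ℂ (hm.toLp _) (vs n) := by
    intro n
    have hmem : MemLp (F n) 2 (volume.restrict Ω) := (memLp_congr_ae (hF n)).1 (Lp.memLp _)
    rw [hFw, hr _ (hFd n) hmem, hinner]
    refine integral_congr_ae ?_
    filter_upwards [hF n] with η hη
    rw [hη]
  have h2 : Filter.Tendsto (fun n => vs (ns n) w) Filter.atTop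
      (nhds (inner ℂ (hm.toLp _) v)) := by
    simp_rw [h1]
    exact (tendsto_const_nhds.inner hlim).comp hns.tendsto_atTop
  rw [tendsto_nhds_unique hw h2, ← hinner w hm]
  -- Self-adjointness moves the projection onto the conjugate kernel, which it fixes.
  have hkM : hm.toLp _ ∈ M.topologicalClosure :=
    M.le_topologicalClosure ⟨_, hd, hm.coeFn_toLp⟩
  rw [hv, bergmanProjection, ← Submodule.inner_starProjection_left_eq_right,
    Submodule.starProjection_eq_self_iff.2 hkM]

/-- The reproducing property of the Bergman kernel of the bidisk. -/
theorem bidiskKernel_reproducing {V : ℂ × ℂ → ℂ} (hV : DifferentiableOn ℂ V bidisk) {w : ℂ × ℂ}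
    (hw : w ∈ bidisk) (hi : IntegrableOn V bidisk) :
    ∫ η in bidisk, bidiskKernel w η * V η = V w := by
  have hw1 : w.1 ∈ disk := mem_disk.2 (mem_bidisk.1 hw).1
  have hw2 : w.2 ∈ disk := mem_disk.2 (mem_bidisk.1 hw).2
  obtain ⟨M₁, hM₁⟩ := (isCompact_closedBall (0 : ℂ) 1).exists_bound_of_continuousOn
    (continuousOn_diskKernel hw1)
  obtain ⟨M₂, hM₂⟩ := (isCompact_closedBall (0 : ℂ) 1).exists_bound_of_continuousOn
    (continuousOn_diskKernel hw2)
  have hint : IntegrableOn (fun η => bidiskKernel w η * V η) bidisk := by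
    refine Integrable.bdd_mul (c := M₁ * M₂) hi (Measurable.aestronglyMeasurable (by fun_prop)) ?_
    filter_upwards [ae_restrict_mem measurableSet_bidisk] with η hη
    rw [bidiskKernel, norm_mul]
    have h := mem_bidisk.1 hη
    have h1 := hM₁ η.1 (by simpa using h.1.le)
    have h2 := hM₂ η.2 (by simpa using h.2.le)
    exact mul_le_mul h1 h2 (norm_nonneg _) ((norm_nonneg _).trans h1)
  have hV1 : ∀ η₂ ∈ disk, DifferentiableOn ℂ (fun η₁ => V (η₁, η₂)) disk := by
    intro η₂ hη₂
    refine hV.comp (by fun_prop) fun η₁ hη₁ => ?_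
    rw [bidisk_eq]; exact ⟨hη₁, hη₂⟩
  have hV2 : DifferentiableOn ℂ (fun η₂ => V (w.1, η₂)) disk := by
    refine hV.comp (by fun_prop) fun η₂ hη₂ => ?_
    rw [bidisk_eq]; exact ⟨hw1, hη₂⟩
  have hint' := hint
  rw [IntegrableOn, volume_restrict_bidisk] at hint'
  have hi' := hi
  rw [IntegrableOn, volume_restrict_bidisk] at hi'
  have hinner : ∀ᵐ η₂ ∂(volume.restrict disk), ∫ η₁ in disk, bidiskKernel w (η₁, η₂) * V (η₁, η₂) =
      diskKernel w.2 η₂ * V (w.1, η₂) := by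
    filter_upwards [hi'.prod_left_ae, ae_restrict_mem measurableSet_disk] with η₂ h hη₂
    rw [← diskKernel_reproducing (hV1 η₂ hη₂) hw1, ← integral_const_mul]
    · simp only [bidiskKernel]
      refine integral_congr_ae (Filter.Eventually.of_forall fun η₁ => ?_)
      ring_nf
    · refine Integrable.bdd_mul (c := M₁) h (Measurable.aestronglyMeasurable (by fun_prop)) ?_
      filter_upwards [ae_restrict_mem measurableSet_disk] with η hη
      exact hM₁ η (by simpa using (mem_disk.1 hη).le)
  rw [volume_restrict_bidisk, integral_prod_symm _ hint', integral_congr_ae hinner]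
  refine diskKernel_reproducing hV2 hw2 ?_
  exact hint'.integral_prod_right.congr hinner

/-! ## Holomorphic functions of two variables -/

/-- Coordinatewise complex conjugation. -/
def conjProd (η : ℂ × ℂ) : ℂ × ℂ := (conj η.1, conj η.2)

@[fun_prop]
lemma continuous_conjProd : Continuous conjProd :=
  (Complex.continuous_conj.comp continuous_fst).prodMk (Complex.continuous_conj.comp continuous_snd)

/-- Differentiation under the integral sign for a kernel that is holomorphic in `(w, conj η)`. -/
theorem hasFDerivAt_integral_kernel {κ : (ℂ × ℂ) × (ℂ × ℂ) → ℂ} {S : Set (ℂ × ℂ)}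
    (hS : IsCompact S) {w₀ : ℂ × ℂ} (h : ∀ η ∈ S, ContDiffAt ℂ 1 κ (w₀, conjProd η))
    {μ : Measure (ℂ × ℂ)} (hμ : ∀ᵐ η ∂μ, η ∈ S) {G : ℂ × ℂ → ℂ} (hG : Integrable G μ) :
    ∃ L : (ℂ × ℂ) →L[ℂ] ℂ, HasFDerivAt (fun w => ∫ η, κ (w, conjProd η) * G η ∂μ) L w₀ ∧
      ∀ v, L v = ∫ η, fderiv ℂ κ (w₀, conjProd η) (v, 0) * G η ∂μ := by
  have hSc : IsCompact (conjProd '' S) := hS.image continuous_conjProd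
  have hfc : ∀ q, ContDiffAt ℂ 1 κ q → ContinuousAt (fderiv ℂ κ) q := fun q hq =>
    (hq.fderiv_right (m := 0) (by norm_num)).continuousAt
  obtain ⟨M, hM⟩ := (isCompact_singleton (x := w₀)).prod hSc |>.exists_bound_of_continuousOn
    (f := fderiv ℂ κ) (by
      rintro ⟨w, ζ⟩ ⟨hw, η, hη, rfl⟩
      rw [mem_singleton_iff] at hw
      simp only at hw
      subst hw
      exact (hfc _ (h η hη)).continuousWithinAt)
  -- The tube lemma applied to this open set gives one neighbourhood of `w₀` on which, for all η in
  -- the compact `S`, κ is C¹ with derivative bounded by `M + 1`; this is the dominating function.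
  set O : Set ((ℂ × ℂ) × (ℂ × ℂ)) := {q | ContDiffAt ℂ 1 κ q ∧ ‖fderiv ℂ κ q‖ < M + 1}
  have hO : IsOpen O := by
    rw [isOpen_iff_mem_nhds]
    rintro q ⟨hq, hqM⟩
    filter_upwards [hq.eventually (by simp), (hfc q hq).norm.eventually_lt_const hqM] with q' h1 h2
    exact ⟨h1, h2⟩
  obtain ⟨U, V, hU, hV, hwU, hSV, hUV⟩ := generalized_tube_lemma (isCompact_singleton (x := w₀)) hSc
    hO (by
      rintro ⟨w, ζ⟩ ⟨hw, η, hη, rfl⟩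
      have hM' := hM (w, conjProd η) ⟨hw, η, hη, rfl⟩
      rw [mem_singleton_iff] at hw
      simp only at hw
      subst hw
      exact ⟨h η hη, by linarith⟩)
  have hmem : ∀ w ∈ U, ∀ η ∈ S, (w, conjProd η) ∈ O := fun w hw η hη =>
    hUV ⟨hw, hSV (mem_image_of_mem _ hη)⟩
  have hμS : μ.restrict S = μ := Measure.restrict_eq_self_of_ae_mem hμ
  have hSm : MeasurableSet S := hS.isClosed.measurableSet
  have hcont : ∀ w : ℂ × ℂ, Continuous fun η => (w, conjProd η) := fun w => by fun_prop
  have hmeas : ∀ w ∈ U, AEStronglyMeasurable (fun η => κ (w, conjProd η)) μ := by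
    intro w hw
    rw [← hμS]
    refine ContinuousOn.aestronglyMeasurable (fun η hη => ?_) hSm
    exact ((hmem w hw η hη).1.continuousAt.comp (f := fun η => (w, conjProd η))
      (hcont w).continuousAt).continuousWithinAt
  have hmeas' : AEStronglyMeasurable (fun η => (fderiv ℂ κ (w₀, conjProd η)).comp
      (ContinuousLinearMap.inl ℂ (ℂ × ℂ) (ℂ × ℂ))) μ := by
    rw [← hμS]
    refine ContinuousOn.aestronglyMeasurable (fun η hη => ?_) hSm
    have h1 := ((hfc _ (h η hη)).comp (f := fun η => (w₀, conjProd η))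
      (hcont w₀).continuousAt).continuousWithinAt (s := S)
    exact h1.clm_comp continuousWithinAt_const
  have hw₀U : w₀ ∈ U := hwU rfl
  obtain ⟨N, hN⟩ := hSc.exists_bound_of_continuousOn (f := fun ζ => κ (w₀, ζ)) (by
    rintro ζ ⟨η, hη, rfl⟩
    exact ((h η hη).continuousAt.comp (by fun_prop : Continuous fun ζ =>
      ((w₀, ζ) : (ℂ × ℂ) × (ℂ × ℂ))).continuousAt).continuousWithinAt)
  have hbd : ∀ η ∈ S, ∀ w ∈ U, ‖G η • (fderiv ℂ κ (w, conjProd η)).comp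
      (ContinuousLinearMap.inl ℂ (ℂ × ℂ) (ℂ × ℂ))‖ ≤ ‖G η‖ * (M + 1) := by
    intro η hη w hw
    rw [norm_smul]
    gcongr
    refine (ContinuousLinearMap.opNorm_comp_le _ _).trans ?_
    calc _ ≤ (M + 1) * 1 := by
          gcongr
          · exact (norm_nonneg _).trans (hmem w hw η hη).2.le
          · exact (hmem w hw η hη).2.le
          · exact ContinuousLinearMap.norm_inl_le_one ℂ (ℂ × ℂ) (ℂ × ℂ)
      _ = M + 1 := mul_one _
  refine ⟨∫ η, G η • (fderiv ℂ κ (w₀, conjProd η)).comp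
    (ContinuousLinearMap.inl ℂ (ℂ × ℂ) (ℂ × ℂ)) ∂μ, ?_, fun v => ?_⟩
  swap
  · rw [ContinuousLinearMap.integral_apply]
    · simp [mul_comm]
    · refine (hG.norm.mul_const (M + 1)).mono' (hG.1.smul hmeas') ?_
      filter_upwards [hμ] with η hη
      exact hbd η hη w₀ hw₀U
  refine hasFDerivAt_integral_of_dominated_of_fderiv_le (s := U)
    (F := fun w η => κ (w, conjProd η) * G η)
    (F' := fun w η => G η • (fderiv ℂ κ (w, conjProd η)).comp
      (ContinuousLinearMap.inl ℂ (ℂ × ℂ) (ℂ × ℂ)))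
    (bound := fun η => ‖G η‖ * (M + 1)) (hU.mem_nhds hw₀U) ?_ ?_ ?_ ?_ ?_ ?_
  · filter_upwards [hU.mem_nhds hw₀U] with w hw
    exact (hmeas w hw).mul hG.1
  · refine hG.bdd_mul (c := N) (hmeas w₀ hw₀U) ?_
    filter_upwards [hμ] with η hη
    exact hN _ (mem_image_of_mem _ hη)
  · exact hG.1.smul hmeas'
  · filter_upwards [hμ] with η hη w hw
    exact hbd η hη w hw
  · exact hG.norm.mul_const _
  · filter_upwards [hμ] with η hη w hw
    have h1 := ((hmem w hw η hη).1.differentiableAt (by norm_num)).hasFDerivAt.comp (f := fun w => (w, conjProd η)) w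
      (hasFDerivAt_prodMk_left w (conjProd η))
    exact h1.mul_const (G η)

/-- A directional derivative of a holomorphic function of two variables is holomorphic. -/
theorem differentiableOn_fderiv_apply {f : ℂ × ℂ → ℂ} {Ω : Set (ℂ × ℂ)} (hΩ : IsOpen Ω)
    (hf : DifferentiableOn ℂ f Ω) (v : ℂ × ℂ) :
    DifferentiableOn ℂ (fun z => fderiv ℂ f z v) Ω := by
  intro z₀ hz₀
  obtain ⟨R, hR, hRΩ⟩ := Metric.nhds_basis_closedBall.mem_iff.1 (hΩ.mem_nhds hz₀)
  obtain ⟨M, hM⟩ := (isCompact_closedBall z₀ R).exists_bound_of_continuousOn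
    (hf.continuousOn.mono hRΩ)
  have hM0 : 0 ≤ M := (norm_nonneg _).trans (hM z₀ (Metric.mem_closedBall_self hR.le))
  have hd : ∀ z ∈ Metric.closedBall z₀ R, DifferentiableAt ℂ f z := fun z hz =>
    hf.differentiableAt (hΩ.mem_nhds (hRΩ hz))
  obtain ⟨ρ, hρ, hρR⟩ : ∃ ρ : ℝ, 0 < ρ ∧ ρ * ‖v‖ ≤ R / 4 := by
    refine ⟨R / (4 * (‖v‖ + 1)), by positivity, ?_⟩
    rw [div_mul_eq_mul_div, div_le_div_iff₀ (by positivity) (by positivity)]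
    nlinarith [norm_nonneg v]
  have hline : ∀ (z u : ℂ × ℂ) (r a : ℝ), z ∈ Metric.ball z₀ a → r * ‖u‖ + a ≤ R →
      ∀ t ∈ Metric.closedBall (0 : ℂ) r, z + t • u ∈ Metric.closedBall z₀ R := by
    intro z u r a hz hra t ht
    rw [mem_closedBall_iff_norm] at *
    rw [mem_ball_iff_norm] at hz
    have : ‖t • u‖ ≤ r * ‖u‖ := by
      rw [norm_smul]; gcongr; simpa using ht
    calc ‖z + t • u - z₀‖ = ‖(z - z₀) + t • u‖ := by congr 1; abel
      _ ≤ ‖z - z₀‖ + ‖t • u‖ := norm_add_le _ _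
      _ ≤ R := by linarith
  have hderiv : ∀ (z u : ℂ × ℂ) (t : ℂ), z + t • u ∈ Metric.closedBall z₀ R →
      HasDerivAt (fun t : ℂ => f (z + t • u)) (fderiv ℂ f (z + t • u) u) t := by
    intro z u t ht
    have h1 : HasDerivAt (fun t : ℂ => z + t • u) u t := by
      simpa using ((hasDerivAt_id t).smul_const u).const_add z
    exact (hd _ ht).hasFDerivAt.comp_hasDerivAt t h1
  -- Cauchy's estimate on the complex line through z in direction u: the radius R / (4‖u‖) keeps the
  -- circle inside the ball of radius R, and scaling with u gives an operator norm bound.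
  have hbound : ∀ z ∈ Metric.ball z₀ (R / 2), ‖fderiv ℂ f z‖ ≤ 4 * M / R := by
    intro z hz
    refine ContinuousLinearMap.opNorm_le_bound _ (by positivity) fun u => ?_
    rcases eq_or_ne u 0 with rfl | hu
    · simp
    have hu' : 0 < ‖u‖ := norm_pos_iff.2 hu
    have hl := hline z u (R / (4 * ‖u‖)) (R / 2) hz (by field_simp; norm_num)
    have h0 := hderiv z u 0 (hl 0 (by simp; positivity))
    have hc := Complex.norm_deriv_le_of_forall_mem_sphere_norm_le (c := 0) (R := R / (4 * ‖u‖))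
      (C := M) (f := fun t : ℂ => f (z + t • u)) (by positivity) (by
        refine DifferentiableOn.diffContOnCl fun t ht => ?_
        rw [closure_ball _ (by positivity)] at ht
        exact (hderiv z u t (hl t ht)).differentiableAt.differentiableWithinAt) (fun t ht =>
          hM _ (hl t (Metric.sphere_subset_closedBall ht)))
    rw [h0.deriv] at hc
    simp only [zero_smul, add_zero] at hc
    refine hc.trans (le_of_eq ?_)
    field_simp
  have hU : Metric.ball z₀ (R / 4) ∈ nhds z₀ := Metric.ball_mem_nhds _ (by positivity)
  have hcirc : ∀ θ : ℝ, circleMap 0 ρ θ ∈ Metric.closedBall (0 : ℂ) ρ := fun θ => by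
    simp [abs_of_pos hρ]
  have hl : ∀ z ∈ Metric.ball z₀ (R / 4), ∀ t ∈ Metric.closedBall (0 : ℂ) ρ,
      z + t • v ∈ Metric.closedBall z₀ R := fun z hz =>
    hline z v ρ (R / 4) hz (by linarith)
  have hl2 : ∀ z ∈ Metric.ball z₀ (R / 4), ∀ t ∈ Metric.closedBall (0 : ℂ) ρ,
      z + t • v ∈ Metric.ball z₀ (R / 2) := by
    intro z hz t ht
    rw [mem_ball_iff_norm] at *
    have : ‖t • v‖ ≤ ρ * ‖v‖ := by
      rw [norm_smul]; gcongr; simpa using ht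
    calc ‖z + t • v - z₀‖ = ‖(z - z₀) + t • v‖ := by congr 1; abel
      _ ≤ ‖z - z₀‖ + ‖t • v‖ := norm_add_le _ _
      _ < R / 2 := by linarith
  -- Cauchy's formula for the derivative along the line z + t v, with a radius that does not depend
  -- on z, so that it can be differentiated in z under the integral.
  have hrep : ∀ z ∈ Metric.ball z₀ (R / 4), fderiv ℂ f z v = (2 * Real.pi * Complex.I)⁻¹ •
      ∫ θ in (0 : ℝ)..2 * Real.pi, (circleMap 0 ρ θ * Complex.I * ((circleMap 0 ρ θ) ^ 2)⁻¹) *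
        f (z + circleMap 0 ρ θ • v) := by
    intro z hz
    have hopen : IsOpen {t : ℂ | z + t • v ∈ Ω} := hΩ.preimage (by fun_prop)
    have h := Complex.two_pi_I_inv_smul_circleIntegral_sub_sq_inv_smul_of_differentiable
      (U := {t : ℂ | z + t • v ∈ Ω}) hopen (c := 0) (R := ρ) (w₀ := 0)
      (f := fun t : ℂ => f (z + t • v)) (fun t ht => hRΩ (hl z hz t ht))
      (hf.comp (by fun_prop) fun t ht => ht) (by simpa using hρ)
    have h0 := (hderiv z v 0 (hl z hz 0 (by simp [hρ.le]))).deriv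
    simp only [zero_smul, add_zero] at h0
    rw [← h0, ← h]
    congr 1
    simp only [circleIntegral, deriv_circleMap, smul_eq_mul, sub_zero, mul_assoc]
  have hker : Continuous fun θ : ℝ => circleMap 0 ρ θ * Complex.I * ((circleMap 0 ρ θ) ^ 2)⁻¹ := by
    refine Continuous.mul (by fun_prop) (Continuous.inv₀ (by fun_prop) fun θ => ?_)
    exact pow_ne_zero _ (circleMap_ne_center hρ.ne')
  obtain ⟨N, hN⟩ := (isCompact_uIcc (a := (0 : ℝ)) (b := 2 * Real.pi)).exists_bound_of_continuousOn
    hker.continuousOn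
  have hfcont : ∀ z ∈ Metric.ball z₀ (R / 4), Continuous fun θ : ℝ =>
      (circleMap 0 ρ θ * Complex.I * ((circleMap 0 ρ θ) ^ 2)⁻¹) * f (z + circleMap 0 ρ θ • v) := by
    intro z hz
    refine hker.mul (continuous_iff_continuousAt.2 fun θ => ?_)
    exact ContinuousAt.comp (f := fun θ : ℝ => z + circleMap 0 ρ θ • v)
      (hd _ (hl z hz _ (hcirc θ))).continuousAt (by fun_prop)
  have hz₀' : z₀ ∈ Metric.ball z₀ (R / 4) := Metric.mem_ball_self (by positivity)
  have hmain := intervalIntegral.hasFDerivAt_integral_of_dominated_of_fderiv_le (𝕜 := ℂ)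
    (μ := volume) (a := 0) (b := 2 * Real.pi) (s := Metric.ball z₀ (R / 4)) (x₀ := z₀)
    (F := fun z θ => (circleMap 0 ρ θ * Complex.I * ((circleMap 0 ρ θ) ^ 2)⁻¹) *
      f (z + circleMap 0 ρ θ • v))
    (F' := fun z θ => (circleMap 0 ρ θ * Complex.I * ((circleMap 0 ρ θ) ^ 2)⁻¹) •
      fderiv ℂ f (z + circleMap 0 ρ θ • v))
    (bound := fun _ => N * (4 * M / R)) hU
    (by filter_upwards [hU] with z hz using (hfcont z hz).aestronglyMeasurable)
    ((hfcont z₀ hz₀').intervalIntegrable _ _)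
    (by
      refine hker.aestronglyMeasurable.smul (Measurable.aestronglyMeasurable ?_)
      exact (measurable_fderiv ℂ f).comp (by fun_prop :
        Continuous fun θ : ℝ => z₀ + circleMap 0 ρ θ • v).measurable)
    (by
      refine Filter.Eventually.of_forall fun θ hθ z hz => ?_
      rw [norm_smul]
      exact mul_le_mul (hN θ (uIoc_subset_uIcc hθ)) (hbound _ (hl2 z hz _ (hcirc θ)))
        (norm_nonneg _) ((norm_nonneg _).trans (hN θ (uIoc_subset_uIcc hθ))))
    intervalIntegrable_const
    (by
      refine Filter.Eventually.of_forall fun θ hθ z hz => ?_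
      refine HasFDerivAt.const_mul ?_ _
      exact (hasFDerivAt_comp_add_right _).2 (hd _ (hl z hz _ (hcirc θ))).hasFDerivAt)
  refine DifferentiableAt.differentiableWithinAt ?_
  refine DifferentiableAt.congr_of_eventuallyEq
    (hmain.differentiableAt.const_smul (2 * Real.pi * Complex.I)⁻¹) ?_
  filter_upwards [hU] with z hz
  exact hrep z hz

/-! ## The Bergman kernel of the symmetrized bidisk -/

/-- The denominator of the Bergman kernel of the symmetrized bidisk. -/
def symDenom (q : (ℂ × ℂ) × (ℂ × ℂ)) : ℂ :=
  1 - q.1.1 * q.2.1 + q.1.2 * (q.2.1 ^ 2 - 2 * q.2.2) + q.1.1 ^ 2 * q.2.2 -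
    q.1.1 * q.1.2 * q.2.1 * q.2.2 + q.1.2 ^ 2 * q.2.2 ^ 2

/-- The Bergman kernel of the symmetrized bidisk as a rational function of `(z, conj ζ)`. -/
def symKernelAux (q : (ℂ × ℂ) × (ℂ × ℂ)) : ℂ :=
  ((Real.pi : ℂ) ^ 2)⁻¹ * ((2 - q.1.1 * q.2.1 + 2 * (q.1.2 * q.2.2)) * (symDenom q ^ 2)⁻¹)

/-- The Bergman kernel of the symmetrized bidisk. -/
def symKernel (z ζ : ℂ × ℂ) : ℂ := symKernelAux (z, conjProd ζ)

lemma conjProd_symMap (η : ℂ × ℂ) : conjProd (symMap η) = symMap (conjProd η) := by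
  simp [conjProd, symMap]

/-- The denominator is the product of all four factors 1 - wᵢ ηⱼ. Being symmetric in w and in η, it
is a polynomial in the symmetrized coordinates. -/
lemma symDenom_symMap (w η : ℂ × ℂ) : symDenom (symMap w, symMap η) =
    ((1 - w.1 * η.1) * (1 - w.2 * η.2)) * ((1 - w.1 * η.2) * (1 - w.2 * η.1)) := by
  simp only [symDenom, symMap]; ring

lemma symDenom_ne_zero {z ζ : ℂ × ℂ} (hz : z ∈ symBidisk)
    (hζ : ζ ∈ symMap '' Metric.closedBall 0 1) : symDenom (z, conjProd ζ) ≠ 0 := by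
  rw [symBidisk_eq_image] at hz
  obtain ⟨w, hw, rfl⟩ := hz
  obtain ⟨η, hη, rfl⟩ := hζ
  rw [mem_bidisk] at hw
  rw [mem_closedBall_zero_iff, Prod.norm_def, max_le_iff] at hη
  rw [conjProd_symMap, symDenom_symMap]
  simp only [conjProd]
  refine mul_ne_zero (mul_ne_zero ?_ ?_) (mul_ne_zero ?_ ?_)
  · exact one_sub_mul_conj_ne_zero hw.1 hη.1
  · exact one_sub_mul_conj_ne_zero hw.2 hη.2
  · exact one_sub_mul_conj_ne_zero hw.1 hη.2
  · exact one_sub_mul_conj_ne_zero hw.2 hη.1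

@[fun_prop]
lemma contDiff_symDenom : ContDiff ℂ 1 symDenom := by unfold symDenom; fun_prop

lemma contDiffAt_symKernelAux {q : (ℂ × ℂ) × (ℂ × ℂ)} (hq : symDenom q ≠ 0) :
    ContDiffAt ℂ 1 symKernelAux q := by
  unfold symKernelAux
  refine contDiffAt_const.mul (ContDiffAt.mul (by fun_prop) (ContDiffAt.inv ?_ (pow_ne_zero 2 hq)))
  exact (contDiff_symDenom.pow 2).contDiffAt

lemma conj_symKernel (z ζ : ℂ × ℂ) : conj (symKernel z ζ) = symKernel ζ z := by
  simp only [symKernel, symKernelAux, symDenom, conjProd]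
  simp only [map_mul, map_inv₀, map_pow, map_add, map_sub, map_one, map_ofNat, Complex.conj_conj,
    Complex.conj_ofReal]
  ring_nf

lemma measurable_symKernel (z : ℂ × ℂ) : Measurable (symKernel z) := by
  have h : Measurable symDenom := contDiff_symDenom.continuous.measurable
  have h2 : Measurable symKernelAux := by unfold symKernelAux; fun_prop
  exact h2.comp (by fun_prop : Measurable fun ζ => (z, conjProd ζ))

/-- With AB and CD the products of the direct and of the crossed factors, 1/(AB)² - 1/(CD)² has
numerator (CD - AB)(CD + AB). The first factor is J(w) times the conjugate of J(η); the second is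
symmetric and is the numerator of `symKernelAux`. -/
lemma bidiskKernel_sub_swap {w η : ℂ × ℂ} (hw : w ∈ bidisk) (hη : η ∈ bidisk) :
    bidiskKernel w η - bidiskKernel w η.swap =
      jac w * (conj (jac η) * symKernel (symMap w) (symMap η)) := by
  rw [mem_bidisk] at hw hη
  have h1 := one_sub_mul_conj_ne_zero hw.1 hη.1.le
  have h2 := one_sub_mul_conj_ne_zero hw.2 hη.2.le
  have h3 := one_sub_mul_conj_ne_zero hw.1 hη.2.le
  have h4 := one_sub_mul_conj_ne_zero hw.2 hη.1.le
  rw [symKernel, symKernelAux, conjProd_symMap, symDenom_symMap]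
  simp only [bidiskKernel, diskKernel, conjProd, symMap, jac, Prod.fst_swap, Prod.snd_swap, map_sub]
  generalize conj η.1 = c at *
  generalize conj η.2 = d at *
  generalize w.1 = a at *
  generalize w.2 = b at *
  have key : ∀ p A B C D : ℂ, A ≠ 0 → B ≠ 0 → C ≠ 0 → D ≠ 0 →
      p * (A ^ 2)⁻¹ * (p * (B ^ 2)⁻¹) - p * (C ^ 2)⁻¹ * (p * (D ^ 2)⁻¹) =
        p ^ 2 * ((C * D - A * B) * ((C * D + A * B) * ((A * B * (C * D)) ^ 2)⁻¹)) := by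
    intro p A B C D hA hB hC hD
    field_simp
    ring
  rw [key _ _ _ _ _ h1 h2 h3 h4, inv_pow]
  ring

/-! ### Transformation formula between the two Bergman integrals -/

lemma exists_bound_bidiskKernel {w : ℂ × ℂ} (hw : w ∈ bidisk) :
    ∃ M, ∀ η ∈ bidisk, ‖bidiskKernel w η‖ ≤ M := by
  obtain ⟨M₁, hM₁⟩ := (isCompact_closedBall (0 : ℂ) 1).exists_bound_of_continuousOn
    (continuousOn_diskKernel (mem_disk.2 (mem_bidisk.1 hw).1))
  obtain ⟨M₂, hM₂⟩ := (isCompact_closedBall (0 : ℂ) 1).exists_bound_of_continuousOn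
    (continuousOn_diskKernel (mem_disk.2 (mem_bidisk.1 hw).2))
  refine ⟨M₁ * M₂, fun η hη => ?_⟩
  rw [bidiskKernel, norm_mul]
  have h := mem_bidisk.1 hη
  have h1 := hM₁ η.1 (by simpa using h.1.le)
  have h2 := hM₂ η.2 (by simpa using h.2.le)
  exact mul_le_mul h1 h2 (norm_nonneg _) ((norm_nonneg _).trans h1)

lemma integrableOn_bidiskKernel_mul {w : ℂ × ℂ} (hw : w ∈ bidisk) {F : ℂ × ℂ → ℂ}
    (hF : IntegrableOn F bidisk) : IntegrableOn (fun η => bidiskKernel w η * F η) bidisk := by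
  obtain ⟨M, hM⟩ := exists_bound_bidiskKernel hw
  refine Integrable.bdd_mul (c := M) hF (Measurable.aestronglyMeasurable (by fun_prop)) ?_
  filter_upwards [ae_restrict_mem measurableSet_bidisk] with η hη
  exact hM η hη

lemma measurePreserving_swap_bidisk :
    MeasurePreserving Prod.swap (volume.restrict bidisk) (volume.restrict bidisk) := by
  rw [volume_restrict_bidisk]
  exact Measure.measurePreserving_swap

lemma integral_bidisk_swap (F : ℂ × ℂ → ℂ) :
    ∫ η in bidisk, F η.swap = ∫ η in bidisk, F η :=
  measurePreserving_swap_bidisk.integral_comp MeasurableEquiv.prodComm.measurableEmbedding F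

/-- Bell's transformation formula. The function J · (f ∘ symMap) is odd under the swap, so pairing
it with the antisymmetrized kernel doubles the integral, which matches the factor 2 in
`integral_symMap`. Integrability of that function suffices; f need not be in L². -/
lemma jac_mul_integral_symKernel {f : ℂ × ℂ → ℂ}
    (hf : AEStronglyMeasurable f (volume.restrict symBidisk))
    (hi : IntegrableOn (fun η => jac η * f (symMap η)) bidisk) {w : ℂ × ℂ} (hw : w ∈ bidisk) :
    jac w * ∫ ζ in symBidisk, symKernel (symMap w) ζ * f ζ =
      ∫ η in bidisk, bidiskKernel w η * (jac η * f (symMap η)) := by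
  set F : ℂ × ℂ → ℂ := fun η => jac η * f (symMap η)
  have h1 := integral_symMap (u := fun ζ => symKernel (symMap w) ζ * f ζ)
    ((measurable_symKernel _).aestronglyMeasurable.mul hf)
  have hKF := integrableOn_bidiskKernel_mul hw hi
  have hswap : ∫ η in bidisk, bidiskKernel w η.swap * F η = - ∫ η in bidisk, bidiskKernel w η * F η := by
    rw [← integral_bidisk_swap, ← integral_neg]
    refine integral_congr_ae (Filter.Eventually.of_forall fun η => ?_)
    simp [F, jac_swap, symMap_swap]
  have hKF' : IntegrableOn (fun η => bidiskKernel w η.swap * F η) bidisk := by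
    have := measurePreserving_swap_bidisk.integrable_comp_of_integrable hKF
    refine this.neg.congr (Filter.Eventually.of_forall fun η => ?_)
    simp [F, jac_swap, symMap_swap]
  have h2 : jac w * ∫ η in bidisk,
      (‖jac η‖ ^ 2 : ℝ) * (symKernel (symMap w) (symMap η) * f (symMap η)) =
      2 * ∫ η in bidisk, bidiskKernel w η * F η := by
    rw [two_mul]
    nth_rewrite 2 [← neg_neg (∫ η in bidisk, bidiskKernel w η * F η)]
    rw [← hswap, ← sub_eq_add_neg, ← integral_sub hKF hKF', ← integral_const_mul]
    refine setIntegral_congr_fun measurableSet_bidisk fun η hη => ?_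
    rw [← sub_mul, bidiskKernel_sub_swap hw hη]
    have : ((‖jac η‖ ^ 2 : ℝ) : ℂ) = conj (jac η) * jac η := by
      rw [← Complex.normSq_eq_norm_sq, Complex.normSq_eq_conj_mul_self]
    rw [this]
    simp only [F]; ring
  rw [h1] at h2
  linear_combination h2 / 2

lemma memLp_jac_mul_comp {f : ℂ × ℂ → ℂ}
    (hf : AEStronglyMeasurable (fun η => f (symMap η)) (volume.restrict bidisk))
    (hf2 : MemLp f 2 (volume.restrict symBidisk)) :
    MemLp (fun η => jac η * f (symMap η)) 2 (volume.restrict bidisk) := by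
  refine ⟨measurable_jac.aestronglyMeasurable.mul hf, ?_⟩
  rw [eLpNorm_lt_top_iff_lintegral_rpow_enorm_lt_top (by simp) (by simp)]
  have h := hf2.2
  rw [eLpNorm_lt_top_iff_lintegral_rpow_enorm_lt_top (by simp) (by simp)] at h
  have h3 := lintegral_symMap (fun z => ‖f z‖ₑ ^ (2 : ℝ≥0∞).toReal)
  refine lt_of_eq_of_lt ?_ (h3 ▸ ENNReal.mul_lt_top (by simp) h)
  refine lintegral_congr fun w => ?_
  simp [enorm_mul, mul_pow]

lemma exists_bound_symKernel {z : ℂ × ℂ} (hz : z ∈ symBidisk) :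
    ∃ M, ∀ ζ ∈ symBidisk, ‖symKernel z ζ‖ ≤ M := by
  obtain ⟨M, hM⟩ := isCompact_image_symMap.exists_bound_of_continuousOn (f := symKernel z)
    (fun ζ hζ => by
      refine ContinuousAt.continuousWithinAt ?_
      exact ContinuousAt.comp (f := fun ζ => (z, conjProd ζ))
        (contDiffAt_symKernelAux (symDenom_ne_zero hz hζ)).continuousAt (by fun_prop))
  exact ⟨M, fun ζ hζ => hM ζ (symBidisk_subset_image hζ)⟩

theorem differentiableOn_integral_symKernel {f : ℂ × ℂ → ℂ}
    (hf : Integrable f (volume.restrict symBidisk)) :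
    DifferentiableOn ℂ (fun z => ∫ ζ in symBidisk, symKernel z ζ * f ζ) symBidisk := by
  intro z hz
  obtain ⟨L, hL, -⟩ := hasFDerivAt_integral_kernel (κ := symKernelAux) isCompact_image_symMap
    (fun ζ hζ => contDiffAt_symKernelAux (symDenom_ne_zero hz hζ))
    ((ae_restrict_mem measurableSet_symBidisk).mono fun ζ hζ => symBidisk_subset_image hζ) hf
  exact hL.differentiableAt.differentiableWithinAt

/-- The bidisk kernel reproduces J · (F ∘ symMap), and one divides by J. This fails on the
discriminant, a null set, which is harmless for identifying the projection. -/
lemma symKernel_reproducing_ae : ∀ᵐ z ∂(volume.restrict symBidisk),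
    DifferentiableOn ℂ (fun ζ => conj (symKernel z ζ)) symBidisk ∧
      MemLp (fun ζ => conj (symKernel z ζ)) 2 (volume.restrict symBidisk) ∧
      ∀ F : ℂ × ℂ → ℂ, DifferentiableOn ℂ F symBidisk → MemLp F 2 (volume.restrict symBidisk) →
        F z = ∫ ζ in symBidisk, symKernel z ζ * F ζ := by
  filter_upwards [ae_restrict_mem measurableSet_symBidisk,
    ae_restrict_of_ae ae_symMap_discriminant_ne_zero] with z hz hz0
  refine ⟨?_, ?_, fun F hF hF2 => ?_⟩
  · simp only [conj_symKernel]
    intro ζ hζ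
    refine DifferentiableAt.differentiableWithinAt ?_
    exact DifferentiableAt.comp (f := fun ζ => (ζ, conjProd z)) ζ
      ((contDiffAt_symKernelAux (symDenom_ne_zero hζ (symBidisk_subset_image hz))).differentiableAt
        (by norm_num)) (by fun_prop)
  · obtain ⟨M, hM⟩ := exists_bound_symKernel hz
    refine MemLp.of_bound (C := M) ?_ ?_
    · exact (Complex.continuous_conj.measurable.comp (measurable_symKernel z)).aestronglyMeasurable
    · filter_upwards [ae_restrict_mem measurableSet_symBidisk] with ζ hζ
      simpa using hM ζ hζ
  · obtain ⟨w, hw, rfl⟩ := symBidisk_eq_image ▸ hz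
    rw [jac_sq] at hz0
    have hj : jac w ≠ 0 := by simpa using hz0
    have hV : DifferentiableOn ℂ (fun η => jac η * F (symMap η)) bidisk := by
      refine DifferentiableOn.mul (by unfold jac; fun_prop) ?_
      exact hF.comp (fun η _ => (hasFDerivAt_symMap η).differentiableAt.differentiableWithinAt)
        fun η hη => symMap_mem hη
    have hFm : AEStronglyMeasurable (fun η => F (symMap η)) (volume.restrict bidisk) :=
      (hF.continuousOn.comp continuous_symMap.continuousOn
        fun η hη => symMap_mem hη).aestronglyMeasurable measurableSet_bidisk
    have hi : IntegrableOn (fun η => jac η * F (symMap η)) bidisk :=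
      (memLp_jac_mul_comp hFm hF2).integrable (by norm_num)
    have h1 := jac_mul_integral_symKernel hF2.1 hi hw
    rw [bidiskKernel_reproducing hV hw hi] at h1
    exact (mul_left_cancel₀ hj h1).symm

/-- The holomorphic representative of the Bergman projection on the symmetrized bidisk. -/
theorem bergmanProjection_symBidisk (f : Lp ℂ 2 (volume.restrict symBidisk)) :
    bergmanProjection symBidisk f =ᵐ[volume.restrict symBidisk]
      fun z => ∫ ζ in symBidisk, symKernel z ζ * f ζ :=
  bergmanProjection_eq_integral symKernel_reproducing_ae f

/-! ## Calculus of the Wirtinger derivatives -/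

/-- The four first order Wirtinger derivatives. -/
def wder : Fin 4 → (ℂ × ℂ → ℂ) → ℂ × ℂ → ℂ :=
  ![dHol (1, 0), dBar (1, 0), dHol (0, 1), dBar (0, 1)]

lemma dHol_mul {e : ℂ × ℂ} {φ ψ : ℂ × ℂ → ℂ} {z : ℂ × ℂ} (hφ : DifferentiableAt ℝ φ z)
    (hψ : DifferentiableAt ℝ ψ z) :
    dHol e (fun z => φ z * ψ z) z = φ z * dHol e ψ z + dHol e φ z * ψ z := by
  simp only [dHol, fderiv_fun_mul hφ hψ, add_apply, smul_apply, smul_eq_mul]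
  ring

lemma dBar_mul {e : ℂ × ℂ} {φ ψ : ℂ × ℂ → ℂ} {z : ℂ × ℂ} (hφ : DifferentiableAt ℝ φ z)
    (hψ : DifferentiableAt ℝ ψ z) :
    dBar e (fun z => φ z * ψ z) z = φ z * dBar e ψ z + dBar e φ z * ψ z := by
  simp only [dBar, fderiv_fun_mul hφ hψ, add_apply, smul_apply, smul_eq_mul]
  ring

lemma dHol_eq_of_differentiableAt {e : ℂ × ℂ} {φ : ℂ × ℂ → ℂ} {z : ℂ × ℂ}
    (hφ : DifferentiableAt ℂ φ z) : dHol e φ z = fderiv ℂ φ z e := by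
  rw [dHol, hφ.fderiv_restrictScalars ℝ]
  simp only [ContinuousLinearMap.coe_restrictScalars', map_smul, smul_eq_mul]
  linear_combination (-fderiv ℂ φ z e / 2) * Complex.I_sq

lemma dBar_eq_of_differentiableAt {e : ℂ × ℂ} {φ : ℂ × ℂ → ℂ} {z : ℂ × ℂ}
    (hφ : DifferentiableAt ℂ φ z) : dBar e φ z = 0 := by
  rw [dBar, hφ.fderiv_restrictScalars ℝ]
  simp only [ContinuousLinearMap.coe_restrictScalars', map_smul, smul_eq_mul]
  linear_combination (fderiv ℂ φ z e / 2) * Complex.I_sq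

lemma fderiv_eq_wirtinger (φ : ℂ × ℂ → ℂ) (z v : ℂ × ℂ) : fderiv ℝ φ z v =
    v.1 * dHol (1, 0) φ z + conj v.1 * dBar (1, 0) φ z + v.2 * dHol (0, 1) φ z +
      conj v.2 * dBar (0, 1) φ z := by
  have hv : v = v.1.re • ((1, 0) : ℂ × ℂ) + v.1.im • (Complex.I • ((1, 0) : ℂ × ℂ)) +
      v.2.re • ((0, 1) : ℂ × ℂ) + v.2.im • (Complex.I • ((0, 1) : ℂ × ℂ)) := by
    ext <;> simp
  have h1 : v.1 = v.1.re + v.1.im * Complex.I := (Complex.re_add_im v.1).symm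
  have h2 : v.2 = v.2.re + v.2.im * Complex.I := (Complex.re_add_im v.2).symm
  have h1' : conj v.1 = v.1.re - v.1.im * Complex.I := by apply Complex.ext <;> simp
  have h2' : conj v.2 = v.2.re - v.2.im * Complex.I := by apply Complex.ext <;> simp
  have key : fderiv ℝ φ z v = v.1.re * fderiv ℝ φ z (1, 0) +
      v.1.im * fderiv ℝ φ z (Complex.I • ((1, 0) : ℂ × ℂ)) + v.2.re * fderiv ℝ φ z (0, 1) +
      v.2.im * fderiv ℝ φ z (Complex.I • ((0, 1) : ℂ × ℂ)) := by
    conv_lhs => rw [hv]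
    simp only [map_add, map_smul, Complex.real_smul]
  simp only [dHol, dBar]
  linear_combination key - (fderiv ℝ φ z (1, 0) - Complex.I * fderiv ℝ φ z (Complex.I • (1, 0))) / 2 * h1 -
    (fderiv ℝ φ z (1, 0) + Complex.I * fderiv ℝ φ z (Complex.I • (1, 0))) / 2 * h1' -
    (fderiv ℝ φ z (0, 1) - Complex.I * fderiv ℝ φ z (Complex.I • (0, 1))) / 2 * h2 -
    (fderiv ℝ φ z (0, 1) + Complex.I * fderiv ℝ φ z (Complex.I • (0, 1))) / 2 * h2' +
    (v.1.im * fderiv ℝ φ z (Complex.I • ((1, 0) : ℂ × ℂ)) +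
      v.2.im * fderiv ℝ φ z (Complex.I • ((0, 1) : ℂ × ℂ))) * Complex.I_sq

lemma symMapDeriv_apply (w v : ℂ × ℂ) :
    symMapDeriv w v = (v.1 + v.2, w.1 * v.2 + w.2 * v.1) := by
  simp [symMapDeriv]

lemma fderiv_comp_symMap {N : ℂ × ℂ → ℂ} {η : ℂ × ℂ} (hN : DifferentiableAt ℝ N (symMap η))
    (v : ℂ × ℂ) : fderiv ℝ (fun η => N (symMap η)) η v =
      fderiv ℝ N (symMap η) (symMapDeriv η v) := by
  have h := hN.hasFDerivAt.comp η ((hasFDerivAt_symMap η).restrictScalars ℝ)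
  rw [show (fun η => N (symMap η)) = N ∘ symMap from rfl, h.fderiv]
  rfl

lemma dHol_comp_symMap {N : ℂ × ℂ → ℂ} {η : ℂ × ℂ} (hN : DifferentiableAt ℝ N (symMap η))
    (e : ℂ × ℂ) : dHol e (fun η => N (symMap η)) η =
      (symMapDeriv η e).1 * dHol (1, 0) N (symMap η) +
        (symMapDeriv η e).2 * dHol (0, 1) N (symMap η) := by
  rw [dHol, fderiv_comp_symMap hN, fderiv_comp_symMap hN, fderiv_eq_wirtinger, fderiv_eq_wirtinger]
  simp only [map_smul, Prod.smul_fst, Prod.smul_snd, smul_eq_mul, map_mul, Complex.conj_I]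
  linear_combination (-(((symMapDeriv η e).1 * dHol (1, 0) N (symMap η) +
        (symMapDeriv η e).2 * dHol (0, 1) N (symMap η))) / 2 +
    (conj (symMapDeriv η e).1 * dBar (1, 0) N (symMap η) +
        conj (symMapDeriv η e).2 * dBar (0, 1) N (symMap η)) / 2) * Complex.I_sq

lemma dBar_comp_symMap {N : ℂ × ℂ → ℂ} {η : ℂ × ℂ} (hN : DifferentiableAt ℝ N (symMap η))
    (e : ℂ × ℂ) : dBar e (fun η => N (symMap η)) η =
      conj (symMapDeriv η e).1 * dBar (1, 0) N (symMap η) +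
        conj (symMapDeriv η e).2 * dBar (0, 1) N (symMap η) := by
  rw [dBar, fderiv_comp_symMap hN, fderiv_comp_symMap hN, fderiv_eq_wirtinger, fderiv_eq_wirtinger]
  simp only [map_smul, Prod.smul_fst, Prod.smul_snd, smul_eq_mul, map_mul, Complex.conj_I]
  linear_combination ((((symMapDeriv η e).1 * dHol (1, 0) N (symMap η) +
        (symMapDeriv η e).2 * dHol (0, 1) N (symMap η))) / 2 -
    (conj (symMapDeriv η e).1 * dBar (1, 0) N (symMap η) +
        conj (symMapDeriv η e).2 * dBar (0, 1) N (symMap η)) / 2) * Complex.I_sq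

lemma continuous_dHol {φ : ℂ × ℂ → ℂ} (hφ : ContDiff ℝ 1 φ) (e : ℂ × ℂ) :
    Continuous (dHol e φ) := by
  have := hφ.continuous_fderiv (by norm_num)
  unfold dHol; fun_prop

lemma continuous_dBar {φ : ℂ × ℂ → ℂ} (hφ : ContDiff ℝ 1 φ) (e : ℂ × ℂ) :
    Continuous (dBar e φ) := by
  have := hφ.continuous_fderiv (by norm_num)
  unfold dBar; fun_prop

lemma dHol_eq_zero_of_notMem_tsupport {φ : ℂ × ℂ → ℂ} {z : ℂ × ℂ} (hz : z ∉ tsupport φ)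
    (e : ℂ × ℂ) : dHol e φ z = 0 := by
  have : fderiv ℝ φ z = 0 := by
    by_contra h
    exact hz (support_fderiv_subset ℝ h)
  simp [dHol, this]

lemma dBar_eq_zero_of_notMem_tsupport {φ : ℂ × ℂ → ℂ} {z : ℂ × ℂ} (hz : z ∉ tsupport φ)
    (e : ℂ × ℂ) : dBar e φ z = 0 := by
  have : fderiv ℝ φ z = 0 := by
    by_contra h
    exact hz (support_fderiv_subset ℝ h)
  simp [dBar, this]

/-! ### Integration by parts against compactly supported functions -/

lemma integral_mul_fderiv_of_compact {u ψ : ℂ × ℂ → ℂ} {Ω : Set (ℂ × ℂ)} (hΩ : IsOpen Ω)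
    (hu : ContDiffOn ℝ 1 u Ω) (hψ : ContDiff ℝ 1 ψ) (hc : HasCompactSupport ψ)
    (hs : tsupport ψ ⊆ Ω) (v : ℂ × ℂ) :
    Integrable (fun z => u z * fderiv ℝ ψ z v) ∧ Integrable (fun z => fderiv ℝ u z v * ψ z) ∧
    ∫ z, u z * fderiv ℝ ψ z v = -∫ z, fderiv ℝ u z v * ψ z := by
  have huc : ContinuousOn u Ω := hu.continuousOn
  have hfu : ContinuousOn (fderiv ℝ u) Ω := hu.continuousOn_fderiv_of_isOpen hΩ (by norm_num)
  have aux : ∀ a b : ℂ × ℂ → ℂ, ContinuousOn a Ω → Continuous b → (∀ z ∉ tsupport ψ, b z = 0) →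
      Integrable (fun z => a z * b z) := by
    intro a b ha hb hb0
    have hsupp : Function.support (fun z => a z * b z) ⊆ tsupport ψ := by
      intro z hz
      by_contra h
      exact hz (by simp [hb0 z h])
    rw [← integrableOn_iff_integrable_of_support_subset hsupp]
    exact ((ha.mono hs).mul hb.continuousOn).integrableOn_compact hc
  have h1 : Integrable (fun z => u z * fderiv ℝ ψ z v) := by
    refine aux _ _ huc ?_ fun z hz => ?_
    · have := hψ.continuous_fderiv (by norm_num); fun_prop
    · have : fderiv ℝ ψ z = 0 := by
        by_contra h
        exact hz (support_fderiv_subset ℝ h)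
      simp [this]
  have h2 : Integrable (fun z => fderiv ℝ u z v * ψ z) :=
    aux _ _ (hfu.clm_apply continuousOn_const) hψ.continuous fun z hz => image_eq_zero_of_notMem_tsupport hz
  have h3 : Integrable (fun z => u z * ψ z) :=
    aux _ _ huc hψ.continuous fun z hz => image_eq_zero_of_notMem_tsupport hz
  refine ⟨h1, h2, integral_mul_fderiv_eq_neg_fderiv_mul_of_integrable h2 h1 h3 (fun z hz => ?_)
    fun z _ => (hψ.differentiable (by norm_num)) z⟩
  exact (hu.differentiableOn (by norm_num)).differentiableAt (hΩ.mem_nhds (hs hz))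

lemma integral_mul_dHol {u ψ : ℂ × ℂ → ℂ} {Ω : Set (ℂ × ℂ)} (hΩ : IsOpen Ω)
    (hu : ContDiffOn ℝ 1 u Ω) (hψ : ContDiff ℝ 1 ψ) (hc : HasCompactSupport ψ)
    (hs : tsupport ψ ⊆ Ω) (e : ℂ × ℂ) :
    Integrable (fun z => u z * dHol e ψ z) ∧ Integrable (fun z => dHol e u z * ψ z) ∧
    ∫ z, u z * dHol e ψ z = -∫ z, dHol e u z * ψ z := by
  obtain ⟨a1, a2, a3⟩ := integral_mul_fderiv_of_compact hΩ hu hψ hc hs e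
  obtain ⟨b1, b2, b3⟩ := integral_mul_fderiv_of_compact hΩ hu hψ hc hs (Complex.I • e)
  have e1 : (fun z => u z * dHol e ψ z) = fun z => (1 / 2 : ℂ) * (u z * fderiv ℝ ψ z e) -
      (Complex.I / 2) * (u z * fderiv ℝ ψ z (Complex.I • e)) := by
    ext z; simp only [dHol]; ring
  have e2 : (fun z => dHol e u z * ψ z) = fun z => (1 / 2 : ℂ) * (fderiv ℝ u z e * ψ z) -
      (Complex.I / 2) * (fderiv ℝ u z (Complex.I • e) * ψ z) := by
    ext z; simp only [dHol]; ring
  rw [e1, e2]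
  refine ⟨(a1.const_mul _).sub (b1.const_mul _), (a2.const_mul _).sub (b2.const_mul _), ?_⟩
  rw [integral_sub (a1.const_mul _) (b1.const_mul _), integral_sub (a2.const_mul _) (b2.const_mul _)]
  simp only [integral_const_mul, a3, b3]
  ring

lemma integral_mul_dBar {u ψ : ℂ × ℂ → ℂ} {Ω : Set (ℂ × ℂ)} (hΩ : IsOpen Ω)
    (hu : ContDiffOn ℝ 1 u Ω) (hψ : ContDiff ℝ 1 ψ) (hc : HasCompactSupport ψ)
    (hs : tsupport ψ ⊆ Ω) (e : ℂ × ℂ) :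
    Integrable (fun z => u z * dBar e ψ z) ∧ Integrable (fun z => dBar e u z * ψ z) ∧
    ∫ z, u z * dBar e ψ z = -∫ z, dBar e u z * ψ z := by
  obtain ⟨a1, a2, a3⟩ := integral_mul_fderiv_of_compact hΩ hu hψ hc hs e
  obtain ⟨b1, b2, b3⟩ := integral_mul_fderiv_of_compact hΩ hu hψ hc hs (Complex.I • e)
  have e1 : (fun z => u z * dBar e ψ z) = fun z => (1 / 2 : ℂ) * (u z * fderiv ℝ ψ z e) +
      (Complex.I / 2) * (u z * fderiv ℝ ψ z (Complex.I • e)) := by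
    ext z; simp only [dBar]; ring
  have e2 : (fun z => dBar e u z * ψ z) = fun z => (1 / 2 : ℂ) * (fderiv ℝ u z e * ψ z) +
      (Complex.I / 2) * (fderiv ℝ u z (Complex.I • e) * ψ z) := by
    ext z; simp only [dBar]; ring
  rw [e1, e2]
  refine ⟨(a1.const_mul _).add (b1.const_mul _), (a2.const_mul _).add (b2.const_mul _), ?_⟩
  rw [integral_add (a1.const_mul _) (b1.const_mul _), integral_add (a2.const_mul _) (b2.const_mul _)]
  simp only [integral_const_mul, a3, b3]
  ring

/-! ## The tangential operators on the bidisk -/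

/-- The coordinate in the direction of a basis vector `e`. -/
def coordAlong (e η : ℂ × ℂ) : ℂ := e.1 * η.1 + e.2 * η.2

/-- The formal transpose of the operator `∂_e - (conj c)² ∂̄_e`, with `c` the coordinate along the
basis vector `e`, which is tangential to the boundary circle. -/
def tangAdj (e : ℂ × ℂ) (ψ : ℂ × ℂ → ℂ) (η : ℂ × ℂ) : ℂ :=
  -dHol e ψ η + 2 * conj (coordAlong e η) * ψ η + conj (coordAlong e η) ^ 2 * dBar e ψ η

/-- The operator `∂_e - (conj c)² ∂̄_e`. -/
def tang (e : ℂ × ℂ) (ψ : ℂ × ℂ → ℂ) (η : ℂ × ℂ) : ℂ :=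
  dHol e ψ η - conj (coordAlong e η) ^ 2 * dBar e ψ η

/-- The basis vectors of `ℂ²`. -/
def IsBasisVec (e : ℂ × ℂ) : Prop := e = (1, 0) ∨ e = (0, 1)

@[fun_prop]
lemma contDiff_conj_coordAlong (e : ℂ × ℂ) {n : WithTop ℕ∞} :
    ContDiff ℝ n fun η => conj (coordAlong e η) := by
  have h : ContDiff ℝ n fun η => coordAlong e η := by unfold coordAlong; fun_prop
  exact Complex.conjCLE.contDiff.comp h

lemma fderiv_conj_coordAlong (e η v : ℂ × ℂ) :
    fderiv ℝ (fun η => conj (coordAlong e η)) η v = conj (coordAlong e v) := by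
  have h : HasFDerivAt (fun η => conj (coordAlong e η))
      ((Complex.conjCLE : ℂ →L[ℝ] ℂ).comp
        ((e.1 • ContinuousLinearMap.fst ℂ ℂ ℂ + e.2 • ContinuousLinearMap.snd ℂ ℂ ℂ).restrictScalars ℝ)) η :=
    ContinuousLinearMap.hasFDerivAt ((Complex.conjCLE : ℂ →L[ℝ] ℂ).comp
        ((e.1 • ContinuousLinearMap.fst ℂ ℂ ℂ + e.2 • ContinuousLinearMap.snd ℂ ℂ ℂ).restrictScalars ℝ))
  rw [h.fderiv]
  simp [coordAlong]

/-- This is the source of the zeroth order term of `tangAdj`, with which it cancels in the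
integration by parts. -/
lemma dBar_conj_coordAlong_sq {e : ℂ × ℂ} (he : IsBasisVec e) (η : ℂ × ℂ) :
    dBar e (fun η => conj (coordAlong e η) ^ 2) η = 2 * conj (coordAlong e η) := by
  have hd : DifferentiableAt ℝ (fun η => conj (coordAlong e η)) η :=
    (contDiff_conj_coordAlong e (n := 1)).differentiable (by norm_num) η
  have h1 : dBar e (fun η => conj (coordAlong e η)) η = 1 := by
    rw [dBar, fderiv_conj_coordAlong, fderiv_conj_coordAlong]
    rcases he with rfl | rfl <;> simp [coordAlong]
  simp only [sq]
  rw [dBar_mul hd hd, h1]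
  ring

lemma tangAdj_mul {e : ℂ × ℂ} {χ ψ : ℂ × ℂ → ℂ} {η : ℂ × ℂ} (hχ : DifferentiableAt ℝ χ η)
    (hψ : DifferentiableAt ℝ ψ η) :
    tangAdj e (fun η => χ η * ψ η) η = χ η * tangAdj e ψ η - tang e χ η * ψ η := by
  simp only [tangAdj, tang, dHol_mul hχ hψ, dBar_mul hχ hψ]
  ring

/-- Classical integration by parts for the tangential operator. -/
lemma integral_mul_tangAdj {q ψ : ℂ × ℂ → ℂ} (hq : ContDiff ℝ 1 q) (hψ : ContDiff ℝ 1 ψ)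
    (hc : HasCompactSupport ψ) {e : ℂ × ℂ} (he : IsBasisVec e) :
    ∫ η, q η * tangAdj e ψ η = ∫ η, tang e q η * ψ η := by
  have hqc : ContDiff ℝ 1 (fun η => q η * conj (coordAlong e η) ^ 2) := by fun_prop
  obtain ⟨a1, a2, a3⟩ := integral_mul_dHol isOpen_univ hq.contDiffOn hψ hc (subset_univ _) e
  obtain ⟨b1, b2, b3⟩ := integral_mul_dBar isOpen_univ hqc.contDiffOn hψ hc (subset_univ _) e
  have hi : Integrable (fun η => q η * (2 * conj (coordAlong e η) * ψ η)) := by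
    refine Continuous.integrable_of_hasCompactSupport ?_ (hc.mul_left.mul_left)
    have := hq.continuous
    have := hψ.continuous
    have := (contDiff_conj_coordAlong e (n := 1)).continuous
    fun_prop
  have e1 : ∀ η, q η * tangAdj e ψ η = (-(q η * dHol e ψ η) + q η * (2 * conj (coordAlong e η) * ψ η)) +
      q η * conj (coordAlong e η) ^ 2 * dBar e ψ η := by
    intro η; simp only [tangAdj]; ring
  have e2 : ∀ η, tang e q η * ψ η = dHol e q η * ψ η + q η * (2 * conj (coordAlong e η) * ψ η) -
      dBar e (fun η => q η * conj (coordAlong e η) ^ 2) η * ψ η := by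
    intro η
    rw [dBar_mul (hq.differentiable (by norm_num) η)
      ((by fun_prop : ContDiff ℝ 1 fun η => conj (coordAlong e η) ^ 2).differentiable (by norm_num) η),
      dBar_conj_coordAlong_sq he]
    simp only [tang]; ring
  have a1' : Integrable (fun η => -(q η * dHol e ψ η)) := a1.neg
  have c1 : Integrable (fun η => -(q η * dHol e ψ η) + q η * (2 * conj (coordAlong e η) * ψ η)) :=
    a1'.add hi
  have c2 : Integrable (fun η => dHol e q η * ψ η + q η * (2 * conj (coordAlong e η) * ψ η)) :=
    a2.add hi
  simp_rw [e1, e2]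
  rw [integral_add c1 b1, integral_add a1' hi, integral_sub c2 b2, integral_add a2 hi, integral_neg,
    a3, b3]
  ring

/-! ## Translations and mollification -/

/-- The L¹ embedding absorbs the weight |J|² in the change of variables, so pullbacks of L^p
functions are integrable on the bidisk with no Jacobian factor, as the chain rule needs. -/
lemma lintegral_comp_symMap_le {p : ℝ} (hp : 1 < p) {A : ℝ≥0}
    (hA : ∀ u : ℂ × ℂ → ℝ≥0∞, Measurable u → (∫⁻ η in bidisk, u η) ^ p ≤
      A * ∫⁻ w in bidisk, u w ^ p * ‖jac w‖ₑ ^ 2) {w : ℂ × ℂ → ℂ} (hw : Measurable w) :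
    ∫⁻ η in bidisk, ‖w (symMap η)‖ₑ ≤
      ((A : ℝ≥0∞) * 2) ^ (1 / p) * eLpNorm w (ENNReal.ofReal p) volume := by
  have hp0 : 0 < p := by linarith
  have h1 := hA (fun η => ‖w (symMap η)‖ₑ) (by fun_prop)
  have h2 := lintegral_symMap (fun z => ‖w z‖ₑ ^ p)
  simp only [mul_comm (‖jac _‖ₑ ^ 2)] at h2
  rw [h2] at h1
  have h3 : ∫⁻ z in symBidisk, ‖w z‖ₑ ^ p ≤ ∫⁻ z, ‖w z‖ₑ ^ p := setLIntegral_le_lintegral _ _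
  rw [eLpNorm_eq_lintegral_rpow_enorm_toReal (by simpa using hp0) (by simp),
    ENNReal.toReal_ofReal hp0.le, ← ENNReal.mul_rpow_of_nonneg _ _ (by positivity),
    one_div, ENNReal.le_rpow_inv_iff hp0, mul_assoc]
  exact h1.trans (by gcongr)

lemma tendsto_eLpNorm_translate {p : ℝ} (hp : 1 < p) {u : ℂ × ℂ → ℂ}
    (hu : MemLp u (ENNReal.ofReal p) volume) (y₀ : ℂ × ℂ) :
    Filter.Tendsto (fun y => eLpNorm (fun z => u (z - y) - u (z - y₀)) (ENNReal.ofReal p) volume)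
      (nhds y₀) (nhds 0) := by
  have : Fact (1 ≤ ENNReal.ofReal p) := ⟨by simpa using hp.le⟩
  set g : (ℂ × ℂ) → C(ℂ × ℂ, ℂ × ℂ) := fun y => ⟨fun z => z - y, by fun_prop⟩
  have hg : Continuous g :=
    ContinuousMap.continuous_of_continuous_uncurry _ (by
      simp only [g, Function.uncurry_def, ContinuousMap.coe_mk]; fun_prop)
  have hgm : ∀ y, MeasurePreserving (g y) volume volume := fun y =>
    measurePreserving_sub_right volume y
  have hc := Continuous.compMeasurePreservingLp (f := fun _ : ℂ × ℂ => hu.toLp u) continuous_const hg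
    hgm (by simp)
  have h1 := tendsto_iff_edist_tendsto_0.1 (hc.tendsto y₀)
  refine h1.congr fun y => ?_
  rw [Lp.edist_def]
  refine eLpNorm_congr_ae ?_
  have h2 : ∀ y, (Lp.compMeasurePreserving (g y) (hgm y) (hu.toLp u) : ℂ × ℂ → ℂ) =ᵐ[volume]
      fun z => u (z - y) := fun y =>
    (Lp.coeFn_compMeasurePreserving _ (hgm y)).trans
      ((hgm y).quasiMeasurePreserving.ae_eq_comp hu.coeFn_toLp)
  exact (h2 y).sub (h2 y₀)

lemma integrableOn_comp_symMap {p : ℝ} (hp : 1 < p) {A : ℝ≥0}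
    (hA : ∀ u : ℂ × ℂ → ℝ≥0∞, Measurable u → (∫⁻ η in bidisk, u η) ^ p ≤
      A * ∫⁻ w in bidisk, u w ^ p * ‖jac w‖ₑ ^ 2) {u : ℂ × ℂ → ℂ} (hu : Measurable u)
    (hup : MemLp u (ENNReal.ofReal p) volume) :
    IntegrableOn (fun η => u (symMap η)) bidisk := by
  refine ⟨Measurable.aestronglyMeasurable (by fun_prop), ?_⟩
  rw [hasFiniteIntegral_iff_enorm]
  refine (lintegral_comp_symMap_le hp hA hu).trans_lt (ENNReal.mul_lt_top ?_ hup.2)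
  exact ENNReal.rpow_lt_top_of_nonneg (by positivity) (by finiteness)

/-- Translation is continuous in L^p downstairs, and pullback is continuous from L^p to L¹. This
lets an identity averaged over small y be evaluated at y = 0. -/
lemma continuous_integral_translate {p : ℝ} (hp : 1 < p) {A : ℝ≥0}
    (hA : ∀ u : ℂ × ℂ → ℝ≥0∞, Measurable u → (∫⁻ η in bidisk, u η) ^ p ≤
      A * ∫⁻ w in bidisk, u w ^ p * ‖jac w‖ₑ ^ 2) {u : ℂ × ℂ → ℂ} (hu : Measurable u)
    (hup : MemLp u (ENNReal.ofReal p) volume) {θ : ℂ × ℂ → ℂ} (hθ : Measurable θ) {M : ℝ}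
    (hM : ∀ η, ‖θ η‖ ≤ M) :
    Continuous fun y => ∫ η in bidisk, u (symMap η - y) * θ η := by
  have hmem : ∀ y, MemLp (fun z => u (z - y)) (ENNReal.ofReal p) volume := fun y =>
    hup.comp_measurePreserving (measurePreserving_sub_right volume y)
  have hint : ∀ y, Integrable (fun η => u (symMap η - y) * θ η) (volume.restrict bidisk) := fun y =>
    (integrableOn_comp_symMap hp hA (u := fun z => u (z - y)) (by fun_prop) (hmem y)).mul_bdd
      (c := M) hθ.aestronglyMeasurable (Filter.Eventually.of_forall hM)
  rw [continuous_iff_continuousAt]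
  intro y₀
  rw [ContinuousAt, tendsto_iff_edist_tendsto_0]
  have hlim : Filter.Tendsto (fun y => ((A : ℝ≥0∞) * 2) ^ (1 / p) *
      eLpNorm (fun z => u (z - y) - u (z - y₀)) (ENNReal.ofReal p) volume * ENNReal.ofReal M)
      (nhds y₀) (nhds 0) := by
    have h := ENNReal.Tendsto.mul_const (ENNReal.Tendsto.const_mul
      (a := ((A : ℝ≥0∞) * 2) ^ (1 / p)) (tendsto_eLpNorm_translate hp hup y₀) (Or.inr
      (ENNReal.rpow_lt_top_of_nonneg (by positivity) (by finiteness)).ne))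
      (b := ENNReal.ofReal M) (Or.inr ENNReal.ofReal_ne_top)
    simpa using h
  refine tendsto_of_tendsto_of_tendsto_of_le_of_le tendsto_const_nhds hlim (fun _ => zero_le)
    fun y => ?_
  simp only
  rw [edist_eq_enorm_sub, ← integral_sub (hint y) (hint y₀)]
  refine (enorm_integral_le_lintegral_enorm _).trans ?_
  calc ∫⁻ η in bidisk, ‖u (symMap η - y) * θ η - u (symMap η - y₀) * θ η‖ₑ
      ≤ ∫⁻ η in bidisk, ‖u (symMap η - y) - u (symMap η - y₀)‖ₑ * ENNReal.ofReal M := by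
        refine lintegral_mono fun η => ?_
        simp only
        rw [← sub_mul, enorm_mul]
        gcongr
        rw [← ofReal_norm]
        exact ENNReal.ofReal_le_ofReal (hM η)
    _ ≤ _ := by
        rw [lintegral_mul_const _ (by fun_prop)]
        gcongr
        exact lintegral_comp_symMap_le hp hA (w := fun z => u (z - y) - u (z - y₀)) (by fun_prop)

/-- Convolution with a smooth function, for complex valued functions on `ℂ²`. -/
def moll (ρ u : ℂ × ℂ → ℂ) : ℂ × ℂ → ℂ :=
  MeasureTheory.convolution ρ u (ContinuousLinearMap.mul ℝ ℂ) volume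

lemma moll_apply (ρ u : ℂ × ℂ → ℂ) (x : ℂ × ℂ) : moll ρ u x = ∫ t, ρ t * u (x - t) := rfl

lemma moll_apply' (ρ u : ℂ × ℂ → ℂ) (x : ℂ × ℂ) : moll ρ u x = ∫ z, ρ (x - z) * u z := by
  rw [moll_apply, ← integral_sub_left_eq_self (fun t => ρ t * u (x - t)) volume x]
  simp

lemma contDiff_moll {ρ u : ℂ × ℂ → ℂ} (hc : HasCompactSupport ρ) (hρ : ContDiff ℝ 1 ρ)
    (hu : Integrable u) : ContDiff ℝ 1 (moll ρ u) :=
  hc.contDiff_convolution_left _ hρ hu.locallyIntegrable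

lemma fderiv_moll {ρ u : ℂ × ℂ → ℂ} (hc : HasCompactSupport ρ) (hρ : ContDiff ℝ 1 ρ)
    (hu : Integrable u) (x v : ℂ × ℂ) :
    Integrable (fun z => fderiv ℝ ρ (x - z) v * u z) ∧
    fderiv ℝ (moll ρ u) x v = ∫ z, fderiv ℝ ρ (x - z) v * u z := by
  have h := (hc.hasFDerivAt_convolution_left (ContinuousLinearMap.mul ℝ ℂ) hρ
    hu.locallyIntegrable x).fderiv
  have hcont : Continuous (fun z => fderiv ℝ ρ (x - z)) := by
    have := hρ.continuous_fderiv (by norm_num); fun_prop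
  have hbdd : ∃ C, ∀ t, ‖fderiv ℝ ρ t‖ ≤ C :=
    (hρ.continuous_fderiv (by norm_num)).bounded_above_of_compact_support (hc.fderiv ℝ)
  obtain ⟨C, hC⟩ := hbdd
  have hex : MeasureTheory.ConvolutionExistsAt (fderiv ℝ ρ) u x
      (ContinuousLinearMap.precompL (ℂ × ℂ) (ContinuousLinearMap.mul ℝ ℂ)) volume :=
    (hc.fderiv ℝ).convolutionExists_left _ (hρ.continuous_fderiv (by norm_num))
      hu.locallyIntegrable x
  refine ⟨hu.bdd_mul (c := C * ‖v‖) ?_ ?_, ?_⟩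
  · have := hcont.clm_apply (continuous_const (y := v))
    exact this.aestronglyMeasurable
  · exact Filter.Eventually.of_forall fun z => (ContinuousLinearMap.le_opNorm _ _).trans
      (by gcongr; exact hC _)
  · rw [moll, h, MeasureTheory.convolution, ContinuousLinearMap.integral_apply hex]
    simp only [ContinuousLinearMap.precompL_apply, ContinuousLinearMap.mul_apply']
    rw [← integral_sub_left_eq_self (fun t => fderiv ℝ ρ t v * u (x - t)) volume x]
    simp

lemma dHol_moll {ρ u : ℂ × ℂ → ℂ} (hc : HasCompactSupport ρ) (hρ : ContDiff ℝ 1 ρ)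
    (hu : Integrable u) (x e : ℂ × ℂ) :
    dHol e (moll ρ u) x = -∫ z, u z * dHol e (fun z => ρ (x - z)) z := by
  obtain ⟨a1, a2⟩ := fderiv_moll hc hρ hu x e
  obtain ⟨b1, b2⟩ := fderiv_moll hc hρ hu x (Complex.I • e)
  have hf : ∀ z v, fderiv ℝ (fun z => ρ (x - z)) z v = - fderiv ℝ ρ (x - z) v := by
    intro z v
    have h1 : HasFDerivAt (fun z => x - z) (-(ContinuousLinearMap.id ℝ (ℂ × ℂ))) z :=
      (hasFDerivAt_id z).const_sub x
    have h2 := ((hρ.differentiable (by norm_num) (x - z)).hasFDerivAt).comp z h1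
    rw [show (fun z => ρ (x - z)) = ρ ∘ fun z => x - z from rfl, h2.fderiv]
    simp
  simp only [dHol, hf, a2, b2]
  rw [← integral_neg, ← integral_const_mul, ← integral_sub a1 (b1.const_mul _), ← integral_div]
  refine integral_congr_ae (Filter.Eventually.of_forall fun z => ?_)
  simp only; ring

lemma dBar_moll {ρ u : ℂ × ℂ → ℂ} (hc : HasCompactSupport ρ) (hρ : ContDiff ℝ 1 ρ)
    (hu : Integrable u) (x e : ℂ × ℂ) :
    dBar e (moll ρ u) x = -∫ z, u z * dBar e (fun z => ρ (x - z)) z := by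
  obtain ⟨a1, a2⟩ := fderiv_moll hc hρ hu x e
  obtain ⟨b1, b2⟩ := fderiv_moll hc hρ hu x (Complex.I • e)
  have hf : ∀ z v, fderiv ℝ (fun z => ρ (x - z)) z v = - fderiv ℝ ρ (x - z) v := by
    intro z v
    have h1 : HasFDerivAt (fun z => x - z) (-(ContinuousLinearMap.id ℝ (ℂ × ℂ))) z :=
      (hasFDerivAt_id z).const_sub x
    have h2 := ((hρ.differentiable (by norm_num) (x - z)).hasFDerivAt).comp z h1
    rw [show (fun z => ρ (x - z)) = ρ ∘ fun z => x - z from rfl, h2.fderiv]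
    simp
  simp only [dBar, hf, a2, b2]
  rw [← integral_neg, ← integral_const_mul, ← integral_add a1 (b1.const_mul _), ← integral_div]
  refine integral_congr_ae (Filter.Eventually.of_forall fun z => ?_)
  simp only; ring

lemma wder_moll {ρ u : ℂ × ℂ → ℂ} (hc : HasCompactSupport ρ) (hρ : ContDiff ℝ 1 ρ)
    (hu : Integrable u) (x : ℂ × ℂ) (i : Fin 4) :
    wder i (moll ρ u) x = -∫ z, u z * wder i (fun z => ρ (x - z)) z := by
  fin_cases i
  · exact dHol_moll hc hρ hu x _
  · exact dBar_moll hc hρ hu x _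
  · exact dHol_moll hc hρ hu x _
  · exact dBar_moll hc hρ hu x _

/-- `v' i`, `i < 4`, are the weak first order derivatives of `v` on the symmetrized bidisk; all
functions are extended by zero, and in `L^p`. -/
structure HasWeakGrad (p : ℝ) (v : ℂ × ℂ → ℂ) (v' : Fin 4 → ℂ × ℂ → ℂ) : Prop where
  measurable_fun : Measurable v
  measurable_deriv : ∀ i, Measurable (v' i)
  memLp_fun : MemLp v (ENNReal.ofReal p) volume
  memLp_deriv : ∀ i, MemLp (v' i) (ENNReal.ofReal p) volume
  eq_zero_fun : ∀ z ∉ symBidisk, v z = 0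
  eq_zero_deriv : ∀ i, ∀ z ∉ symBidisk, v' i z = 0
  integral_eq : ∀ i, ∀ φ : ℂ × ℂ → ℂ, ContDiff ℝ (⊤ : ℕ∞) φ → HasCompactSupport φ →
    tsupport φ ⊆ symBidisk → ∫ z, v z * wder i φ z = -∫ z, v' i z * φ z

lemma integrable_of_eq_zero {p : ℝ} (hp : 1 < p) {v : ℂ × ℂ → ℂ}
    (hv : MemLp v (ENNReal.ofReal p) volume) (h0 : ∀ z ∉ symBidisk, v z = 0) : Integrable v := by
  have hsupp : Function.support v ⊆ symBidisk := by
    intro z hz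
    by_contra h
    exact hz (h0 z h)
  rw [← integrableOn_iff_integrable_of_support_subset hsupp]
  exact (hv.restrict symBidisk).integrable (by simpa using hp.le)

/-- The derivative falls on z ↦ ρ(x - z), which is an admissible test function exactly because x -
supp ρ stays inside the symmetrized bidisk. -/
lemma HasWeakGrad.wder_moll {p : ℝ} (hp : 1 < p) {v : ℂ × ℂ → ℂ} {v' : Fin 4 → ℂ × ℂ → ℂ}
    (h : HasWeakGrad p v v') {ρ : ℂ × ℂ → ℂ} (hc : HasCompactSupport ρ)
    (hρ : ContDiff ℝ (⊤ : ℕ∞) ρ) {x : ℂ × ℂ} (hx : ∀ t ∈ tsupport ρ, x - t ∈ symBidisk) (i : Fin 4) :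
    wder i (moll ρ v) x = moll ρ (v' i) x := by
  have hρ1 : ContDiff ℝ 1 ρ := hρ.of_le (by exact_mod_cast le_top)
  rw [SymBidisk.wder_moll hc hρ1 (integrable_of_eq_zero hp h.memLp_fun h.eq_zero_fun)]
  have hts : tsupport (fun z => ρ (x - z)) = (fun z => x - z) ⁻¹' tsupport ρ :=
    tsupport_comp_eq_preimage ρ (Homeomorph.subLeft x)
  rw [h.integral_eq i (fun z => ρ (x - z)) (hρ.comp (by fun_prop)) ?_ ?_, neg_neg, moll_apply']
  · simp only [mul_comm]
  · exact hc.comp_homeomorph (Homeomorph.subLeft x)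
  · rw [hts]
    intro z hz
    simpa using hx _ hz

/-- Fubini's theorem for a mollification composed with the symmetrization map. -/
lemma integral_mul_integral_translate {ρ u θ : ℂ × ℂ → ℂ} (hρ : Continuous ρ)
    (hc : HasCompactSupport ρ) (hu : Measurable u) (hui : Integrable u) (hθ : Measurable θ) {M : ℝ}
    (hM : ∀ η, ‖θ η‖ ≤ M) :
    ∫ y, ρ y * ∫ η in bidisk, u (symMap η - y) * θ η =
      ∫ η in bidisk, moll ρ u (symMap η) * θ η := by
  obtain ⟨C, hC⟩ := hρ.bounded_above_of_compact_support hc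
  have hC0 : 0 ≤ C := (norm_nonneg _).trans (hC 0)
  have hM0 : 0 ≤ M := (norm_nonneg _).trans (hM 0)
  have hmeas : Measurable fun q : (ℂ × ℂ) × (ℂ × ℂ) => ρ q.1 * (u (symMap q.2 - q.1) * θ q.2) := by
    have := hρ.measurable
    fun_prop
  have hint : Integrable (fun q : (ℂ × ℂ) × (ℂ × ℂ) => ρ q.1 * (u (symMap q.2 - q.1) * θ q.2))
      (volume.prod (volume.restrict bidisk)) := by
    refine ⟨hmeas.aestronglyMeasurable, ?_⟩
    rw [hasFiniteIntegral_iff_enorm, lintegral_prod_symm _ hmeas.enorm.aemeasurable]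
    have hb : ∀ η : ℂ × ℂ, ∫⁻ y, ‖ρ y * (u (symMap η - y) * θ η)‖ₑ ≤
        ENNReal.ofReal C * ENNReal.ofReal M * ∫⁻ y, ‖u y‖ₑ := by
      intro η
      calc ∫⁻ y, ‖ρ y * (u (symMap η - y) * θ η)‖ₑ
          ≤ ∫⁻ y, ENNReal.ofReal C * ENNReal.ofReal M * ‖u (symMap η - y)‖ₑ := by
            refine lintegral_mono fun y => ?_
            simp only
            rw [enorm_mul, enorm_mul, mul_comm ‖u _‖ₑ, ← mul_assoc]
            gcongr
            · rw [← ofReal_norm]; exact ENNReal.ofReal_le_ofReal (hC y)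
            · rw [← ofReal_norm]; exact ENNReal.ofReal_le_ofReal (hM η)
        _ = _ := by
            rw [lintegral_const_mul _ (by fun_prop),
              lintegral_sub_left_eq_self (fun y => ‖u y‖ₑ) (symMap η)]
    refine (lintegral_mono hb).trans_lt ?_
    rw [lintegral_const]
    refine ENNReal.mul_lt_top (ENNReal.mul_lt_top (by finiteness) hui.2) (measure_lt_top _ _)
  simp_rw [← integral_const_mul]
  rw [integral_integral_swap hint]
  refine integral_congr_ae (Filter.Eventually.of_forall fun η => ?_)
  simp only
  rw [moll_apply, ← integral_mul_const]
  simp only [mul_assoc]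

/-! ## The weak chain rule for the symmetrization map -/

/-- The coefficients of the tangential operator applied to a composition with `symMap`. -/
def tangCoef (e : ℂ × ℂ) : Fin 4 → ℂ × ℂ → ℂ :=
  ![fun η => (symMapDeriv η e).1, fun η => -conj (coordAlong e η) ^ 2 * conj (symMapDeriv η e).1,
    fun η => (symMapDeriv η e).2, fun η => -conj (coordAlong e η) ^ 2 * conj (symMapDeriv η e).2]

lemma contDiff_tangCoef (e : ℂ × ℂ) (i : Fin 4) {n : WithTop ℕ∞} : ContDiff ℝ n (tangCoef e i) := by
  have h1 : ContDiff ℝ n fun η => conj (symMapDeriv η e).1 := by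
    simp only [symMapDeriv_apply]
    exact Complex.conjCLE.contDiff.comp (by fun_prop)
  have h2 : ContDiff ℝ n fun η => conj (symMapDeriv η e).2 := by
    simp only [symMapDeriv_apply]
    exact Complex.conjCLE.contDiff.comp
      (by fun_prop : ContDiff ℝ n fun η : ℂ × ℂ => η.1 * e.2 + η.2 * e.1)
  fin_cases i
  · show ContDiff ℝ n fun η => (symMapDeriv η e).1
    simp only [symMapDeriv_apply]; fun_prop
  · show ContDiff ℝ n fun η => -conj (coordAlong e η) ^ 2 * conj (symMapDeriv η e).1
    fun_prop
  · show ContDiff ℝ n fun η => (symMapDeriv η e).2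
    simp only [symMapDeriv_apply]; fun_prop
  · show ContDiff ℝ n fun η => -conj (coordAlong e η) ^ 2 * conj (symMapDeriv η e).2
    fun_prop

lemma tang_comp_symMap {N : ℂ × ℂ → ℂ} {η : ℂ × ℂ} (hN : DifferentiableAt ℝ N (symMap η))
    (e : ℂ × ℂ) : tang e (fun η => N (symMap η)) η =
      ∑ i, tangCoef e i η * wder i N (symMap η) := by
  rw [tang, dHol_comp_symMap hN, dBar_comp_symMap hN, Fin.sum_univ_four]
  simp only [tangCoef, wder, Matrix.cons_val]
  ring

lemma tangAdj_eq_zero_of_notMem_tsupport {ψ : ℂ × ℂ → ℂ} {η : ℂ × ℂ} (hη : η ∉ tsupport ψ)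
    (e : ℂ × ℂ) : tangAdj e ψ η = 0 := by
  rw [tangAdj, dHol_eq_zero_of_notMem_tsupport hη, dBar_eq_zero_of_notMem_tsupport hη,
    image_eq_zero_of_notMem_tsupport hη]
  ring

lemma continuous_tangAdj {ψ : ℂ × ℂ → ℂ} (hψ : ContDiff ℝ 1 ψ) (e : ℂ × ℂ) :
    Continuous (tangAdj e ψ) := by
  have h1 := continuous_dHol hψ e
  have h2 := continuous_dBar hψ e
  have h3 := (contDiff_conj_coordAlong e (n := 1)).continuous
  have h4 := hψ.continuous
  unfold tangAdj; fun_prop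

lemma eq_zero_of_forall_integral_smooth_mul_eq_zero {A : ℂ × ℂ → ℂ} (hA : Continuous A) {ε : ℝ}
    (hε : 0 < ε) (h : ∀ ρ : ℂ × ℂ → ℂ, ContDiff ℝ (⊤ : ℕ∞) ρ → HasCompactSupport ρ →
      tsupport ρ ⊆ Metric.ball 0 ε → ∫ y, ρ y * A y = 0) : A 0 = 0 := by
  have hae := Metric.isOpen_ball.ae_eq_zero_of_integral_contDiff_smul_eq_zero (μ := volume)
    (U := Metric.ball (0 : ℂ × ℂ) ε) (f := A) (hA.locallyIntegrable.locallyIntegrableOn _)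
    (fun g hg hgc hgs => by
      have hsub : tsupport (fun y => (g y : ℂ)) ⊆ tsupport g :=
        tsupport_comp_subset Complex.ofReal_zero g
      have := h (fun y => (g y : ℂ)) (Complex.ofRealCLM.contDiff.comp hg)
        (hgc.comp_left Complex.ofReal_zero) (hsub.trans hgs)
      simpa using this)
  by_contra hne
  have hopen : IsOpen ({y | A y ≠ 0} ∩ Metric.ball 0 ε) :=
    (isOpen_ne_fun hA continuous_const).inter Metric.isOpen_ball
  refine (hopen.measure_pos volume ⟨0, hne, Metric.mem_ball_self hε⟩).ne' ?_
  rw [ae_iff] at hae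
  refine measure_mono_null (fun y hy => ?_) hae
  simp only [mem_ofPred_eq, Classical.not_imp]
  exact ⟨hy.2, hy.1⟩

lemma setIntegral_bidisk_eq {F ψ : ℂ × ℂ → ℂ} (hs : tsupport ψ ⊆ bidisk)
    (h0 : ∀ η ∉ tsupport ψ, F η = 0) : ∫ η in bidisk, F η = ∫ η, F η :=
  setIntegral_eq_integral_of_forall_compl_eq_zero fun η hη => h0 η fun h => hη (hs h)

/-- The weak chain rule, tested against compactly supported functions. -/
lemma HasWeakGrad.integral_comp_symMap_of_compact {p : ℝ} (hp : 1 < p) {A : ℝ≥0}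
    (hA : ∀ u : ℂ × ℂ → ℝ≥0∞, Measurable u → (∫⁻ η in bidisk, u η) ^ p ≤
      A * ∫⁻ w in bidisk, u w ^ p * ‖jac w‖ₑ ^ 2)
    {v : ℂ × ℂ → ℂ} {v' : Fin 4 → ℂ × ℂ → ℂ} (h : HasWeakGrad p v v') {e : ℂ × ℂ}
    (he : IsBasisVec e) {ψ : ℂ × ℂ → ℂ} (hψ : ContDiff ℝ 1 ψ) (hc : HasCompactSupport ψ)
    (hs : tsupport ψ ⊆ bidisk) :
    ∫ η in bidisk, v (symMap η) * tangAdj e ψ η =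
      ∫ η in bidisk, (∑ i, tangCoef e i η * v' i (symMap η)) * ψ η := by
  have hTc : Continuous (tangAdj e ψ) := continuous_tangAdj hψ e
  have hTs : HasCompactSupport (tangAdj e ψ) :=
    HasCompactSupport.intro hc fun η hη => tangAdj_eq_zero_of_notMem_tsupport hη e
  have hTi : ∀ i, Continuous fun η => tangCoef e i η * ψ η := fun i =>
    (contDiff_tangCoef e i (n := 1)).continuous.mul hψ.continuous
  have hTis : ∀ i, HasCompactSupport fun η => tangCoef e i η * ψ η := fun i => hc.mul_left
  obtain ⟨M, hM⟩ := hTc.bounded_above_of_compact_support hTs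
  choose Mi hMi using fun i => (hTi i).bounded_above_of_compact_support (hTis i)
  -- Both sides of the chain rule with the argument `symMap η` translated by y. Integrated against a
  -- smooth ρ supported near 0 they become the chain rule for a mollification, which is classical
  -- even at the branch points; continuity in y then gives y = 0.
  set P : ℂ × ℂ → ℂ := fun y => ∫ η in bidisk, v (symMap η - y) * tangAdj e ψ η
  set Q : Fin 4 → ℂ × ℂ → ℂ := fun i y =>
    ∫ η in bidisk, v' i (symMap η - y) * (tangCoef e i η * ψ η)
  have hPc : Continuous P :=
    continuous_integral_translate hp hA h.measurable_fun h.memLp_fun hTc.measurable hM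
  have hQc : ∀ i, Continuous (Q i) := fun i =>
    continuous_integral_translate hp hA (h.measurable_deriv i) (h.memLp_deriv i)
      (hTi i).measurable (hMi i)
  have hK : IsCompact (symMap '' tsupport ψ) := IsCompact.image hc continuous_symMap
  have hKG : symMap '' tsupport ψ ⊆ symBidisk := by
    rintro _ ⟨η, hη, rfl⟩
    exact symMap_mem (hs hη)
  obtain ⟨ε, hε, hεG⟩ := hK.exists_thickening_subset_open isOpen_symBidisk hKG
  have hAc : Continuous fun y => P y - ∑ i, Q i y :=
    hPc.sub (continuous_finsetSum _ fun i _ => hQc i)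
  have hzero : (fun y => P y - ∑ i, Q i y) 0 = 0 := by
    refine eq_zero_of_forall_integral_smooth_mul_eq_zero hAc hε fun ρ hρ hρc hρs => ?_
    have hρ1 : ContDiff ℝ 1 ρ := hρ.of_le (by exact_mod_cast le_top)
    have hvi := integrable_of_eq_zero hp h.memLp_fun h.eq_zero_fun
    have hρP : Integrable fun y => ρ y * P y :=
      (hρ.continuous.mul hPc).integrable_of_hasCompactSupport hρc.mul_right
    have hρQ : ∀ i ∈ Finset.univ, Integrable fun y => ρ y * Q i y := fun i _ =>
      (hρ.continuous.mul (hQc i)).integrable_of_hasCompactSupport hρc.mul_right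
    simp only [mul_sub, Finset.mul_sum]
    rw [integral_sub hρP (integrable_finsetSum _ hρQ), integral_finsetSum _ hρQ]
    have hNc : ContDiff ℝ 1 (moll ρ v) := contDiff_moll hρc hρ1 hvi
    have hP : ∫ y, ρ y * P y = ∫ η, moll ρ v (symMap η) * tangAdj e ψ η := by
      refine (integral_mul_integral_translate hρ.continuous hρc h.measurable_fun hvi hTc.measurable
        hM).trans (setIntegral_bidisk_eq hs fun η hη => ?_)
      rw [tangAdj_eq_zero_of_notMem_tsupport hη, mul_zero]
    have hwd : ∀ i η, wder i (moll ρ v) (symMap η) * (tangCoef e i η * ψ η) =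
        moll ρ (v' i) (symMap η) * (tangCoef e i η * ψ η) := by
      intro i η
      by_cases hη : η ∈ tsupport ψ
      · rw [h.wder_moll hp hρc hρ fun t ht => ?_]
        refine hεG (Metric.mem_thickening_iff.2 ⟨symMap η, mem_image_of_mem _ hη, ?_⟩)
        have := hρs ht
        rw [mem_ball_zero_iff] at this
        simpa [dist_eq_norm] using this
      · rw [image_eq_zero_of_notMem_tsupport hη]; simp
    have hQ : ∀ i, ∫ y, ρ y * Q i y =
        ∫ η, wder i (moll ρ v) (symMap η) * (tangCoef e i η * ψ η) := by
      intro i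
      simp_rw [hwd]
      refine (integral_mul_integral_translate hρ.continuous hρc (h.measurable_deriv i)
        (integrable_of_eq_zero hp (h.memLp_deriv i) (h.eq_zero_deriv i)) (hTi i).measurable
        (hMi i)).trans (setIntegral_bidisk_eq hs fun η hη => ?_)
      rw [image_eq_zero_of_notMem_tsupport hη, mul_zero, mul_zero]
    have hwc : ∀ i, Continuous (wder i (moll ρ v)) := by
      intro i
      fin_cases i
      · exact continuous_dHol hNc _
      · exact continuous_dBar hNc _
      · exact continuous_dHol hNc _
      · exact continuous_dBar hNc _
    rw [hP, Finset.sum_congr rfl fun i _ => hQ i, ← integral_finsetSum]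
    · have hq : ContDiff ℝ 1 fun η => moll ρ v (symMap η) :=
        hNc.comp (by unfold symMap; fun_prop)
      rw [integral_mul_tangAdj hq hψ hc he, sub_eq_zero]
      refine integral_congr_ae (Filter.Eventually.of_forall fun η => ?_)
      simp only
      rw [tang_comp_symMap (hNc.differentiable (by norm_num) _), Finset.sum_mul]
      refine Finset.sum_congr rfl fun i _ => ?_
      ring
    · intro i _
      exact (((hwc i).comp continuous_symMap).mul (hTi i)).integrable_of_hasCompactSupport
        (hTis i).mul_left
  simp only [P, Q, sub_zero] at hzero
  rw [sub_eq_zero.1 hzero, ← integral_finsetSum]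
  · refine integral_congr_ae (Filter.Eventually.of_forall fun η => ?_)
    simp only
    rw [Finset.sum_mul]
    refine Finset.sum_congr rfl fun i _ => ?_
    ring
  · intro i _
    exact (integrableOn_comp_symMap hp hA (h.measurable_deriv i) (h.memLp_deriv i)).mul_bdd
      (c := Mi i) (hTi i).measurable.aestronglyMeasurable (Filter.Eventually.of_forall (hMi i))

/-! ## Cutoff functions on the bidisk -/

lemma exists_bound_deriv_smoothTransition : ∃ D : ℝ, ∀ s,
    |deriv Real.smoothTransition s| ≤ D ∧ (1 < s → deriv Real.smoothTransition s = 0) := by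
  have hc : Continuous (deriv Real.smoothTransition) :=
    (Real.smoothTransition.contDiff (n := 1)).continuous_deriv (by norm_num)
  have h1 : ∀ s, 1 < s → deriv Real.smoothTransition s = 0 := by
    intro s hs
    have : Real.smoothTransition =ᶠ[nhds s] fun _ => 1 := by
      filter_upwards [Ioi_mem_nhds hs] with t ht
      exact Real.smoothTransition.one_of_one_le (le_of_lt ht)
    rw [this.deriv_eq, deriv_const]
  have h0 : ∀ s, s < 0 → deriv Real.smoothTransition s = 0 := by
    intro s hs
    have : Real.smoothTransition =ᶠ[nhds s] fun _ => 0 := by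
      filter_upwards [Iio_mem_nhds hs] with t ht
      exact Real.smoothTransition.zero_of_nonpos (le_of_lt ht)
    rw [this.deriv_eq, deriv_const]
  obtain ⟨D, hD⟩ := (isCompact_Icc (a := (0 : ℝ)) (b := 1)).exists_bound_of_continuousOn
    hc.continuousOn
  have hD0 : 0 ≤ D := (norm_nonneg _).trans (hD 0 (by simp))
  refine ⟨D, fun s => ⟨?_, h1 s⟩⟩
  rcases lt_or_ge s 0 with hs | hs
  · simpa [h0 s hs] using hD0
  rcases lt_or_ge 1 s with hs' | hs'
  · simpa [h1 s hs'] using hD0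
  · exact hD s ⟨hs, hs'⟩

/-- The argument of the cutoff function. -/
def cutoffArg (n : ℕ) (z : ℂ) : ℝ := (n + 1) * (1 - ‖z‖ ^ 2) - 1

/-- A smooth radial cutoff function on the disk. -/
def diskCutoff (n : ℕ) (z : ℂ) : ℂ := (Real.smoothTransition (cutoffArg n z) : ℂ)

/-- The derivative of the radial cutoff function. -/
def diskCutoffDeriv (n : ℕ) (z v : ℂ) : ℂ :=
  ((deriv Real.smoothTransition (cutoffArg n z) * (-((n + 1) * (2 * (z.re * v.re + z.im * v.im)))) : ℝ) : ℂ)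

/-- A smooth cutoff function on the bidisk. -/
def bidiskCutoff (n : ℕ) (η : ℂ × ℂ) : ℂ := diskCutoff n η.1 * diskCutoff n η.2

lemma contDiff_diskCutoff (n : ℕ) : ContDiff ℝ 1 (diskCutoff n) := by
  have h : ContDiff ℝ 1 (cutoffArg n) := by
    unfold cutoffArg
    have : ContDiff ℝ 1 fun z : ℂ => ‖z‖ ^ 2 := contDiff_norm_sq ℝ
    fun_prop
  exact Complex.ofRealCLM.contDiff.comp ((Real.smoothTransition.contDiff (n := 1)).comp h)

lemma contDiff_bidiskCutoff (n : ℕ) : ContDiff ℝ 1 (bidiskCutoff n) :=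
  ((contDiff_diskCutoff n).comp contDiff_fst).mul ((contDiff_diskCutoff n).comp contDiff_snd)

lemma fderiv_diskCutoff (n : ℕ) (z v : ℂ) : fderiv ℝ (diskCutoff n) z v = diskCutoffDeriv n z v := by
  have h1 : HasFDerivAt (fun z : ℂ => ‖z‖ ^ 2) (2 • innerSL ℝ z) z :=
    (hasStrictFDerivAt_norm_sq z).hasFDerivAt
  have h2 : HasFDerivAt (cutoffArg n) (((n : ℝ) + 1) •
      (-(2 • innerSL ℝ z) : ℂ →L[ℝ] ℝ)) z :=
    ((h1.const_sub 1).const_mul ((n : ℝ) + 1)).sub_const 1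
  have h3 := (((Real.smoothTransition.contDiff (n := 1)).differentiable
    (by norm_num)) (cutoffArg n z)).hasDerivAt.comp_hasFDerivAt z h2
  have h4 := Complex.ofRealCLM.hasFDerivAt.comp z h3
  rw [show diskCutoff n = Complex.ofRealCLM ∘ (Real.smoothTransition ∘ cutoffArg n) from rfl, h4.fderiv]
  have h5 : inner ℝ z v = z.re * v.re + z.im * v.im := by
    rw [Complex.inner]; simp; ring
  simp [diskCutoffDeriv, h5]
  ring

lemma fderiv_bidiskCutoff (n : ℕ) (η v : ℂ × ℂ) : fderiv ℝ (bidiskCutoff n) η v =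
    diskCutoff n η.1 * diskCutoffDeriv n η.2 v.2 + diskCutoff n η.2 * diskCutoffDeriv n η.1 v.1 := by
  have hd := fun z => ((contDiff_diskCutoff n).differentiable (by norm_num) z).hasFDerivAt
  have h1 := (hd η.1).comp η hasFDerivAt_fst
  have h2 := (hd η.2).comp η hasFDerivAt_snd
  have h3 := h1.mul h2
  rw [show bidiskCutoff n = (diskCutoff n ∘ Prod.fst) * (diskCutoff n ∘ Prod.snd) from rfl, h3.fderiv]
  simp [fderiv_diskCutoff]

/-- The operator ∂ - z̄² ∂̄ sends |z|² to z̄ - z̄² z = z̄ (1 - |z|²). The factor 1 - |z|² is the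
gain from tangency, and it compensates the growth n + 1 of the cutoff derivative. -/
lemma tang_bidiskCutoff (n : ℕ) {e : ℂ × ℂ} (he : IsBasisVec e) (η : ℂ × ℂ) :
    ∃ z₁ z₂ : ℂ, (z₁ = η.1 ∧ z₂ = η.2 ∨ z₁ = η.2 ∧ z₂ = η.1) ∧
    tang e (bidiskCutoff n) η = -(diskCutoff n z₂ * conj z₁ *
      ((deriv Real.smoothTransition (cutoffArg n z₁) * ((n + 1) * (1 - ‖z₁‖ ^ 2)) : ℝ) : ℂ)) := by
  have hz : ∀ z : ℂ, ((‖z‖ ^ 2 : ℝ) : ℂ) = (z.re : ℂ) ^ 2 + (z.im : ℂ) ^ 2 := by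
    intro z
    rw [← Complex.normSq_eq_norm_sq, Complex.normSq_apply]; push_cast; ring
  have hcj : ∀ z : ℂ, conj z = z.re - z.im * Complex.I := by
    intro z; apply Complex.ext <;> simp
  rcases he with rfl | rfl
  · refine ⟨η.1, η.2, Or.inl ⟨rfl, rfl⟩, ?_⟩
    simp only [tang, dHol, dBar, fderiv_bidiskCutoff, diskCutoffDeriv, coordAlong, Prod.smul_mk,
      smul_eq_mul, mul_one, mul_zero, Complex.I_re, Complex.I_im, Complex.one_re, Complex.one_im,
      Complex.zero_re, Complex.zero_im, add_zero, zero_add, neg_zero, one_mul, zero_mul]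
    rw [hcj]
    push_cast [hz]
    linear_combination (-(n + 1) * diskCutoff n η.2 *
      deriv Real.smoothTransition (cutoffArg n η.1) *
      (η.1.re - η.1.im * Complex.I) * η.1.im ^ 2 : ℂ) * Complex.I_sq
  · refine ⟨η.2, η.1, Or.inr ⟨rfl, rfl⟩, ?_⟩
    simp only [tang, dHol, dBar, fderiv_bidiskCutoff, diskCutoffDeriv, coordAlong, Prod.smul_mk,
      smul_eq_mul, mul_one, mul_zero, Complex.I_re, Complex.I_im, Complex.one_re, Complex.one_im,
      Complex.zero_re, Complex.zero_im, add_zero, zero_add, neg_zero, one_mul, zero_mul]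
    rw [hcj]
    push_cast [hz]
    linear_combination (-(n + 1) * diskCutoff n η.1 *
      deriv Real.smoothTransition (cutoffArg n η.2) *
      (η.2.re - η.2.im * Complex.I) * η.2.im ^ 2 : ℂ) * Complex.I_sq

lemma diskCutoff_norm_le (n : ℕ) (z : ℂ) : ‖diskCutoff n z‖ ≤ 1 := by
  rw [diskCutoff, Complex.norm_real, Real.norm_of_nonneg (Real.smoothTransition.nonneg _)]
  exact Real.smoothTransition.le_one _

/-- The derivative of the transition function vanishes once (n + 1)(1 - |z|²) > 2, so the product in
`tang_bidiskCutoff` is bounded independently of n. -/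
lemma exists_bound_tang_bidiskCutoff : ∃ B : ℝ, ∀ n : ℕ, ∀ e, IsBasisVec e → ∀ η ∈ bidisk,
    ‖tang e (bidiskCutoff n) η‖ ≤ B := by
  obtain ⟨D, hD⟩ := exists_bound_deriv_smoothTransition
  have hD0 : 0 ≤ D := (abs_nonneg _).trans (hD 0).1
  refine ⟨D * 2, fun n e he η hη => ?_⟩
  obtain ⟨z₁, z₂, hz, h⟩ := tang_bidiskCutoff n he η
  have hz1 : ‖z₁‖ < 1 := by
    have := mem_bidisk.1 hη
    rcases hz with ⟨rfl, -⟩ | ⟨rfl, -⟩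
    exacts [this.1, this.2]
  rw [h, norm_neg, norm_mul, norm_mul, Complex.norm_conj, Complex.norm_real, Real.norm_eq_abs, abs_mul]
  have h1 : ‖diskCutoff n z₂‖ * ‖z₁‖ ≤ 1 := by
    nlinarith [diskCutoff_norm_le n z₂, norm_nonneg z₁, norm_nonneg (diskCutoff n z₂)]
  have h2 : |deriv Real.smoothTransition (cutoffArg n z₁)| * |((n : ℝ) + 1) * (1 - ‖z₁‖ ^ 2)| ≤
      D * 2 := by
    have hpos : 0 ≤ ((n : ℝ) + 1) * (1 - ‖z₁‖ ^ 2) := by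
      have : ‖z₁‖ ^ 2 ≤ 1 := pow_le_one₀ (norm_nonneg _) hz1.le
      exact mul_nonneg (by positivity) (by linarith)
    rcases lt_or_ge 1 (cutoffArg n z₁) with hs | hs
    · rw [(hD _).2 hs]; simpa using hD0
    · refine mul_le_mul (hD _).1 ?_ (abs_nonneg _) hD0
      rw [abs_of_nonneg hpos]
      unfold cutoffArg at hs
      linarith
  calc _ ≤ 1 * (D * 2) := by gcongr
    _ = _ := one_mul _

lemma eventually_one_lt_cutoffArg {z : ℂ} (hz : ‖z‖ < 1) :
    ∀ᶠ n : ℕ in Filter.atTop, 1 < cutoffArg n z := by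
  have hpos : 0 < 1 - ‖z‖ ^ 2 := by nlinarith [norm_nonneg z]
  obtain ⟨N, hN⟩ := exists_nat_gt (2 / (1 - ‖z‖ ^ 2))
  filter_upwards [Filter.eventually_ge_atTop N] with n hn
  rw [div_lt_iff₀ hpos] at hN
  have : (N : ℝ) ≤ n := by exact_mod_cast hn
  unfold cutoffArg
  nlinarith

lemma eventually_bidiskCutoff_eq {η : ℂ × ℂ} (hη : η ∈ bidisk) :
    ∀ᶠ n : ℕ in Filter.atTop, bidiskCutoff n η = 1 ∧
      ∀ e, IsBasisVec e → tang e (bidiskCutoff n) η = 0 := by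
  obtain ⟨D, hD⟩ := exists_bound_deriv_smoothTransition
  have h := mem_bidisk.1 hη
  filter_upwards [eventually_one_lt_cutoffArg h.1, eventually_one_lt_cutoffArg h.2] with n h1 h2
  refine ⟨?_, fun e he => ?_⟩
  · rw [bidiskCutoff, diskCutoff, diskCutoff, Real.smoothTransition.one_of_one_le h1.le,
      Real.smoothTransition.one_of_one_le h2.le]
    simp
  · obtain ⟨z₁, z₂, hz, h⟩ := tang_bidiskCutoff n he η
    have : 1 < cutoffArg n z₁ := by
      rcases hz with ⟨rfl, -⟩ | ⟨rfl, -⟩ <;> assumption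
    rw [h, (hD _).2 this]
    simp

lemma bidiskCutoff_eq_zero {n : ℕ} {η : ℂ × ℂ} (h : cutoffArg n η.1 ≤ 0 ∨ cutoffArg n η.2 ≤ 0) :
    bidiskCutoff n η = 0 := by
  rw [bidiskCutoff, diskCutoff, diskCutoff]
  rcases h with h | h <;> simp [Real.smoothTransition.zero_of_nonpos h]

lemma cutoffArg_nonpos_of_one_le {n : ℕ} {z : ℂ} (hz : 1 ≤ ‖z‖) : cutoffArg n z ≤ 0 := by
  have : 1 ≤ ‖z‖ ^ 2 := one_le_pow₀ hz
  have h0 : (0 : ℝ) ≤ n := Nat.cast_nonneg n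
  unfold cutoffArg
  nlinarith

lemma tsupport_bidiskCutoff_mul_subset (n : ℕ) (ψ : ℂ × ℂ → ℂ) :
    tsupport (fun η => bidiskCutoff n η * ψ η) ⊆ bidisk := by
  have hc : Continuous (cutoffArg n) := by unfold cutoffArg; fun_prop
  have hcl : IsClosed {η : ℂ × ℂ | 0 ≤ cutoffArg n η.1 ∧ 0 ≤ cutoffArg n η.2} :=
    (isClosed_le continuous_const (hc.comp continuous_fst)).inter
      (isClosed_le continuous_const (hc.comp continuous_snd))
  have hsub : tsupport (fun η => bidiskCutoff n η * ψ η) ⊆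
      {η : ℂ × ℂ | 0 ≤ cutoffArg n η.1 ∧ 0 ≤ cutoffArg n η.2} := by
    refine closure_minimal (fun η hη => ?_) hcl
    by_contra h
    simp only [mem_ofPred_eq, not_and_or, not_le] at h
    exact hη (by simp [bidiskCutoff_eq_zero (h.imp le_of_lt le_of_lt)])
  refine hsub.trans fun η hη => ?_
  have key : ∀ z : ℂ, 0 ≤ cutoffArg n z → ‖z‖ < 1 := by
    intro z hz
    by_contra! h
    have : 1 ≤ ‖z‖ ^ 2 := one_le_pow₀ h
    have h0 : (0 : ℝ) ≤ n := Nat.cast_nonneg n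
    unfold cutoffArg at hz
    nlinarith
  exact mem_bidisk.2 ⟨key _ hη.1, key _ hη.2⟩

lemma contDiff_bidiskCutoff_mul (n : ℕ) {ψ : ℂ × ℂ → ℂ}
    (hψ : ∀ η ∈ Metric.closedBall (0 : ℂ × ℂ) 1, ContDiffAt ℝ 1 ψ η) :
    ContDiff ℝ 1 fun η => bidiskCutoff n η * ψ η := by
  rw [contDiff_iff_contDiffAt]
  intro η
  by_cases hη : η ∈ Metric.closedBall (0 : ℂ × ℂ) 1
  · exact (contDiff_bidiskCutoff n).contDiffAt.mul (hψ η hη)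
  · have : (fun η => bidiskCutoff n η * ψ η) =ᶠ[nhds η] fun _ => 0 := by
      filter_upwards [Metric.isClosed_closedBall.isOpen_compl.mem_nhds hη] with ζ hζ
      simp only [mem_compl_iff, mem_closedBall_zero_iff, Prod.norm_def, max_le_iff, not_and_or,
        not_le] at hζ
      rw [bidiskCutoff_eq_zero (hζ.imp (fun h => cutoffArg_nonpos_of_one_le h.le)
        fun h => cutoffArg_nonpos_of_one_le h.le), zero_mul]
    exact contDiffAt_const.congr_of_eventuallyEq this

/-! ### Tangential derivatives tested up to the boundary -/

/-- `u'` is the derivative of `u` along the tangential field of direction `e`, in the weak sense,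
tested against functions that are regular up to the boundary. -/
structure HasTangDeriv (e : ℂ × ℂ) (u u' : ℂ × ℂ → ℂ) : Prop where
  integrableOn_fun : IntegrableOn u bidisk
  integrableOn_deriv : IntegrableOn u' bidisk
  integral_eq : ∀ ψ : ℂ × ℂ → ℂ, (∀ η ∈ Metric.closedBall (0 : ℂ × ℂ) 1, ContDiffAt ℝ 1 ψ η) →
    ∫ η in bidisk, u η * tangAdj e ψ η = ∫ η in bidisk, u' η * ψ η

lemma continuousOn_tangAdj (e : ℂ × ℂ) {ψ : ℂ × ℂ → ℂ} {S : Set (ℂ × ℂ)}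
    (hψ : ∀ η ∈ S, ContDiffAt ℝ 1 ψ η) : ContinuousOn (tangAdj e ψ) S := by
  have h1 : ContinuousOn (fderiv ℝ ψ) S := fun η hη =>
    ((hψ η hη).fderiv_right (m := 0) (by norm_num)).continuousAt.continuousWithinAt
  have h2 : ContinuousOn ψ S := fun η hη => (hψ η hη).continuousAt.continuousWithinAt
  have h3 : ContinuousOn (fun η => conj (coordAlong e η)) S :=
    (contDiff_conj_coordAlong e (n := 1)).continuous.continuousOn
  have h4 : ∀ v, ContinuousOn (fun η => fderiv ℝ ψ η v) S := fun v =>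
    h1.clm_apply continuousOn_const
  have h5 : ContinuousOn (fun η => dHol e ψ η) S := by
    unfold dHol
    exact ((h4 _).sub (continuousOn_const.mul (h4 _))).div_const 2
  have h6 : ContinuousOn (fun η => dBar e ψ η) S := by
    unfold dBar
    exact ((h4 _).add (continuousOn_const.mul (h4 _))).div_const 2
  exact (h5.neg.add ((continuousOn_const.mul h3).mul h2)).add ((h3.pow 2).mul h6)

/-- To verify a tangential derivative it suffices to test against compactly supported functions. -/
theorem HasTangDeriv.of_compact {e : ℂ × ℂ} (he : IsBasisVec e) {u u' : ℂ × ℂ → ℂ}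
    (hu : IntegrableOn u bidisk) (hu' : IntegrableOn u' bidisk)
    (h : ∀ ψ : ℂ × ℂ → ℂ, ContDiff ℝ 1 ψ → HasCompactSupport ψ → tsupport ψ ⊆ bidisk →
      ∫ η in bidisk, u η * tangAdj e ψ η = ∫ η in bidisk, u' η * ψ η) : HasTangDeriv e u u' := by
  refine ⟨hu, hu', fun ψ hψ => ?_⟩
  have hsub : bidisk ⊆ Metric.closedBall (0 : ℂ × ℂ) 1 := Metric.ball_subset_closedBall
  have hψc : ContinuousOn ψ (Metric.closedBall (0 : ℂ × ℂ) 1) := fun η hη =>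
    (hψ η hη).continuousAt.continuousWithinAt
  have hTc := continuousOn_tangAdj e hψ
  obtain ⟨M, hM⟩ := (isCompact_closedBall (0 : ℂ × ℂ) 1).exists_bound_of_continuousOn hψc
  obtain ⟨N, hN⟩ := (isCompact_closedBall (0 : ℂ × ℂ) 1).exists_bound_of_continuousOn hTc
  obtain ⟨B, hB⟩ := exists_bound_tang_bidiskCutoff
  have hcut : ∀ n η, ‖bidiskCutoff n η‖ ≤ 1 := by
    intro n η
    rw [bidiskCutoff, norm_mul]
    exact mul_le_one₀ (diskCutoff_norm_le _ _) (norm_nonneg _) (diskCutoff_norm_le _ _)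
  -- The commutator term is uniformly bounded and vanishes at each point for large n, so dominated
  -- convergence removes the cutoff with no boundary contribution.
  have hprod : ∀ n, ∀ η ∈ bidisk, tangAdj e (fun η => bidiskCutoff n η * ψ η) η =
      bidiskCutoff n η * tangAdj e ψ η - tang e (bidiskCutoff n) η * ψ η := fun n η hη =>
    tangAdj_mul ((contDiff_bidiskCutoff n).differentiable (by norm_num) η)
      ((hψ η (hsub hη)).differentiableAt (by norm_num))
  have hev : ∀ᵐ η ∂(volume.restrict bidisk), η ∈ bidisk := ae_restrict_mem measurableSet_bidisk
  have hL : Filter.Tendsto (fun n => ∫ η in bidisk,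
      u η * tangAdj e (fun η => bidiskCutoff n η * ψ η) η) Filter.atTop
      (nhds (∫ η in bidisk, u η * tangAdj e ψ η)) := by
    refine tendsto_integral_of_dominated_convergence (fun η => ‖u η‖ * (N + B * M)) ?_
      (hu.norm.mul_const _) ?_ ?_
    · intro n
      exact hu.1.mul (continuous_tangAdj (contDiff_bidiskCutoff_mul n hψ) e).aestronglyMeasurable
    · intro n
      filter_upwards [hev] with η hη
      rw [norm_mul, hprod n η hη]
      gcongr
      refine (norm_sub_le _ _).trans (add_le_add ?_ ?_)
      · rw [norm_mul]
        calc _ ≤ 1 * N := mul_le_mul (hcut n η) (hN η (hsub hη)) (norm_nonneg _) zero_le_one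
          _ = N := one_mul N
      · rw [norm_mul]
        exact mul_le_mul (hB n e he η hη) (hM η (hsub hη)) (norm_nonneg _)
          ((norm_nonneg _).trans (hB n e he η hη))
    · filter_upwards [hev] with η hη
      refine tendsto_const_nhds.congr' ?_
      filter_upwards [eventually_bidiskCutoff_eq hη] with n hn
      rw [hprod n η hη, hn.1, hn.2 e he]
      ring
  have hR : Filter.Tendsto (fun n => ∫ η in bidisk, u' η * (bidiskCutoff n η * ψ η)) Filter.atTop
      (nhds (∫ η in bidisk, u' η * ψ η)) := by
    refine tendsto_integral_of_dominated_convergence (fun η => ‖u' η‖ * M) ?_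
      (hu'.norm.mul_const _) ?_ ?_
    · intro n
      exact hu'.1.mul (contDiff_bidiskCutoff_mul n hψ).continuous.aestronglyMeasurable
    · intro n
      filter_upwards [hev] with η hη
      rw [norm_mul, norm_mul]
      gcongr
      calc _ ≤ 1 * M := mul_le_mul (hcut n η) (hM η (hsub hη)) (norm_nonneg _) zero_le_one
        _ = M := one_mul M
    · filter_upwards [hev] with η hη
      refine tendsto_const_nhds.congr' ?_
      filter_upwards [eventually_bidiskCutoff_eq hη] with n hn
      rw [hn.1]
      ring
  refine tendsto_nhds_unique hL (hR.congr fun n => ?_)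
  have hs := tsupport_bidiskCutoff_mul_subset n ψ
  exact (h _ (contDiff_bidiskCutoff_mul n hψ)
    ((isCompact_closedBall (0 : ℂ × ℂ) 1).of_isClosed_subset (isClosed_tsupport _)
      (hs.trans hsub)) hs).symm

/-- The weak chain rule for the symmetrization map. -/
theorem HasWeakGrad.hasTangDeriv {p : ℝ} (hp : 1 < p) {A : ℝ≥0}
    (hA : ∀ u : ℂ × ℂ → ℝ≥0∞, Measurable u → (∫⁻ η in bidisk, u η) ^ p ≤
      A * ∫⁻ w in bidisk, u w ^ p * ‖jac w‖ₑ ^ 2)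
    {v : ℂ × ℂ → ℂ} {v' : Fin 4 → ℂ × ℂ → ℂ} (h : HasWeakGrad p v v') {e : ℂ × ℂ}
    (he : IsBasisVec e) :
    HasTangDeriv e (fun η => v (symMap η)) fun η => ∑ i, tangCoef e i η * v' i (symMap η) := by
  refine HasTangDeriv.of_compact he (integrableOn_comp_symMap hp hA h.measurable_fun h.memLp_fun) ?_
    fun ψ hψ hc hs => h.integral_comp_symMap_of_compact hp hA he hψ hc hs
  refine integrable_finsetSum _ fun i _ => ?_
  obtain ⟨M, hM⟩ := (isCompact_closedBall (0 : ℂ × ℂ) 1).exists_bound_of_continuousOn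
    (contDiff_tangCoef e i (n := 1)).continuous.continuousOn
  refine (integrableOn_comp_symMap hp hA (h.measurable_deriv i) (h.memLp_deriv i)).bdd_mul (c := M)
    (contDiff_tangCoef e i (n := 1)).continuous.aestronglyMeasurable ?_
  filter_upwards [ae_restrict_mem measurableSet_bidisk] with η hη
  exact hM η (Metric.ball_subset_closedBall hη)

lemma HasTangDeriv.mul {e : ℂ × ℂ} {u u' c : ℂ × ℂ → ℂ} (h : HasTangDeriv e u u')
    (hc : ContDiff ℝ (⊤ : ℕ∞) c) :
    HasTangDeriv e (fun η => c η * u η) fun η => c η * u' η + tang e c η * u η := by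
  have hc1 : ContDiff ℝ 1 c := hc.of_le (by exact_mod_cast le_top)
  have htc : Continuous (tang e c) := by
    have h1 := continuous_dHol hc1 e
    have h2 := continuous_dBar hc1 e
    have h3 := (contDiff_conj_coordAlong e (n := 1)).continuous
    unfold tang; fun_prop
  have hbd : ∀ (a f : ℂ × ℂ → ℂ), Continuous a → IntegrableOn f bidisk →
      IntegrableOn (fun η => a η * f η) bidisk := by
    intro a f ha hf
    obtain ⟨M, hM⟩ := (isCompact_closedBall (0 : ℂ × ℂ) 1).exists_bound_of_continuousOn
      ha.continuousOn
    refine hf.bdd_mul (c := M) ha.aestronglyMeasurable ?_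
    filter_upwards [ae_restrict_mem measurableSet_bidisk] with η hη
    exact hM η (Metric.ball_subset_closedBall hη)
  refine ⟨hbd _ _ hc1.continuous h.integrableOn_fun,
    (hbd _ _ hc1.continuous h.integrableOn_deriv).add (hbd _ _ htc h.integrableOn_fun),
    fun ψ hψ => ?_⟩
  have hcψ : ∀ η ∈ Metric.closedBall (0 : ℂ × ℂ) 1, ContDiffAt ℝ 1 (fun η => c η * ψ η) η :=
    fun η hη => hc1.contDiffAt.mul (hψ η hη)
  have h1 := h.integral_eq _ hcψ
  have hψbd : ∀ f : ℂ × ℂ → ℂ, ∀ b : ℂ × ℂ → ℂ, ContinuousOn b (Metric.closedBall 0 1) →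
      IntegrableOn f bidisk → IntegrableOn (fun η => f η * b η) bidisk := by
    intro f b hb hf
    obtain ⟨M, hM⟩ := (isCompact_closedBall (0 : ℂ × ℂ) 1).exists_bound_of_continuousOn hb
    refine hf.mul_bdd (c := M)
      ((hb.mono Metric.ball_subset_closedBall).aestronglyMeasurable measurableSet_bidisk) ?_
    filter_upwards [ae_restrict_mem measurableSet_bidisk] with η hη
    exact hM η (Metric.ball_subset_closedBall hη)
  have hψc : ContinuousOn ψ (Metric.closedBall (0 : ℂ × ℂ) 1) := fun η hη =>
    (hψ η hη).continuousAt.continuousWithinAt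
  have i1 := hψbd u (fun η => tangAdj e (fun η => c η * ψ η) η) (continuousOn_tangAdj e hcψ)
    h.integrableOn_fun
  have i2 := hψbd (fun η => tang e c η * u η) ψ hψc (hbd _ _ htc h.integrableOn_fun)
  have i3 := hψbd (fun η => c η * u' η) ψ hψc (hbd _ _ hc1.continuous h.integrableOn_deriv)
  calc ∫ η in bidisk, c η * u η * tangAdj e ψ η
      = ∫ η in bidisk, u η * tangAdj e (fun η => c η * ψ η) η + tang e c η * u η * ψ η := by
        refine setIntegral_congr_fun measurableSet_bidisk fun η hη => ?_
        rw [tangAdj_mul (hc1.differentiable (by norm_num) η)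
          ((hψ η (Metric.ball_subset_closedBall hη)).differentiableAt (by norm_num))]
        ring
    _ = ∫ η in bidisk, c η * u' η * ψ η + tang e c η * u η * ψ η := by
        rw [integral_add i1 i2, integral_add i3 i2, h1]
        congr 1
        refine integral_congr_ae (Filter.Eventually.of_forall fun η => ?_)
        simp only; ring
    _ = _ := by
        refine integral_congr_ae (Filter.Eventually.of_forall fun η => ?_)
        simp only; ring

lemma HasTangDeriv.add {e : ℂ × ℂ} {u u' v v' : ℂ × ℂ → ℂ} (hu : HasTangDeriv e u u')
    (hv : HasTangDeriv e v v') :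
    HasTangDeriv e (fun η => u η + v η) fun η => u' η + v' η := by
  have hψbd : ∀ f : ℂ × ℂ → ℂ, ∀ b : ℂ × ℂ → ℂ, ContinuousOn b (Metric.closedBall 0 1) →
      IntegrableOn f bidisk → IntegrableOn (fun η => f η * b η) bidisk := by
    intro f b hb hf
    obtain ⟨M, hM⟩ := (isCompact_closedBall (0 : ℂ × ℂ) 1).exists_bound_of_continuousOn hb
    refine hf.mul_bdd (c := M)
      ((hb.mono Metric.ball_subset_closedBall).aestronglyMeasurable measurableSet_bidisk) ?_
    filter_upwards [ae_restrict_mem measurableSet_bidisk] with η hη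
    exact hM η (Metric.ball_subset_closedBall hη)
  refine ⟨hu.integrableOn_fun.add hv.integrableOn_fun,
    hu.integrableOn_deriv.add hv.integrableOn_deriv, fun ψ hψ => ?_⟩
  have hψc : ContinuousOn ψ (Metric.closedBall (0 : ℂ × ℂ) 1) := fun η hη =>
    (hψ η hη).continuousAt.continuousWithinAt
  have hTc := continuousOn_tangAdj e hψ
  simp only [add_mul]
  rw [integral_add (hψbd _ _ hTc hu.integrableOn_fun) (hψbd _ _ hTc hv.integrableOn_fun),
    integral_add (hψbd _ _ hψc hu.integrableOn_deriv) (hψbd _ _ hψc hv.integrableOn_deriv),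
    hu.integral_eq ψ hψ, hv.integral_eq ψ hψ]

/-! ### The Bergman integral operator of the bidisk -/

/-- The integral operator on the bidisk whose kernel is the Bergman kernel. -/
def bidiskOp (G : ℂ × ℂ → ℂ) (w : ℂ × ℂ) : ℂ := ∫ η in bidisk, bidiskKernel w η * G η

/-- The Bergman kernel of the bidisk as a holomorphic function of `w` and `conj η`. -/
def bidiskKernelAux (q : (ℂ × ℂ) × (ℂ × ℂ)) : ℂ :=
  ((Real.pi : ℂ)⁻¹ * ((1 - q.1.1 * q.2.1) ^ 2)⁻¹) * ((Real.pi : ℂ)⁻¹ * ((1 - q.1.2 * q.2.2) ^ 2)⁻¹)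

lemma contDiffAt_bidiskKernelAux {q : (ℂ × ℂ) × (ℂ × ℂ)} (h1 : 1 - q.1.1 * q.2.1 ≠ 0)
    (h2 : 1 - q.1.2 * q.2.2 ≠ 0) : ContDiffAt ℂ 1 bidiskKernelAux q := by
  unfold bidiskKernelAux
  refine ContDiffAt.mul (contDiffAt_const.mul (ContDiffAt.inv ?_ (pow_ne_zero 2 h1)))
    (contDiffAt_const.mul (ContDiffAt.inv ?_ (pow_ne_zero 2 h2)))
  all_goals fun_prop

lemma one_sub_mul_conjProd_ne_zero {w η : ℂ × ℂ} (hw : w ∈ bidisk)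
    (hη : η ∈ Metric.closedBall (0 : ℂ × ℂ) 1) :
    1 - w.1 * (conjProd η).1 ≠ 0 ∧ 1 - w.2 * (conjProd η).2 ≠ 0 := by
  rw [mem_bidisk] at hw
  rw [mem_closedBall_zero_iff, Prod.norm_def, max_le_iff] at hη
  exact ⟨one_sub_mul_conj_ne_zero hw.1 hη.1, one_sub_mul_conj_ne_zero hw.2 hη.2⟩

lemma fderiv_bidiskKernelAux {q : (ℂ × ℂ) × (ℂ × ℂ)} (h1 : 1 - q.1.1 * q.2.1 ≠ 0)
    (h2 : 1 - q.1.2 * q.2.2 ≠ 0) (v : (ℂ × ℂ) × (ℂ × ℂ)) :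
    fderiv ℂ bidiskKernelAux q v = bidiskKernelAux q *
      (2 * (v.1.1 * q.2.1 + q.1.1 * v.2.1) * (1 - q.1.1 * q.2.1)⁻¹ +
        2 * (v.1.2 * q.2.2 + q.1.2 * v.2.2) * (1 - q.1.2 * q.2.2)⁻¹) := by
  have hg : ∀ x : ℂ, 1 - x ≠ 0 → HasDerivAt (fun x : ℂ => (Real.pi : ℂ)⁻¹ * ((1 - x) ^ 2)⁻¹)
      ((Real.pi : ℂ)⁻¹ * ((1 - x) ^ 2)⁻¹ * (2 * (1 - x)⁻¹)) x := by
    intro x hx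
    have h := ((((hasDerivAt_id x).const_sub 1).pow 2).inv (pow_ne_zero 2 hx)).const_mul (Real.pi : ℂ)⁻¹
    refine h.congr_deriv ?_
    simp only [Pi.pow_apply, id]
    field_simp
    simp
    ring
  have d1 := (hasFDerivAt_id (𝕜 := ℂ) q).fst
  have d2 := (hasFDerivAt_id (𝕜 := ℂ) q).snd
  have e1 := d1.fst.mul d2.fst
  have e2 := d1.snd.mul d2.snd
  have h := ((hg _ h1).comp_hasFDerivAt q e1).mul ((hg _ h2).comp_hasFDerivAt q e2)
  have h' : HasFDerivAt bidiskKernelAux _ q := h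
  rw [h'.fderiv]
  simp [bidiskKernelAux]
  ring

lemma fderiv_conjProd_comp {κ : (ℂ × ℂ) × (ℂ × ℂ) → ℂ} {w η : ℂ × ℂ}
    (h : DifferentiableAt ℂ κ (w, conjProd η)) (v : ℂ × ℂ) :
    fderiv ℝ (fun η => κ (w, conjProd η)) η v = fderiv ℂ κ (w, conjProd η) (0, conjProd v) := by
  have hc : HasFDerivAt conjProd
      (((Complex.conjCLE : ℂ →L[ℝ] ℂ).comp (ContinuousLinearMap.fst ℝ ℂ ℂ)).prod
        ((Complex.conjCLE : ℂ →L[ℝ] ℂ).comp (ContinuousLinearMap.snd ℝ ℂ ℂ))) η :=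
    ContinuousLinearMap.hasFDerivAt (((Complex.conjCLE : ℂ →L[ℝ] ℂ).comp
      (ContinuousLinearMap.fst ℝ ℂ ℂ)).prod
        ((Complex.conjCLE : ℂ →L[ℝ] ℂ).comp (ContinuousLinearMap.snd ℝ ℂ ℂ)))
  have h1 := (h.hasFDerivAt.restrictScalars ℝ).comp (f := fun η => (w, conjProd η)) η
    ((hasFDerivAt_const w η).prodMk hc)
  have h2 : HasFDerivAt (fun η => κ (w, conjProd η)) _ η := h1
  rw [h2.fderiv]
  rfl

/-- In one variable, with K the disk kernel, ∂_w K = 2η̄ K / (1 - wη̄). As K is antiholomorphic in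
η, the transposed operator gives 2η̄ K + η̄² · 2w K / (1 - wη̄), which is the same. This identity
dictates the choice of `tangAdj`. -/
lemma fderiv_bidiskKernelAux_eq_tangAdj {w η : ℂ × ℂ} (hw : w ∈ bidisk)
    (hη : η ∈ Metric.closedBall (0 : ℂ × ℂ) 1) {e : ℂ × ℂ} (he : IsBasisVec e) :
    fderiv ℂ bidiskKernelAux (w, conjProd η) (e, 0) = tangAdj e (bidiskKernel w) η := by
  obtain ⟨h1, h2⟩ := one_sub_mul_conjProd_ne_zero hw hη
  have hd := (contDiffAt_bidiskKernelAux (q := (w, conjProd η)) h1 h2).differentiableAt (by norm_num)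
  have hK : bidiskKernel w = fun η => bidiskKernelAux (w, conjProd η) := rfl
  have hI : Complex.I * Complex.I = -1 := Complex.I_mul_I
  rw [tangAdj, dHol, dBar, hK, fderiv_conjProd_comp hd, fderiv_conjProd_comp hd]
  rw [fderiv_bidiskKernelAux (q := (w, conjProd η)) h1 h2,
    fderiv_bidiskKernelAux (q := (w, conjProd η)) h1 h2,
    fderiv_bidiskKernelAux (q := (w, conjProd η)) h1 h2]
  rcases he with rfl | rfl
  · simp [conjProd, coordAlong] at h1 ⊢
    field_simp
    ring_nf
    simp only [Complex.I_sq]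
    have hx := mul_inv_cancel₀ (a := 1 - conj η.1 * w.1) (by rwa [mul_comm])
    linear_combination 2 * conj η.1 * bidiskKernelAux (w, conj η.1, conj η.2) * hx
  · simp [conjProd, coordAlong] at h2 ⊢
    field_simp
    ring_nf
    simp only [Complex.I_sq]
    have hx := mul_inv_cancel₀ (a := 1 - conj η.2 * w.2) (by rwa [mul_comm])
    linear_combination 2 * conj η.2 * bidiskKernelAux (w, conj η.1, conj η.2) * hx

lemma contDiffAt_bidiskKernel {w η : ℂ × ℂ} (hw : w ∈ bidisk)
    (hη : η ∈ Metric.closedBall (0 : ℂ × ℂ) 1) : ContDiffAt ℝ 1 (bidiskKernel w) η := by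
  obtain ⟨h1, h2⟩ := one_sub_mul_conjProd_ne_zero hw hη
  have h := (contDiffAt_bidiskKernelAux (q := (w, conjProd η)) h1 h2).restrict_scalars ℝ
  have hc : ContDiff ℝ 1 conjProd :=
    (Complex.conjCLE.contDiff.comp contDiff_fst).prodMk (Complex.conjCLE.contDiff.comp contDiff_snd)
  exact ContDiffAt.comp (f := fun η => (w, conjProd η)) η h (contDiffAt_const.prodMk hc.contDiffAt)

/-- Tangential derivatives pass through the Bergman integral operator. -/
theorem HasTangDeriv.fderiv_bidiskOp {w : ℂ × ℂ} (hw : w ∈ bidisk) {e : ℂ × ℂ} (he : IsBasisVec e)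
    {G G' : ℂ × ℂ → ℂ} (h : HasTangDeriv e G G') :
    DifferentiableAt ℂ (bidiskOp G) w ∧ fderiv ℂ (bidiskOp G) w e = bidiskOp G' w := by
  obtain ⟨L, hL, hLv⟩ := hasFDerivAt_integral_kernel (κ := bidiskKernelAux) (w₀ := w)
    (isCompact_closedBall (0 : ℂ × ℂ) 1)
    (fun η hη => contDiffAt_bidiskKernelAux (one_sub_mul_conjProd_ne_zero hw hη).1
      (one_sub_mul_conjProd_ne_zero hw hη).2)
    (μ := volume.restrict bidisk)
    (by
      filter_upwards [ae_restrict_mem measurableSet_bidisk] with η hη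
      exact Metric.ball_subset_closedBall hη)
    h.integrableOn_fun
  have hL' : HasFDerivAt (bidiskOp G) L w := hL
  refine ⟨hL'.differentiableAt, ?_⟩
  rw [hL'.fderiv, hLv]
  -- Since w is interior, the kernel is smooth in η up to the closed bidisk; it does not vanish at
  -- the boundary, which is why `HasTangDeriv` allows such test functions.
  have h1 := h.integral_eq _ fun η hη => contDiffAt_bidiskKernel hw hη
  calc ∫ η in bidisk, fderiv ℂ bidiskKernelAux (w, conjProd η) (e, 0) * G η
      = ∫ η in bidisk, G η * tangAdj e (bidiskKernel w) η := by
        refine setIntegral_congr_fun measurableSet_bidisk fun η hη => ?_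
        rw [fderiv_bidiskKernelAux_eq_tangAdj hw (Metric.ball_subset_closedBall hη) he, mul_comm]
    _ = bidiskOp G' w := by
        rw [h1, bidiskOp]
        simp only [mul_comm]

/-! ### Families of functions spanned by derivatives -/

variable {ι : Type*}

/-- A family of functions on the symmetrized bidisk together with their weak derivatives of order at
most `k`, represented by functions in `L^p` that vanish outside the symmetrized bidisk. -/
structure SobolevFamily (p : ℝ) (k : ℕ) (v : ι → (Fin 4 → ℕ) → ℂ × ℂ → ℂ) : Prop where
  measurable : ∀ i, ∀ α ∈ multiIndices k, Measurable (v i α)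
  memLp : ∀ i, ∀ α ∈ multiIndices k, MemLp (v i α) (ENNReal.ofReal p) volume
  eq_zero : ∀ i, ∀ α ∈ multiIndices k, ∀ z ∉ symBidisk, v i α z = 0
  integral_eq : ∀ i, ∀ α, ∀ j, α + Pi.single j 1 ∈ multiIndices k → ∀ φ : ℂ × ℂ → ℂ,
    ContDiff ℝ (⊤ : ℕ∞) φ → HasCompactSupport φ → tsupport φ ⊆ symBidisk →
      ∫ z, v i α z * wder j φ z = -∫ z, v i (α + Pi.single j 1) z * φ z

lemma mem_multiIndices {k : ℕ} {α : Fin 4 → ℕ} : α ∈ multiIndices k ↔ ∑ i, α i ≤ k := by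
  simp only [multiIndices, Finset.mem_filter, Fintype.mem_piFinset, Finset.mem_range,
    and_iff_right_iff_imp]
  intro h i
  have : α i ≤ ∑ i, α i := Finset.single_le_sum (fun _ _ => Nat.zero_le _) (Finset.mem_univ i)
  omega

lemma sum_add_single (α : Fin 4 → ℕ) (j : Fin 4) : ∑ i, (α + Pi.single j 1 : Fin 4 → ℕ) i = ∑ i, α i + 1 := by
  simp [Finset.sum_add_distrib]

lemma add_single_mem_multiIndices {m : ℕ} {α : Fin 4 → ℕ} (h : α ∈ multiIndices m) (j : Fin 4) :
    α + Pi.single j 1 ∈ multiIndices (m + 1) := by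
  rw [mem_multiIndices] at h ⊢
  rw [sum_add_single]; omega

lemma multiIndices_mono {m n : ℕ} (h : m ≤ n) : multiIndices m ⊆ multiIndices n := by
  intro α hα
  rw [mem_multiIndices] at hα ⊢
  omega

lemma SobolevFamily.hasWeakGrad {p : ℝ} {k : ℕ} {v : ι → (Fin 4 → ℕ) → ℂ × ℂ → ℂ}
    (hv : SobolevFamily p k v) {m : ℕ} (hm : m < k) {α : Fin 4 → ℕ} (hα : α ∈ multiIndices m) (i : ι) :
    HasWeakGrad p (v i α) fun j => v i (α + Pi.single j 1) := by
  have h0 : α ∈ multiIndices k := multiIndices_mono hm.le hα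
  have h1 : ∀ j, α + Pi.single j 1 ∈ multiIndices k := fun j =>
    multiIndices_mono hm (add_single_mem_multiIndices hα j)
  exact ⟨hv.measurable i α h0, fun j => hv.measurable i _ (h1 j), hv.memLp i α h0,
    fun j => hv.memLp i _ (h1 j), hv.eq_zero i α h0, fun j => hv.eq_zero i _ (h1 j),
    fun j => hv.integral_eq i α j (h1 j)⟩

/-- Sums of smooth multiples of pullbacks of derivatives of order at most `m`. -/
inductive PullbackSpan (v : ι → (Fin 4 → ℕ) → ℂ × ℂ → ℂ) (m : ℕ) : (ι → ℂ × ℂ → ℂ) → Prop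
  | base {α : Fin 4 → ℕ} (hα : α ∈ multiIndices m) {c : ℂ × ℂ → ℂ} (hc : ContDiff ℝ (⊤ : ℕ∞) c) :
    PullbackSpan v m fun i η => c η * v i α (symMap η)
  | add {E F : ι → ℂ × ℂ → ℂ} (hE : PullbackSpan v m E) (hF : PullbackSpan v m F) :
    PullbackSpan v m fun i η => E i η + F i η

/-- Sums of entire multiples of images of functions in `PullbackSpan` under the Bergman integral
operator. -/
inductive BergmanSpan (v : ι → (Fin 4 → ℕ) → ℂ × ℂ → ℂ) (m : ℕ) : (ι → ℂ × ℂ → ℂ) → Prop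
  | base {E : ι → ℂ × ℂ → ℂ} (hE : PullbackSpan v m E) {q : ℂ × ℂ → ℂ}
    (hq : ContDiff ℂ (⊤ : ℕ∞) q) : BergmanSpan v m fun i w => q w * bidiskOp (E i) w
  | add {H K : ι → ℂ × ℂ → ℂ} (hH : BergmanSpan v m H) (hK : BergmanSpan v m K) :
    BergmanSpan v m fun i w => H i w + K i w

lemma contDiff_dHol {c : ℂ × ℂ → ℂ} (hc : ContDiff ℝ (⊤ : ℕ∞) c) (e : ℂ × ℂ) :
    ContDiff ℝ (⊤ : ℕ∞) (dHol e c) := by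
  have h : ContDiff ℝ (⊤ : ℕ∞) (fderiv ℝ c) := hc.fderiv_right (by norm_num)
  unfold dHol; fun_prop

lemma contDiff_dBar {c : ℂ × ℂ → ℂ} (hc : ContDiff ℝ (⊤ : ℕ∞) c) (e : ℂ × ℂ) :
    ContDiff ℝ (⊤ : ℕ∞) (dBar e c) := by
  have h : ContDiff ℝ (⊤ : ℕ∞) (fderiv ℝ c) := hc.fderiv_right (by norm_num)
  unfold dBar; fun_prop

lemma contDiff_tang {c : ℂ × ℂ → ℂ} (hc : ContDiff ℝ (⊤ : ℕ∞) c) (e : ℂ × ℂ) :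
    ContDiff ℝ (⊤ : ℕ∞) (tang e c) := by
  have h1 := contDiff_dHol hc e
  have h2 := contDiff_dBar hc e
  unfold tang; fun_prop

variable {p : ℝ} {k m : ℕ} {v : ι → (Fin 4 → ℕ) → ℂ × ℂ → ℂ}

lemma PullbackSpan.mono {E : ι → ℂ × ℂ → ℂ} (hE : PullbackSpan v m E) :
    PullbackSpan v (m + 1) E := by
  induction hE with
  | base hα hc => exact .base (multiIndices_mono m.le_succ hα) hc
  | add _ _ h1 h2 => exact .add h1 h2

lemma BergmanSpan.mono {H : ι → ℂ × ℂ → ℂ} (hH : BergmanSpan v m H) : BergmanSpan v (m + 1) H := by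
  induction hH with
  | base hE hq => exact .base hE.mono hq
  | add _ _ h1 h2 => exact .add h1 h2

lemma BergmanSpan.mul {H : ι → ℂ × ℂ → ℂ} (hH : BergmanSpan v m H) {q : ℂ × ℂ → ℂ}
    (hq : ContDiff ℂ (⊤ : ℕ∞) q) : BergmanSpan v m fun i w => q w * H i w := by
  induction hH with
  | @base E hE q' hq' =>
    have := BergmanSpan.base hE (hq.mul hq')
    simpa only [mul_assoc] using this
  | @add H K _ _ h1 h2 =>
    have := h1.add h2
    simpa only [← mul_add] using this

/-- The field either differentiates the smooth coefficient, keeping the order, or passes to the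
pullback by the weak chain rule, raising the order by one with smooth coefficients `tangCoef`. -/
lemma PullbackSpan.exists_hasTangDeriv (hp : 1 < p) {A : ℝ≥0}
    (hA : ∀ u : ℂ × ℂ → ℝ≥0∞, Measurable u → (∫⁻ η in bidisk, u η) ^ p ≤
      A * ∫⁻ w in bidisk, u w ^ p * ‖jac w‖ₑ ^ 2)
    (hv : SobolevFamily p k v) (hm : m < k) {e : ℂ × ℂ} (he : IsBasisVec e)
    {E : ι → ℂ × ℂ → ℂ} (hE : PullbackSpan v m E) :
    ∃ E', PullbackSpan v (m + 1) E' ∧ ∀ i, HasTangDeriv e (E i) (E' i) := by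
  induction hE with
  | @base α hα c hc =>
    have hs : ∀ j, PullbackSpan v (m + 1) fun i η =>
        (c η * tangCoef e j η) * v i (α + Pi.single j 1) (symMap η) := fun j =>
      .base (add_single_mem_multiIndices hα j) (hc.mul (contDiff_tangCoef e j))
    have h0 : PullbackSpan v (m + 1) fun i η => tang e c η * v i α (symMap η) :=
      .base (multiIndices_mono m.le_succ hα) (contDiff_tang hc e)
    refine ⟨_, ((((hs 0).add (hs 1)).add (hs 2)).add (hs 3)).add h0, fun i => ?_⟩
    have := ((hv.hasWeakGrad hm hα i).hasTangDeriv hp hA he).mul hc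
    convert this using 2
    rw [Fin.sum_univ_four]
    ring
  | add _ _ h1 h2 =>
    obtain ⟨E', hE', h1⟩ := h1
    obtain ⟨F', hF', h2⟩ := h2
    exact ⟨_, hE'.add hF', fun i => (h1 i).add (h2 i)⟩

/-- A derivative hits the entire factor, or passes through the Bergman integral as a tangential
derivative of its argument. Members of the span are thus holomorphic on the bidisk while m < k. -/
lemma BergmanSpan.exists_fderiv (hp : 1 < p) {A : ℝ≥0}
    (hA : ∀ u : ℂ × ℂ → ℝ≥0∞, Measurable u → (∫⁻ η in bidisk, u η) ^ p ≤
      A * ∫⁻ w in bidisk, u w ^ p * ‖jac w‖ₑ ^ 2)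
    (hv : SobolevFamily p k v) (hm : m < k) {e : ℂ × ℂ} (he : IsBasisVec e)
    {H : ι → ℂ × ℂ → ℂ} (hH : BergmanSpan v m H) :
    ∃ H', BergmanSpan v (m + 1) H' ∧ ∀ i, ∀ w ∈ bidisk,
      DifferentiableAt ℂ (H i) w ∧ fderiv ℂ (H i) w e = H' i w := by
  induction hH with
  | @base E hE q hq =>
    obtain ⟨E', hE', h⟩ := hE.exists_hasTangDeriv hp hA hv hm he
    have hq' : ContDiff ℂ (⊤ : ℕ∞) fun w => fderiv ℂ q w e := by
      have h : ContDiff ℂ (⊤ : ℕ∞) (fderiv ℂ q) := hq.fderiv_right (by norm_num)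
      fun_prop
    refine ⟨_, (BergmanSpan.base hE' hq).add (.base hE.mono hq'), fun i w hw => ?_⟩
    obtain ⟨h1, h2⟩ := (h i).fderiv_bidiskOp hw he
    have hqd : DifferentiableAt ℂ q w := hq.differentiable (by simp) w
    refine ⟨hqd.mul h1, ?_⟩
    rw [fderiv_fun_mul hqd h1]
    simp [h2]
    ring
  | add _ _ h1 h2 =>
    obtain ⟨E', hE', h1⟩ := h1
    obtain ⟨F', hF', h2⟩ := h2
    refine ⟨_, hE'.add hF', fun i w hw => ⟨(h1 i w hw).1.add (h2 i w hw).1, ?_⟩⟩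
    rw [fderiv_fun_add (h1 i w hw).1 (h2 i w hw).1]
    simp [(h1 i w hw).2, (h2 i w hw).2]

/-! ### Weighted bounds for the two spans -/

/-- The sum of the integrals of the `p`-th powers of the derivatives of order at most `k`. -/
def familyNorm (p : ℝ) (k : ℕ) (v : ι → (Fin 4 → ℕ) → ℂ × ℂ → ℂ) (i : ι) : ℝ≥0∞ :=
  ∑ α ∈ multiIndices k, ∫⁻ z in symBidisk, ‖v i α z‖ₑ ^ p

lemma lintegral_add_rpow_le (hp : 1 < p) {C D N : ℝ≥0∞} {f g : ℂ × ℂ → ℝ≥0∞} (hf : Measurable f)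
    (h1 : ∫⁻ w in bidisk, f w ^ p * ‖jac w‖ₑ ^ 2 ≤ C * N)
    (h2 : ∫⁻ w in bidisk, g w ^ p * ‖jac w‖ₑ ^ 2 ≤ D * N) :
    ∫⁻ w in bidisk, (f w + g w) ^ p * ‖jac w‖ₑ ^ 2 ≤ 2 ^ (p - 1) * (C + D) * N := by
  calc ∫⁻ w in bidisk, (f w + g w) ^ p * ‖jac w‖ₑ ^ 2
      ≤ ∫⁻ w in bidisk, 2 ^ (p - 1) * (f w ^ p * ‖jac w‖ₑ ^ 2 + g w ^ p * ‖jac w‖ₑ ^ 2) := by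
        refine lintegral_mono fun w => ?_
        rw [← add_mul, ← mul_assoc]
        gcongr
        exact ENNReal.rpow_add_le_mul_rpow_add_rpow _ _ hp.le
    _ = 2 ^ (p - 1) * ((∫⁻ w in bidisk, f w ^ p * ‖jac w‖ₑ ^ 2) +
          (∫⁻ w in bidisk, g w ^ p * ‖jac w‖ₑ ^ 2)) := by
        rw [lintegral_const_mul' _ _ (by simp), lintegral_add_left (by fun_prop)]
    _ ≤ _ := by
        rw [mul_assoc, add_mul]
        exact mul_le_mul_right (add_le_add h1 h2) _

lemma PullbackSpan.measurable (hv : SobolevFamily p k v) (hm : m ≤ k) {E : ι → ℂ × ℂ → ℂ}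
    (hE : PullbackSpan v m E) (i : ι) : Measurable (E i) := by
  induction hE with
  | base hα hc =>
    exact hc.continuous.measurable.mul
      ((hv.measurable i _ (multiIndices_mono hm hα)).comp measurable_symMap)
  | add _ _ h1 h2 => exact h1.add h2

lemma lintegral_const_mul_rpow_le (hp : 1 < p) {M : ℝ≥0} {c f : ℂ × ℂ → ℂ}
    (hM : ∀ w ∈ bidisk, ‖c w‖ₑ ≤ M) {C N : ℝ≥0∞}
    (h : ∫⁻ w in bidisk, ‖f w‖ₑ ^ p * ‖jac w‖ₑ ^ 2 ≤ C * N) :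
    ∫⁻ w in bidisk, ‖c w * f w‖ₑ ^ p * ‖jac w‖ₑ ^ 2 ≤ (M : ℝ≥0∞) ^ p * C * N := by
  have hp0 : 0 ≤ p := by linarith
  calc ∫⁻ w in bidisk, ‖c w * f w‖ₑ ^ p * ‖jac w‖ₑ ^ 2
      ≤ ∫⁻ w in bidisk, (M : ℝ≥0∞) ^ p * (‖f w‖ₑ ^ p * ‖jac w‖ₑ ^ 2) := by
        refine setLIntegral_mono' measurableSet_bidisk fun w hw => ?_
        rw [enorm_mul, ENNReal.mul_rpow_of_nonneg _ _ hp0, mul_assoc]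
        gcongr
        exact hM w hw
    _ ≤ _ := by
        rw [lintegral_const_mul' _ _ (by simp [hp0]), mul_assoc]
        gcongr

lemma exists_enorm_le_of_continuous {c : ℂ × ℂ → ℂ} (hc : Continuous c) :
    ∃ M : ℝ≥0, ∀ w ∈ bidisk, ‖c w‖ₑ ≤ M := by
  obtain ⟨M, hM⟩ := (isCompact_closedBall (0 : ℂ × ℂ) 1).exists_bound_of_continuousOn hc.continuousOn
  refine ⟨M.toNNReal, fun w hw => ?_⟩
  rw [← ofReal_norm]
  exact ENNReal.ofReal_le_ofReal (hM w (Metric.ball_subset_closedBall hw))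

/-- |J|² is exactly the density that turns pullbacks into L^p norms downstairs. The constant depends
only on the coefficients of the span, which are shared by the whole family, hence not on i. -/
lemma PullbackSpan.exists_lintegral_le (hp : 1 < p) (hv : SobolevFamily p k v) (hm : m ≤ k)
    {E : ι → ℂ × ℂ → ℂ} (hE : PullbackSpan v m E) :
    ∃ C : ℝ≥0, ∀ i, ∫⁻ w in bidisk, ‖E i w‖ₑ ^ p * ‖jac w‖ₑ ^ 2 ≤ C * familyNorm p k v i := by
  have hp0 : 0 ≤ p := by linarith
  induction hE with
  | @base α hα c hc =>
    obtain ⟨M, hM⟩ := exists_enorm_le_of_continuous hc.continuous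
    refine ⟨M ^ p * 2, fun i => ?_⟩
    rw [ENNReal.coe_mul, ENNReal.coe_rpow_of_nonneg _ hp0]
    refine lintegral_const_mul_rpow_le hp hM ?_
    have h1 := lintegral_symMap fun z => ‖v i α z‖ₑ ^ p
    simp only [mul_comm] at h1 ⊢
    rw [h1]
    push_cast
    gcongr
    exact Finset.single_le_sum (f := fun α => ∫⁻ z in symBidisk, ‖v i α z‖ₑ ^ p)
      (fun _ _ => zero_le) (multiIndices_mono hm hα)
  | @add E F hE hF h1 h2 =>
    obtain ⟨C, hC⟩ := h1
    obtain ⟨D, hD⟩ := h2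
    refine ⟨2 ^ (p - 1) * (C + D), fun i => ?_⟩
    have h := lintegral_add_rpow_le hp (hE.measurable hv hm i).enorm (hC i) (hD i)
    refine (lintegral_mono fun w => ?_).trans (h.trans (le_of_eq ?_))
    · gcongr; exact enorm_add_le _ _
    · rw [ENNReal.coe_mul, ENNReal.coe_rpow_of_nonneg _ (by linarith), ENNReal.coe_add]; rfl

lemma BergmanSpan.measurable (hv : SobolevFamily p k v) (hm : m ≤ k) {H : ι → ℂ × ℂ → ℂ}
    (hH : BergmanSpan v m H) (i : ι) : Measurable (H i) := by
  induction hH with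
  | @base E hE q hq =>
    have hE' := hE.measurable hv hm i
    have h : StronglyMeasurable fun x : (ℂ × ℂ) × (ℂ × ℂ) => bidiskKernel x.1 x.2 * E i x.2 :=
      Measurable.stronglyMeasurable (by fun_prop)
    exact hq.continuous.measurable.mul
      (h.integral_prod_right (ν := volume.restrict bidisk)).measurable
  | add _ _ h1 h2 => exact h1.add h2

/-- The Bergman integral is dominated by the positive operator applied to the modulus, which is
bounded on L^p(|J|²). -/
lemma BergmanSpan.exists_lintegral_le (hp : 1 < p) {A : ℝ≥0}
    (hA : ∀ u : ℂ × ℂ → ℝ≥0∞, Measurable u →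
      ∫⁻ w in bidisk, (∫⁻ η in bidisk, ‖bidiskKernel w η‖ₑ * u η) ^ p * ‖jac w‖ₑ ^ 2 ≤
        A * ∫⁻ w in bidisk, u w ^ p * ‖jac w‖ₑ ^ 2)
    (hv : SobolevFamily p k v) (hm : m ≤ k) {H : ι → ℂ × ℂ → ℂ} (hH : BergmanSpan v m H) :
    ∃ C : ℝ≥0, ∀ i, ∫⁻ w in bidisk, ‖H i w‖ₑ ^ p * ‖jac w‖ₑ ^ 2 ≤ C * familyNorm p k v i := by
  have hp0 : 0 ≤ p := by linarith
  induction hH with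
  | @base E hE q hq =>
    obtain ⟨M, hM⟩ := exists_enorm_le_of_continuous hq.continuous
    obtain ⟨C, hC⟩ := hE.exists_lintegral_le hp hv hm
    refine ⟨M ^ p * (A * C), fun i => ?_⟩
    rw [ENNReal.coe_mul, ENNReal.coe_rpow_of_nonneg _ hp0]
    refine lintegral_const_mul_rpow_le hp hM ?_
    calc ∫⁻ w in bidisk, ‖bidiskOp (E i) w‖ₑ ^ p * ‖jac w‖ₑ ^ 2
        ≤ ∫⁻ w in bidisk, (∫⁻ η in bidisk, ‖bidiskKernel w η‖ₑ * ‖E i η‖ₑ) ^ p * ‖jac w‖ₑ ^ 2 := by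
          refine lintegral_mono fun w => ?_
          gcongr
          refine (enorm_integral_le_lintegral_enorm _).trans (le_of_eq ?_)
          simp only [enorm_mul]
      _ ≤ A * ∫⁻ w in bidisk, ‖E i w‖ₑ ^ p * ‖jac w‖ₑ ^ 2 := hA _ (hE.measurable hv hm i).enorm
      _ ≤ _ := by
          rw [ENNReal.coe_mul, mul_assoc]
          gcongr
          exact hC i
  | @add E F hE hF h1 h2 =>
    obtain ⟨C, hC⟩ := h1
    obtain ⟨D, hD⟩ := h2
    refine ⟨2 ^ (p - 1) * (C + D), fun i => ?_⟩
    have h := lintegral_add_rpow_le hp (hE.measurable hv hm i).enorm (hC i) (hD i)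
    refine (lintegral_mono fun w => ?_).trans (h.trans (le_of_eq ?_))
    · gcongr; exact enorm_add_le _ _
    · rw [ENNReal.coe_mul, ENNReal.coe_rpow_of_nonneg _ (by linarith), ENNReal.coe_add]; rfl

/-! ### Holomorphic families and their derivatives -/

lemma wder_eq_of_differentiableAt {φ : ℂ × ℂ → ℂ} {z : ℂ × ℂ} (hφ : DifferentiableAt ℂ φ z) :
    wder 0 φ z = fderiv ℂ φ z (1, 0) ∧ wder 1 φ z = 0 ∧ wder 2 φ z = fderiv ℂ φ z (0, 1) ∧
      wder 3 φ z = 0 :=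
  ⟨dHol_eq_of_differentiableAt hφ, dBar_eq_of_differentiableAt hφ, dHol_eq_of_differentiableAt hφ,
    dBar_eq_of_differentiableAt hφ⟩

lemma differentiableOn_wder {Ω : Set (ℂ × ℂ)} (hΩ : IsOpen Ω) {f : ℂ × ℂ → ℂ}
    (hf : DifferentiableOn ℂ f Ω) (j : Fin 4) : DifferentiableOn ℂ (wder j f) Ω := by
  have h := fun z hz => wder_eq_of_differentiableAt (hf.differentiableAt (hΩ.mem_nhds hz) (x := z))
  fin_cases j
  · exact (differentiableOn_fderiv_apply hΩ hf (1, 0)).congr fun z hz => (h z hz).1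
  · exact (differentiableOn_const 0).congr fun z hz => (h z hz).2.1
  · exact (differentiableOn_fderiv_apply hΩ hf (0, 1)).congr fun z hz => (h z hz).2.2.1
  · exact (differentiableOn_const 0).congr fun z hz => (h z hz).2.2.2

/-- A family of holomorphic functions `u` on the symmetrized bidisk such that the product of the
pullback of `u` with the `(2m+1)`-st power of the Jacobian lies in `BergmanSpan v m`. -/
structure HasOrder {ι : Type*} (v : ι → (Fin 4 → ℕ) → ℂ × ℂ → ℂ) (m : ℕ) (u : ι → ℂ × ℂ → ℂ) :
    Prop where
  differentiableOn : ∀ i, DifferentiableOn ℂ (u i) symBidisk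
  exists_eq : ∃ H, BergmanSpan v m H ∧
    ∀ i, ∀ w ∈ bidisk, jac w ^ (2 * m + 1) * u i (symMap w) = H i w

variable {ι : Type*} {p : ℝ} {k m : ℕ} {v : ι → (Fin 4 → ℕ) → ℂ × ℂ → ℂ}

lemma contDiff_jac {n : WithTop ℕ∞} : ContDiff ℂ n jac := by unfold jac; fun_prop

/-- For e = (1, 0) and (0, 1) this is a linear system for the two partial derivatives of u, with
coefficient rows (1, w₂) and (1, w₁) and determinant J. -/
lemma fderiv_jac_pow_mul {u : ℂ × ℂ → ℂ} {w : ℂ × ℂ} (hu : DifferentiableAt ℂ u (symMap w)) (n : ℕ)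
    (e : ℂ × ℂ) : fderiv ℂ (fun w => jac w ^ (n + 1) * u (symMap w)) w e =
      (n + 1) * jac w ^ n * (e.1 - e.2) * u (symMap w) + jac w ^ (n + 1) *
        ((e.1 + e.2) * fderiv ℂ u (symMap w) (1, 0) +
          (w.1 * e.2 + w.2 * e.1) * fderiv ℂ u (symMap w) (0, 1)) := by
  have h1 : HasFDerivAt jac (ContinuousLinearMap.fst ℂ ℂ ℂ - ContinuousLinearMap.snd ℂ ℂ ℂ) w :=
    ContinuousLinearMap.hasFDerivAt (ContinuousLinearMap.fst ℂ ℂ ℂ - ContinuousLinearMap.snd ℂ ℂ ℂ)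
  have h2 := hu.hasFDerivAt.comp w (hasFDerivAt_symMap w)
  have h3 : HasFDerivAt (fun w => jac w ^ (n + 1) * u (symMap w)) _ w := (h1.pow (n + 1)).mul h2
  have h4 : symMapDeriv w e = (e.1 + e.2) • ((1, 0) : ℂ × ℂ) +
      (w.1 * e.2 + w.2 * e.1) • ((0, 1) : ℂ × ℂ) := by
    rw [symMapDeriv_apply]; simp
  rw [h3.fderiv]
  simp only [add_apply, smul_apply, ContinuousLinearMap.comp_apply, h4, map_add, map_smul]
  simp
  ring

/-- Eliminating one unknown from the system in `fderiv_jac_pow_mul` costs one power of J. The term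
of order zero carries only J^(2m), and one more power restores the J^(2m+1) that is already
controlled. Hence the exponent grows by two. -/
lemma HasOrder.wder (hp : 1 < p) {A : ℝ≥0}
    (hA : ∀ u : ℂ × ℂ → ℝ≥0∞, Measurable u → (∫⁻ η in bidisk, u η) ^ p ≤
      A * ∫⁻ w in bidisk, u w ^ p * ‖jac w‖ₑ ^ 2)
    (hv : SobolevFamily p k v) (hm : m < k) {u : ι → ℂ × ℂ → ℂ} (hu : HasOrder v m u) (j : Fin 4) :
    HasOrder v (m + 1) fun i => wder j (u i) := by
  refine ⟨fun i => differentiableOn_wder isOpen_symBidisk (hu.differentiableOn i) j, ?_⟩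
  obtain ⟨H, hH, hHu⟩ := hu.exists_eq
  obtain ⟨H₁, hH₁, h1⟩ := hH.exists_fderiv hp hA hv hm (Or.inl rfl)
  obtain ⟨H₂, hH₂, h2⟩ := hH.exists_fderiv hp hA hv hm (Or.inr rfl)
  have hd : ∀ i, ∀ w ∈ bidisk, DifferentiableAt ℂ (u i) (symMap w) := fun i w hw =>
    (hu.differentiableOn i).differentiableAt (isOpen_symBidisk.mem_nhds (symMap_mem hw))
  have key : ∀ i, ∀ w ∈ bidisk, ∀ e, fderiv ℂ (H i) w e = (2 * m + 1) * jac w ^ (2 * m) *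
      (e.1 - e.2) * u i (symMap w) + jac w ^ (2 * m + 1) *
        ((e.1 + e.2) * fderiv ℂ (u i) (symMap w) (1, 0) +
          (w.1 * e.2 + w.2 * e.1) * fderiv ℂ (u i) (symMap w) (0, 1)) := by
    intro i w hw e
    have he : H i =ᶠ[nhds w] fun w => jac w ^ (2 * m + 1) * u i (symMap w) := by
      filter_upwards [isOpen_bidisk.mem_nhds hw] with x hx
      exact (hHu i x hx).symm
    rw [he.fderiv_eq, fderiv_jac_pow_mul (hd i w hw)]
    push_cast
    ring
  have k1 : ∀ i, ∀ w ∈ bidisk, H₁ i w = _ := fun i w hw => (h1 i w hw).2.symm.trans (key i w hw _)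
  have k2 : ∀ i, ∀ w ∈ bidisk, H₂ i w = _ := fun i w hw => (h2 i w hw).2.symm.trans (key i w hw _)
  -- The antiholomorphic derivatives vanish; this is the zero family written as a member of the
  -- span.
  have hz : BergmanSpan v (m + 1) fun i w => 0 * H i w := hH.mono.mul (contDiff_const (c := 0))
  have hw := fun i w hw => wder_eq_of_differentiableAt (hd i w hw)
  have hJ := contDiff_jac (n := ((⊤ : ℕ∞) : WithTop ℕ∞))
  fin_cases j
  -- The combination is J^(2m+3) ∂₁u = J (w₁ H₁ - w₂ H₂) - (2m + 1)(w₁ + w₂) H.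
  · refine ⟨_, ((hH₁.mul (hJ.mul contDiff_fst)).add (hH₂.mul (hJ.mul contDiff_snd).neg)).add
      (hH.mono.mul ((contDiff_const (c := -(2 * (m : ℂ) + 1))).mul
        (contDiff_fst.add contDiff_snd))), fun i w h => ?_⟩
    simp only [Fin.zero_eta, (hw i w h).1, k1 i w h, k2 i w h, ← hHu i w h]
    simp only [jac]
    ring
  · refine ⟨_, hz, fun i w h => ?_⟩
    simp only [Fin.mk_one, (hw i w h).2.1, mul_zero, zero_mul]
  -- The combination is J^(2m+3) ∂₂u = J (H₂ - H₁) + 2(2m + 1) H.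
  · refine ⟨_, ((hH₂.mul hJ).add (hH₁.mul hJ.neg)).add
      (hH.mono.mul (contDiff_const (c := 2 * (2 * (m : ℂ) + 1)))), fun i w h => ?_⟩
    simp only [Fin.reduceFinMk, (hw i w h).2.2.1, k1 i w h, k2 i w h, ← hHu i w h]
    simp only [jac]
    ring
  · refine ⟨_, hz, fun i w h => ?_⟩
    simp only [Fin.reduceFinMk, (hw i w h).2.2.2, mul_zero, zero_mul]

lemma HasOrder.iterate_wder (hp : 1 < p) {A : ℝ≥0}
    (hA : ∀ u : ℂ × ℂ → ℝ≥0∞, Measurable u → (∫⁻ η in bidisk, u η) ^ p ≤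
      A * ∫⁻ w in bidisk, u w ^ p * ‖jac w‖ₑ ^ 2)
    (hv : SobolevFamily p k v) {n : ℕ} (hm : m + n ≤ k) {u : ι → ℂ × ℂ → ℂ} (hu : HasOrder v m u)
    (j : Fin 4) : HasOrder v (m + n) fun i => (SymBidisk.wder j)^[n] (u i) := by
  induction n with
  | zero => exact hu
  | succ n ih =>
    simp only [Function.iterate_succ_apply']
    exact (ih (by omega)).wder hp hA hv (by omega) j

/-- The iterated Wirtinger derivative, with the order of differentiations reversed. -/
def wirtingerRev (α : Fin 4 → ℕ) (f : ℂ × ℂ → ℂ) : ℂ × ℂ → ℂ :=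
  (wder 3)^[α 3] ((wder 2)^[α 2] ((wder 1)^[α 1] ((wder 0)^[α 0] f)))

lemma HasOrder.wirtingerRev (hp : 1 < p) {A : ℝ≥0}
    (hA : ∀ u : ℂ × ℂ → ℝ≥0∞, Measurable u → (∫⁻ η in bidisk, u η) ^ p ≤
      A * ∫⁻ w in bidisk, u w ^ p * ‖jac w‖ₑ ^ 2)
    (hv : SobolevFamily p k v) {α : Fin 4 → ℕ} (hα : α ∈ multiIndices k) {u : ι → ℂ × ℂ → ℂ}
    (hu : HasOrder v 0 u) : HasOrder v (∑ i, α i) fun i => wirtingerRev α (u i) := by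
  rw [mem_multiIndices, Fin.sum_univ_four] at hα
  rw [Fin.sum_univ_four]
  have := (((hu.iterate_wder hp hA hv (n := α 0) (by omega) 0).iterate_wder hp hA hv (n := α 1)
    (by omega) 1).iterate_wder hp hA hv (n := α 2) (by omega) 2).iterate_wder hp hA hv (n := α 3)
    (by omega) 3
  rwa [zero_add] at this

/-! ### Weak derivatives -/

/-- Smooth test functions with compact support in `Ω`. -/
structure IsTest (Ω : Set (ℂ × ℂ)) (φ : ℂ × ℂ → ℂ) : Prop where
  contDiff : ContDiff ℝ (⊤ : ℕ∞) φ
  hasCompactSupport : HasCompactSupport φ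
  tsupport_subset : tsupport φ ⊆ Ω

variable {Ω : Set (ℂ × ℂ)} {φ : ℂ × ℂ → ℂ}

lemma contDiff_wder (hφ : ContDiff ℝ (⊤ : ℕ∞) φ) (j : Fin 4) : ContDiff ℝ (⊤ : ℕ∞) (wder j φ) := by
  fin_cases j
  exacts [contDiff_dHol hφ _, contDiff_dBar hφ _, contDiff_dHol hφ _, contDiff_dBar hφ _]

lemma wder_eq_zero_of_notMem_tsupport {z : ℂ × ℂ} (hz : z ∉ tsupport φ) (j : Fin 4) :
    wder j φ z = 0 := by
  fin_cases j
  exacts [dHol_eq_zero_of_notMem_tsupport hz _, dBar_eq_zero_of_notMem_tsupport hz _,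
    dHol_eq_zero_of_notMem_tsupport hz _, dBar_eq_zero_of_notMem_tsupport hz _]

lemma IsTest.wder (hφ : IsTest Ω φ) (j : Fin 4) : IsTest Ω (wder j φ) := by
  have hsub : tsupport (SymBidisk.wder j φ) ⊆ tsupport φ :=
    closure_minimal (fun z hz => by_contra fun h => hz (wder_eq_zero_of_notMem_tsupport h j))
      (isClosed_tsupport φ)
  exact ⟨contDiff_wder hφ.contDiff j, hφ.hasCompactSupport.of_isClosed_subset (isClosed_tsupport _) hsub,
    hsub.trans hφ.tsupport_subset⟩

lemma IsTest.iterate_wder (hφ : IsTest Ω φ) (j : Fin 4) (n : ℕ) : IsTest Ω ((SymBidisk.wder j)^[n] φ) := by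
  induction n with
  | zero => exact hφ
  | succ n ih =>
    rw [Function.iterate_succ_apply']
    exact ih.wder j

lemma IsTest.eq_zero (hφ : IsTest Ω φ) {z : ℂ × ℂ} (hz : z ∉ Ω) : φ z = 0 :=
  image_eq_zero_of_notMem_tsupport fun h => hz (hφ.tsupport_subset h)

lemma wirtinger_eq (α : Fin 4 → ℕ) (φ : ℂ × ℂ → ℂ) : wirtinger α φ =
    (wder 0)^[α 0] ((wder 1)^[α 1] ((wder 2)^[α 2] ((wder 3)^[α 3] φ))) := rfl

lemma IsTest.wirtinger (hφ : IsTest Ω φ) (α : Fin 4 → ℕ) : IsTest Ω (wirtinger α φ) :=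
  (((hφ.iterate_wder 3 _).iterate_wder 2 _).iterate_wder 1 _).iterate_wder 0 _

lemma wder_eq_sum (j : Fin 4) : ∃ c : ℂ, ∃ e : ℂ × ℂ, ∀ (φ : ℂ × ℂ → ℂ) (z : ℂ × ℂ), wder j φ z =
    (1 / 2 : ℂ) * fderiv ℝ φ z e + c * fderiv ℝ φ z (Complex.I • e) := by
  fin_cases j
  · exact ⟨-Complex.I / 2, (1, 0), fun φ z => by simp [wder, dHol]; ring⟩
  · exact ⟨Complex.I / 2, (1, 0), fun φ z => by simp [wder, dBar]; ring⟩
  · exact ⟨-Complex.I / 2, (0, 1), fun φ z => by simp [wder, dHol]; ring⟩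
  · exact ⟨Complex.I / 2, (0, 1), fun φ z => by simp [wder, dBar]; ring⟩

/-- Wirtinger derivatives commute on smooth functions. -/
lemma wder_comm (hφ : ContDiff ℝ (⊤ : ℕ∞) φ) (i j : Fin 4) : wder i (wder j φ) = wder j (wder i φ) := by
  obtain ⟨c, e, hc⟩ := wder_eq_sum i
  obtain ⟨d, f, hd⟩ := wder_eq_sum j
  have hd1 : ContDiff ℝ (⊤ : ℕ∞) (fderiv ℝ φ) := hφ.fderiv_right (by norm_num)
  have hdiff : ∀ z, DifferentiableAt ℝ (fderiv ℝ φ) z := fun z => hd1.differentiable (by simp) z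
  have h1 : ∀ v z w, fderiv ℝ (fun z => fderiv ℝ φ z v) z w = fderiv ℝ (fderiv ℝ φ) z w v := by
    intro v z w
    rw [fderiv_clm_apply (hdiff z) (by fun_prop)]
    simp
  have h2 : ∀ (a b : ℂ) (v v' z w : ℂ × ℂ), fderiv ℝ (fun z => a * fderiv ℝ φ z v + b * fderiv ℝ φ z v') z w =
      a * fderiv ℝ (fderiv ℝ φ) z w v + b * fderiv ℝ (fderiv ℝ φ) z w v' := by
    intro a b v v' z w
    have hv : ∀ v, DifferentiableAt ℝ (fun z => fderiv ℝ φ z v) z := fun v =>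
      (hdiff z).clm_apply (by fun_prop)
    rw [fderiv_fun_add ((hv v).const_mul a) ((hv v').const_mul b), fderiv_const_mul (hv v),
      fderiv_const_mul (hv v')]
    simp [h1]
  have hsymm : ∀ z v w, fderiv ℝ (fderiv ℝ φ) z v w = fderiv ℝ (fderiv ℝ φ) z w v := fun z v w =>
    (hφ.contDiffAt.isSymmSndFDerivAt (by
      rw [minSmoothness_of_isRCLikeNormedField]
      exact WithTop.coe_le_coe.2 (le_top (a := (2 : ℕ∞))))).eq v w
  funext z
  rw [hc, hd, funext (hc φ), funext (hd φ)]
  rw [h2, h2, h2, h2]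
  rw [hsymm z e f, hsymm z e (Complex.I • f), hsymm z (Complex.I • e) f,
    hsymm z (Complex.I • e) (Complex.I • f)]
  ring

lemma iterate_wder_comm (hφ : ContDiff ℝ (⊤ : ℕ∞) φ) (i j : Fin 4) (n : ℕ) :
    (wder i)^[n] (wder j φ) = wder j ((wder i)^[n] φ) := by
  induction n generalizing φ with
  | zero => rfl
  | succ n ih =>
    rw [Function.iterate_succ_apply, wder_comm hφ, ih (contDiff_wder hφ i), Function.iterate_succ_apply]

/-- Commuting derivatives on the test function makes the weak derivative of order α + eⱼ a first
order weak derivative of the one of order α. -/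
lemma wirtinger_wder (hφ : IsTest Ω φ) (α : Fin 4 → ℕ) (j : Fin 4) :
    wirtinger α (wder j φ) = wirtinger (α + Pi.single j 1) φ := by
  have h3 := (hφ.iterate_wder 3 (α 3))
  have h2 := (h3.iterate_wder 2 (α 2))
  have h1 := (h2.iterate_wder 1 (α 1))
  simp only [wirtinger_eq]
  fin_cases j
  · simp [iterate_wder_comm hφ.contDiff, iterate_wder_comm h3.contDiff, iterate_wder_comm h2.contDiff,
      Function.iterate_succ_apply]
  · simp [iterate_wder_comm hφ.contDiff, iterate_wder_comm h3.contDiff,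
      Function.iterate_succ_apply]
  · simp [iterate_wder_comm hφ.contDiff, Function.iterate_succ_apply]
  · simp [Function.iterate_succ_apply]

/-- Holomorphy here is mere complex differentiability; holomorphy of the partial derivatives
supplies the C¹ regularity that integration by parts needs. -/
lemma contDiffOn_one_of_differentiableOn (hΩ : IsOpen Ω) {u : ℂ × ℂ → ℂ}
    (hu : DifferentiableOn ℂ u Ω) : ContDiffOn ℝ 1 u Ω := by
  refine ContDiffOn.restrict_scalars ℝ (𝕜' := ℂ) ?_
  have h : ContDiffOn ℂ (0 + 1) u Ω := by
    rw [contDiffOn_succ_iff_fderiv_of_isOpen hΩ]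
    refine ⟨hu, by simp, contDiffOn_zero.2 ?_⟩
    have e : fderiv ℂ u = fun z => fderiv ℂ u z (1, 0) • ContinuousLinearMap.fst ℂ ℂ ℂ +
        fderiv ℂ u z (0, 1) • ContinuousLinearMap.snd ℂ ℂ ℂ := by
      funext z
      ext <;> simp
    rw [e]
    have h1 := (differentiableOn_fderiv_apply hΩ hu (1, 0)).continuousOn
    have h2 := (differentiableOn_fderiv_apply hΩ hu (0, 1)).continuousOn
    exact (h1.smul continuousOn_const).add (h2.smul continuousOn_const)
  simpa using h

lemma integral_mul_wder (hΩ : IsOpen Ω) {u : ℂ × ℂ → ℂ} (hu : DifferentiableOn ℂ u Ω)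
    (hφ : IsTest Ω φ) (j : Fin 4) : ∫ z, u z * wder j φ z = -∫ z, wder j u z * φ z := by
  have hu1 := contDiffOn_one_of_differentiableOn hΩ hu
  have hφ1 : ContDiff ℝ 1 φ := hφ.contDiff.of_le (by exact_mod_cast le_top)
  fin_cases j
  · exact (integral_mul_dHol hΩ hu1 hφ1 hφ.hasCompactSupport hφ.tsupport_subset _).2.2
  · exact (integral_mul_dBar hΩ hu1 hφ1 hφ.hasCompactSupport hφ.tsupport_subset _).2.2
  · exact (integral_mul_dHol hΩ hu1 hφ1 hφ.hasCompactSupport hφ.tsupport_subset _).2.2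
  · exact (integral_mul_dBar hΩ hu1 hφ1 hφ.hasCompactSupport hφ.tsupport_subset _).2.2

lemma differentiableOn_iterate_wder (hΩ : IsOpen Ω) {u : ℂ × ℂ → ℂ} (hu : DifferentiableOn ℂ u Ω)
    (j : Fin 4) (n : ℕ) : DifferentiableOn ℂ ((wder j)^[n] u) Ω := by
  induction n with
  | zero => exact hu
  | succ n ih =>
    rw [Function.iterate_succ_apply']
    exact differentiableOn_wder hΩ ih j

lemma integral_mul_iterate_wder (hΩ : IsOpen Ω) {u : ℂ × ℂ → ℂ} (hu : DifferentiableOn ℂ u Ω)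
    (hφ : IsTest Ω φ) (j : Fin 4) (n : ℕ) :
    ∫ z, u z * (wder j)^[n] φ z = (-1) ^ n * ∫ z, (wder j)^[n] u z * φ z := by
  induction n generalizing u with
  | zero => simp
  | succ n ih =>
    rw [Function.iterate_succ_apply', integral_mul_wder hΩ hu (hφ.iterate_wder j n),
      ih (differentiableOn_wder hΩ hu j), Function.iterate_succ_apply, pow_succ]
    ring

/-- Holomorphic functions have weak derivatives of all orders. -/
theorem hasWeakDeriv_wirtingerRev (hΩ : IsOpen Ω) {u : ℂ × ℂ → ℂ} (hu : DifferentiableOn ℂ u Ω)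
    (α : Fin 4 → ℕ) : HasWeakDeriv Ω α u (wirtingerRev α u) := by
  have h0 := differentiableOn_iterate_wder hΩ hu 0 (α 0)
  have h1 := differentiableOn_iterate_wder hΩ h0 1 (α 1)
  have h2 := differentiableOn_iterate_wder hΩ h1 2 (α 2)
  have h3 := differentiableOn_iterate_wder hΩ h2 3 (α 3)
  refine ⟨hu.continuousOn.locallyIntegrableOn hΩ.measurableSet,
    h3.continuousOn.locallyIntegrableOn hΩ.measurableSet, fun φ hφ hc hs => ?_⟩
  have ht : IsTest Ω φ := ⟨hφ, hc, hs⟩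
  have t3 := ht.iterate_wder 3 (α 3)
  have t2 := t3.iterate_wder 2 (α 2)
  have t1 := t2.iterate_wder 1 (α 1)
  rw [setIntegral_eq_integral_of_forall_compl_eq_zero fun z hz => by
      rw [(ht.wirtinger α).eq_zero hz, mul_zero],
    setIntegral_eq_integral_of_forall_compl_eq_zero fun z hz => by rw [ht.eq_zero hz, mul_zero]]
  -- The outermost derivative on φ is the first to be moved and so becomes the innermost on u. The
  -- reversed order spares commuting derivatives of u.
  rw [wirtinger_eq, integral_mul_iterate_wder hΩ hu t1, integral_mul_iterate_wder hΩ h0 t2,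
    integral_mul_iterate_wder hΩ h1 t3, integral_mul_iterate_wder hΩ h2 ht, Fin.sum_univ_four, wirtingerRev]
  ring

lemma integrable_mul_test {v : ℂ × ℂ → ℂ} (hv : LocallyIntegrableOn v Ω) (hφ : IsTest Ω φ) :
    IntegrableOn (fun z => v z * φ z) Ω := by
  obtain ⟨M, hM⟩ := hφ.contDiff.continuous.bounded_above_of_compact_support hφ.hasCompactSupport
  have h1 : IntegrableOn v (tsupport φ) :=
    hv.integrableOn_compact_subset hφ.tsupport_subset hφ.hasCompactSupport
  have h2 : IntegrableOn (fun z => v z * φ z) (tsupport φ) :=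
    Integrable.mul_bdd (c := M) h1 hφ.contDiff.continuous.aestronglyMeasurable
      (Filter.Eventually.of_forall hM)
  have h3 : Integrable (fun z => v z * φ z) := by
    rwa [← integrableOn_iff_integrable_of_support_subset (s := tsupport φ)]
    intro z hz
    by_contra h
    exact hz (by simp [image_eq_zero_of_notMem_tsupport h])
  exact h3.integrableOn

/-- `weakDeriv` is a choice, so uniqueness is what allows norms to be computed with an explicit
derivative. Real test functions suffice. -/
lemma HasWeakDeriv.ae_eq (hΩ : IsOpen Ω) {α : Fin 4 → ℕ} {u v v' : ℂ × ℂ → ℂ}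
    (h : HasWeakDeriv Ω α u v) (h' : HasWeakDeriv Ω α u v') : v =ᵐ[volume.restrict Ω] v' := by
  have hae := hΩ.ae_eq_zero_of_integral_contDiff_smul_eq_zero (μ := volume)
    (h.locallyIntegrableOn_deriv.sub h'.locallyIntegrableOn_deriv) fun g hg hgc hgs => by
      have hsub : tsupport (fun y => (g y : ℂ)) ⊆ tsupport g :=
        tsupport_comp_subset Complex.ofReal_zero g
      have ht : IsTest Ω fun y => (g y : ℂ) := ⟨Complex.ofRealCLM.contDiff.comp hg,
        hgc.comp_left Complex.ofReal_zero, hsub.trans hgs⟩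
      have e := (h.integral_eq _ ht.contDiff ht.hasCompactSupport ht.tsupport_subset).symm.trans
        (h'.integral_eq _ ht.contDiff ht.hasCompactSupport ht.tsupport_subset)
      have e' := mul_left_cancel₀ (pow_ne_zero _ (by norm_num)) e
      have e2 : ∫ z in Ω, g z • (v - v') z = 0 := by
        have : (fun z => g z • (v - v') z) = fun z => v z * (g z : ℂ) - v' z * (g z : ℂ) := by
          funext z
          simp only [Pi.sub_apply, Complex.real_smul]; ring
        rw [this, integral_sub (integrable_mul_test h.locallyIntegrableOn_deriv ht)
          (integrable_mul_test h'.locallyIntegrableOn_deriv ht), e', sub_self]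
      rwa [setIntegral_eq_integral_of_forall_compl_eq_zero fun z hz => by
        simpa using Or.inl (ht.eq_zero hz)] at e2
  rw [Filter.EventuallyEq, ae_restrict_iff' hΩ.measurableSet]
  filter_upwards [hae] with z hz hzΩ
  exact sub_eq_zero.1 (hz hzΩ)

lemma HasWeakDeriv.congr_fun {α : Fin 4 → ℕ} {u u' v : ℂ × ℂ → ℂ}
    (h : HasWeakDeriv Ω α u v) (hu : u =ᵐ[volume.restrict Ω] u') : HasWeakDeriv Ω α u' v := by
  refine ⟨?_, h.locallyIntegrableOn_deriv, fun φ hφ hc hs => ?_⟩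
  · exact h.locallyIntegrableOn_fun.congr hu
  · rw [← h.integral_eq φ hφ hc hs]
    refine integral_congr_ae ?_
    filter_upwards [hu] with z hz
    rw [hz]

lemma hasWeakDeriv_weakDeriv {α : Fin 4 → ℕ} {u : ℂ × ℂ → ℂ} (h : ∃ v, HasWeakDeriv Ω α u v) :
    HasWeakDeriv Ω α u (weakDeriv Ω α u) := by
  rw [weakDeriv, dif_pos h]
  exact h.choose_spec

lemma hasWeakDeriv_zero {u : ℂ × ℂ → ℂ} (h : LocallyIntegrableOn u Ω) : HasWeakDeriv Ω 0 u u :=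
  ⟨h, h, fun φ _ _ _ => by simp [wirtinger]⟩

/-! ### The Sobolev estimate -/

open Classical in
/-- A measurable representative of the weak derivative of `f` of order `α` on the symmetrized bidisk,
extended by zero. -/
def sobolevRep (f : ℂ × ℂ → ℂ) (α : Fin 4 → ℕ) : ℂ × ℂ → ℂ :=
  symBidisk.indicator (if h : AEStronglyMeasurable (weakDeriv symBidisk α f)
    (volume.restrict symBidisk) then h.mk _ else 0)

lemma weightedIntegral_zero (p : ℝ) (g : ℂ × ℂ → ℂ) :
    weightedIntegral p 0 g = ∫⁻ z in symBidisk, ‖g z‖ₑ ^ p := by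
  simp [weightedIntegral]

lemma weightedIntegral_congr {p l : ℝ} {g h : ℂ × ℂ → ℂ} (hgh : g =ᵐ[volume.restrict symBidisk] h) :
    weightedIntegral p l g = weightedIntegral p l h := by
  refine lintegral_congr_ae ?_
  filter_upwards [hgh] with z hz
  rw [hz]

lemma measurable_sobolevRep (f : ℂ × ℂ → ℂ) (α : Fin 4 → ℕ) : Measurable (sobolevRep f α) := by
  refine Measurable.indicator ?_ measurableSet_symBidisk
  split_ifs with h
  · exact h.stronglyMeasurable_mk.measurable
  · exact measurable_zero

lemma sobolevRep_ae_eq {f : ℂ × ℂ → ℂ} {α : Fin 4 → ℕ} (h : ∃ v, HasWeakDeriv symBidisk α f v) :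
    sobolevRep f α =ᵐ[volume.restrict symBidisk] weakDeriv symBidisk α f := by
  have hm : AEStronglyMeasurable (weakDeriv symBidisk α f) (volume.restrict symBidisk) :=
    (hasWeakDeriv_weakDeriv h).locallyIntegrableOn_deriv.aestronglyMeasurable
  rw [sobolevRep, dif_pos hm]
  exact (indicator_ae_eq_restrict measurableSet_symBidisk).trans hm.ae_eq_mk.symm

variable {p : ℝ} {k : ℕ}

lemma memLp_sobolevRep (hp : 1 < p) {f : ℂ × ℂ → ℂ} (hf : MemSobolev k p 0 f) {α : Fin 4 → ℕ}
    (hα : α ∈ multiIndices k) : MemLp (sobolevRep f α) (ENNReal.ofReal p) volume := by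
  have h : MemLp (sobolevRep f α) (ENNReal.ofReal p) (volume.restrict symBidisk) := by
    refine ⟨(measurable_sobolevRep f α).aestronglyMeasurable, ?_⟩
    rw [eLpNorm_lt_top_iff_lintegral_rpow_enorm_lt_top (by simp; linarith) (by simp),
      ENNReal.toReal_ofReal (by linarith), ← weightedIntegral_zero,
      weightedIntegral_congr (sobolevRep_ae_eq (hf α hα).1)]
    exact (hf α hα).2
  rw [← memLp_indicator_iff_restrict measurableSet_symBidisk] at h
  simpa only [sobolevRep, indicator_indicator, inter_self] using h

/-- The index set is the Sobolev space itself, which is what makes the later constants uniform. The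
defining identities of orders α and α + eⱼ share the same integral of f, and dividing by the sign
leaves a first order integration by parts. -/
lemma sobolevFamily_sobolevRep (hp : 1 < p) :
    SobolevFamily p k fun (f : {f // MemSobolev k p 0 f}) α => sobolevRep f.1 α := by
  refine ⟨fun f α _ => measurable_sobolevRep f.1 α, fun f α hα => memLp_sobolevRep hp f.2 hα,
    fun f α _ z hz => indicator_of_notMem hz _, fun f α j hj φ hφ hc hs => ?_⟩
  have ht : IsTest symBidisk φ := ⟨hφ, hc, hs⟩
  have hα : α ∈ multiIndices k := by
    rw [mem_multiIndices] at hj ⊢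
    rw [sum_add_single] at hj; omega
  have hw := hasWeakDeriv_weakDeriv (f.2 α hα).1
  have hw' := hasWeakDeriv_weakDeriv (f.2 _ hj).1
  have e1 := hw.integral_eq _ (ht.wder j).contDiff (ht.wder j).hasCompactSupport
    (ht.wder j).tsupport_subset
  have e2 := hw'.integral_eq _ hφ hc hs
  rw [wirtinger_wder ht, e2, sum_add_single, pow_succ, mul_assoc] at e1
  have e3 := mul_left_cancel₀ (pow_ne_zero _ (by norm_num)) e1
  have c1 : ∀ z ∉ symBidisk, sobolevRep f.1 α z * wder j φ z = 0 := fun z hz => by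
    rw [(ht.wder j).eq_zero hz, mul_zero]
  have c2 : ∀ z ∉ symBidisk, sobolevRep f.1 (α + Pi.single j 1) z * φ z = 0 := fun z hz => by
    rw [ht.eq_zero hz, mul_zero]
  rw [← setIntegral_eq_integral_of_forall_compl_eq_zero c1,
    ← setIntegral_eq_integral_of_forall_compl_eq_zero c2]
  calc ∫ z in symBidisk, sobolevRep f.1 α z * wder j φ z
      = ∫ z in symBidisk, weakDeriv symBidisk α f.1 z * wder j φ z := by
        refine integral_congr_ae ?_
        filter_upwards [sobolevRep_ae_eq (f.2 α hα).1] with z hz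
        rw [hz]
    _ = -∫ z in symBidisk, weakDeriv symBidisk (α + Pi.single j 1) f.1 z * φ z := by
        rw [← e3]; ring
    _ = _ := by
        congr 1
        refine integral_congr_ae ?_
        filter_upwards [sobolevRep_ae_eq (f.2 _ hj).1] with z hz
        rw [hz]

lemma familyNorm_sobolevRep (f : {f // MemSobolev k p 0 f}) :
    familyNorm p k (fun (f : {f // MemSobolev k p 0 f}) α => sobolevRep f.1 α) f =
      ∑ α ∈ multiIndices k, weightedIntegral p 0 (weakDeriv symBidisk α f.1) := by
  refine Finset.sum_congr rfl fun α hα => ?_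
  rw [← weightedIntegral_congr (sobolevRep_ae_eq (f.2 α hα).1), weightedIntegral_zero]

/-- On the image of w the weight e^(-lδ) is |J|^(2l), and l = np/2 makes it the p-th power of |J^n|.
-/
lemma exp_delta_symMap {w : ℂ × ℂ} (hw : jac w ≠ 0) (p : ℝ) (n : ℕ) :
    ENNReal.ofReal (Real.exp (-(n * p / 2) * delta (symMap w))) = ‖jac w ^ n‖ₑ ^ p := by
  have h : 0 < ‖jac w‖ := norm_pos_iff.2 hw
  rw [← ofReal_norm, norm_pow, ENNReal.ofReal_rpow_of_pos (pow_pos h n), delta, jac_sq, norm_pow,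
    Real.log_pow, ← Real.rpow_natCast, ← Real.rpow_mul h.le, Real.rpow_def_of_pos h]
  congr 2
  push_cast
  ring

/-- The weight enters the p-th power as the factor J^n; of this, J^(2m+1) turns u into a member of
the span and the surplus is an entire multiplier. -/
lemma HasOrder.exists_weightedIntegral_le {ι : Type*} {v : ι → (Fin 4 → ℕ) → ℂ × ℂ → ℂ} {m n : ℕ}
    (hp : 1 < p) {A : ℝ≥0}
    (hA : ∀ u : ℂ × ℂ → ℝ≥0∞, Measurable u →
      ∫⁻ w in bidisk, (∫⁻ η in bidisk, ‖bidiskKernel w η‖ₑ * u η) ^ p * ‖jac w‖ₑ ^ 2 ≤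
        A * ∫⁻ w in bidisk, u w ^ p * ‖jac w‖ₑ ^ 2)
    (hv : SobolevFamily p k v) (hm : m ≤ k) (hn : 2 * m + 1 ≤ n) {u : ι → ℂ × ℂ → ℂ}
    (hu : HasOrder v m u) :
    ∃ C : ℝ≥0, ∀ i, weightedIntegral p (n * p / 2) (u i) ≤ C * familyNorm p k v i := by
  obtain ⟨H, hH, hHu⟩ := hu.exists_eq
  obtain ⟨C, hC⟩ := (hH.mul (contDiff_jac.pow (n - (2 * m + 1)))).exists_lintegral_le hp hA hv hm
  refine ⟨C, fun i => le_trans ?_ (hC i)⟩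
  calc weightedIntegral p (n * p / 2) (u i) ≤ 2 * weightedIntegral p (n * p / 2) (u i) := by
        rw [two_mul]; exact le_self_add
    _ = ∫⁻ w in bidisk, ‖jac w‖ₑ ^ 2 * (‖u i (symMap w)‖ₑ ^ p *
          ENNReal.ofReal (Real.exp (-(n * p / 2) * delta (symMap w)))) := (lintegral_symMap _).symm
    _ = ∫⁻ w in bidisk, ‖jac w ^ (n - (2 * m + 1)) * H i w‖ₑ ^ p * ‖jac w‖ₑ ^ 2 := by
        refine lintegral_congr_ae ?_
        filter_upwards [ae_restrict_mem measurableSet_bidisk, ae_restrict_of_ae volume_jac_eq_zero]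
          with w hw hj
        rw [exp_delta_symMap hj, ← hHu i w hw,
          ← mul_assoc (_ ^ (n - (2 * m + 1))), ← pow_add, Nat.sub_add_cancel hn, enorm_mul,
          ENNReal.mul_rpow_of_nonneg _ _ (by linarith)]
        ring
    _ ≤ _ := le_rfl

/-- The Bergman integral of the representative of `f`. -/
def bergmanRep (f : ℂ × ℂ → ℂ) (z : ℂ × ℂ) : ℂ :=
  ∫ ζ in symBidisk, symKernel z ζ * sobolevRep f 0 ζ

lemma zero_mem_multiIndices (k : ℕ) : (0 : Fin 4 → ℕ) ∈ multiIndices k := by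
  simp [mem_multiIndices]

/-- The start of the induction on derivatives: by the transformation formula, J times the pulled
back Bergman integral is the bidisk integral of J · (f ∘ symMap). -/
lemma hasOrder_bergmanRep (hp : 1 < p) {A : ℝ≥0}
    (hA : ∀ u : ℂ × ℂ → ℝ≥0∞, Measurable u → (∫⁻ η in bidisk, u η) ^ p ≤
      A * ∫⁻ w in bidisk, u w ^ p * ‖jac w‖ₑ ^ 2) :
    HasOrder (fun (f : {f // MemSobolev k p 0 f}) α => sobolevRep f.1 α) 0 fun f => bergmanRep f.1 := by
  have hL : ∀ f : {f // MemSobolev k p 0 f}, MemLp (sobolevRep f.1 0) (ENNReal.ofReal p) volume :=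
    fun f => memLp_sobolevRep hp f.2 (zero_mem_multiIndices k)
  have hJ : ContDiff ℝ (⊤ : ℕ∞) jac := contDiff_jac.restrict_scalars ℝ
  refine ⟨fun f => differentiableOn_integral_symKernel
    (((hL f).restrict symBidisk).integrable (by simpa using hp.le)), ?_⟩
  refine ⟨_, .base (.base (zero_mem_multiIndices 0) hJ) (contDiff_const (c := 1)), fun f w hw => ?_⟩
  rw [one_mul, bidiskOp, ← jac_mul_integral_symKernel
    (measurable_sobolevRep f.1 0).aestronglyMeasurable ?_ hw]
  · simp [bergmanRep]
  · obtain ⟨M, hM⟩ := (isCompact_closedBall (0 : ℂ × ℂ) 1).exists_bound_of_continuousOn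
      hJ.continuous.continuousOn
    refine Integrable.bdd_mul (c := M) (integrableOn_comp_symMap hp hA (measurable_sobolevRep f.1 0) (hL f))
      hJ.continuous.aestronglyMeasurable ?_
    filter_upwards [ae_restrict_mem measurableSet_bidisk] with η hη
    exact hM η (Metric.ball_subset_closedBall hη)

lemma ae_eq_sobolevRep_zero {f : ℂ × ℂ → ℂ} (hf : MemSobolev k p 0 f) :
    f =ᵐ[volume.restrict symBidisk] sobolevRep f 0 := by
  have h := (hf 0 (zero_mem_multiIndices k)).1
  have hw := hasWeakDeriv_weakDeriv h
  exact ((hasWeakDeriv_zero hw.locallyIntegrableOn_fun).ae_eq isOpen_symBidisk hw).trans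
    (sobolevRep_ae_eq h).symm

lemma MemSobolev.memLp_two (hp : 2 ≤ p) {f : ℂ × ℂ → ℂ} (hf : MemSobolev k p 0 f) :
    MemLp f 2 (volume.restrict symBidisk) := by
  have h := (memLp_sobolevRep (by linarith) hf (zero_mem_multiIndices k)).restrict symBidisk
  refine MemLp.ae_eq (ae_eq_sobolevRep_zero hf).symm (h.mono_exponent ?_)
  rw [← ENNReal.ofReal_ofNat]
  exact ENNReal.ofReal_le_ofReal hp

lemma bergmanProjection_ae_eq_bergmanRep {f : ℂ × ℂ → ℂ} (hf : MemSobolev k p 0 f)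
    (hf2 : MemLp f 2 (volume.restrict symBidisk)) :
    bergmanProjection symBidisk (hf2.toLp f) =ᵐ[volume.restrict symBidisk] bergmanRep f := by
  refine (bergmanProjection_symBidisk _).trans (Filter.Eventually.of_forall fun z => ?_)
  refine integral_congr_ae ?_
  filter_upwards [hf2.coeFn_toLp, ae_eq_sobolevRep_zero hf] with ζ h1 h2
  rw [h1, h2]

end SymBidisk

end

theorem theorem1p1 (p : ℝ) (hp : 1 < p)
    (hB : ∃ C : ℝ≥0, ∀ w₂ ∈ SymBidisk.disk,
      SymBidisk.PositiveBergmanBoundedBy SymBidisk.disk (fun w₁ => ‖w₁ - w₂‖ ^ 2) p C)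
    (k : ℕ) (hk : 0 < k) :
    ∃ C : ℝ≥0, ∀ f : ℂ × ℂ → ℂ, SymBidisk.MemSobolev k p 0 f →
      ∃ hf : MemLp f 2 (volume.restrict SymBidisk.symBidisk),
        SymBidisk.MemSobolev k p (3 * k * p / 2)
          (SymBidisk.bergmanProjection SymBidisk.symBidisk (hf.toLp f)) ∧
        SymBidisk.sobolevNorm k p (3 * k * p / 2)
            (SymBidisk.bergmanProjection SymBidisk.symBidisk (hf.toLp f)) ≤
          C * SymBidisk.sobolevNorm k p 0 f := by
  open SymBidisk in
  obtain ⟨C₀, hB⟩ := hB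
  have hp2 : 2 ≤ p := two_le_of_positiveBergmanBoundedBy hp (hB 0 (by simp [disk]))
  obtain ⟨A, hA1, hA2⟩ := exists_weighted_estimates hp hB
  have hv := sobolevFamily_sobolevRep (k := k) hp
  have hord := hasOrder_bergmanRep (k := k) hp hA2
  have hest : ∀ α ∈ multiIndices k, ∃ C : ℝ≥0, ∀ f : {f // MemSobolev k p 0 f},
      weightedIntegral p (3 * k * p / 2) (wirtingerRev α (bergmanRep f.1)) ≤ C *
        ∑ α ∈ multiIndices k, weightedIntegral p 0 (weakDeriv symBidisk α f.1) := by
    intro α hα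
    have hm := mem_multiIndices.1 hα
    -- The requirement is 2|α| + 1 ≤ 3k; it follows from |α| ≤ k and k ≥ 1.
    obtain ⟨C, hC⟩ := (hord.wirtingerRev hp hA2 hv hα).exists_weightedIntegral_le (n := 3 * k)
      hp hA1 hv hm (by omega)
    refine ⟨C, fun f => ?_⟩
    have := hC f
    rw [familyNorm_sobolevRep] at this
    exact_mod_cast this
  choose! C hC using hest
  refine ⟨(∑ α ∈ multiIndices k, C α) ^ (1 / p), fun f hf => ⟨hf.memLp_two hp2, ?_⟩⟩
  have hae := bergmanProjection_ae_eq_bergmanRep hf (hf.memLp_two hp2)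
  set P := bergmanProjection symBidisk ((hf.memLp_two hp2).toLp f)
  have hder : ∀ α, HasWeakDeriv symBidisk α P (wirtingerRev α (bergmanRep f)) := fun α =>
    (hasWeakDeriv_wirtingerRev isOpen_symBidisk (hord.differentiableOn ⟨f, hf⟩) α).congr_fun hae.symm
  have hle : ∀ α ∈ multiIndices k,
      weightedIntegral p (3 * k * p / 2) (weakDeriv symBidisk α P) ≤ C α *
        ∑ α ∈ multiIndices k, weightedIntegral p 0 (weakDeriv symBidisk α f) := by
    intro α hα
    rw [weightedIntegral_congr ((hasWeakDeriv_weakDeriv ⟨_, hder α⟩).ae_eq isOpen_symBidisk (hder α))]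
    exact hC α hα ⟨f, hf⟩
  refine ⟨fun α hα => ⟨⟨_, hder α⟩, (hle α hα).trans_lt (ENNReal.mul_lt_top (by simp) ?_)⟩, ?_⟩
  · exact ENNReal.sum_lt_top.2 fun α hα => (hf α hα).2
  · rw [sobolevNorm, sobolevNorm, ENNReal.coe_rpow_of_nonneg _ (by positivity),
      ← ENNReal.mul_rpow_of_nonneg _ _ (by positivity)]
    refine ENNReal.rpow_le_rpow ((Finset.sum_le_sum hle).trans (le_of_eq ?_)) (by positivity)
    rw [← Finset.sum_mul, ENNReal.ofNNReal_finsetSum]
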